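/- Let $\mathfrak H$ be the upper half-plane, $q=e^{2\pi i\tau}$, $\eta(\tau)=q^{1/24}\prod_{n\ge1}(1-q^n)$, and write $[\delta]$ for the function $\tau\mapsto\eta(\delta\tau)$. Put $$\mathscr B_4=\frac{[1]^4}{[2]^2},\quad \mathscr C_4=2^{3/2}\frac{[2]^4}{[1]^2},\quad \mathscr B_3=\frac{[1]^3}{[3]},\quad \mathscr C_3=3\,\frac{[3]^3}{[1]},\quad \mathscr B_2=\frac{[1]^4}{[2]^2},\quad \mathscr C_2=2^2\,\frac{[4]^4}{[2]^2},$$ $$\mathscr A_4=\frac{(2^6[2]^{24}+[1]^{24})^{1/4}}{[1]^2[2]^2},\quad \mathscr A_3=\frac{(3^3[3]^{12}+[1]^{12})^{1/3}}{[1][3]},\quad \mathscr A_2=\frac{(2^4[4]^8+[1]^8)^{1/2}}{[2]^2},$$ where near $i\infty$ the roots are the branches for which $\mathscr A_r\to1$ as $\tau\to i\infty$. Then ${\mathscr A_4}^2$, $\mathscr A_3$ and $\mathscr A_2$ continue to (single-valued) holomorphic functions on $\mathfrak H$, denoted in the same way, and ${\mathscr A_r}^r={\mathscr B_r}^r+{\mathscr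 C_r}^r$ for $r=4,3,2$; powers ${\mathscr A_4}^{2m}$ mean $({\mathscr A_4}^2)^m$. For $c=(c_0,\dots,c_{N-1})\in\mathbf C^N$, with indices read mod $N$, let $$\sigma_k(n;c_0,\dots,c_{N-1})=\sum_{d\mid n}c_d\,d^k,\qquad \sigma^{\mathrm c}_k(n;c_0,\dots,c_{N-1})=\sum_{d\mid n}c_{n/d}\,d^k .$$ For primitive Dirichlet characters $\psi,\phi$ and $k\ge1$ let $\hat E_k(\psi,\phi)=\sum_{n\ge1}\bigl[\sum_{d\mid n}\psi(n/d)\phi(d)d^{k-1}\bigr]q^n$, and let $E_k^{\psi,\phi}(q)=1+\frac{2}{L(1-k,\phi)}\hat E_k(\mathbf 1,\phi)$ if $\psi=\mathbf 1$ is the trivial character of period $1$, and $E_k^{\psi,\phi}(q)=2\hat E_k(\psi,\phi)$ otherwise. Put $E_k=E_k^{\mathbf 1,\mathbf 1}$, $\chi_{-3}(d)=\bigl(\frac d3\bigr)$, $\chi_{-4}(d)=\bigl(\frac{-4}d\bigr)$. Let $M_k(\Gamma_0(N),\chi)$ be the space of holomorphic functions $f$ on $\mathfrak H$ with $f\bigl(\frac{a\tau+b}{c\tau+d}\bigr)=\chi(d)(c\tau+d)^kf(\tau)$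 for all $\left(\begin{smallmatrix}a&b\\c&d\end{smallmatrix}\right)\in\Gamma_0(N)$ that are holomorphic at all cusps, and $M_k(\Gamma_0(N))$ that space for the principal character mod $N$. Then each of the following functions belongs to the stated space, and the stated representations as a convergent $q$-series (sums over $n\ge1$) and as a combination of Eisenstein series hold on $\mathfrak H$. $M_2(\Gamma_0(2))$: - ${\mathscr A_4}^2=1+24\sum\sigma_1(n;0,1)q^n=2E_2(q^2)-E_2(q)$. $M_4(\Gamma_0(2))$: - ${\mathscr A_4}^4=1+24\sum\sigma_3(n;3,2)q^n=\frac15[4E_4(q^2)+E_4(q)]$; - ${\mathscr B_4}^4=1-16\sum\sigma_3(n;-1,1)q^n=\frac1{15}[16E_4(q^2)-E_4(q)]$; - ${\mathscr C_4}^4=8\sum\sigma_3(n;7,8)q^n=-\frac4{15}[E_4(q^2)-E_4(q)]$. $M_6(\Gamma_0(2))$: - ${\mathscr A_4}^6=1+18\sum\sigma_5(n;3,4)q^n=\frac17[8E_6(q^2)-E_6(q)]$; - ${\mathscr A_4}^2{\mathscr B_4}^4=1+8\sum\sigma_5(n;-1,1)q^n=\frac1{63}[64E_6(q^2)-E_6(q)]$;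 - ${\mathscr A_4}^2{\mathscr C_4}^4=2\sum\sigma_5(n;31,32)q^n=\frac8{63}[E_6(q^2)-E_6(q)]$. $M_1(\Gamma_0(3),\chi_{-3})$: - $\mathscr A_3=1+6\sum\sigma_0(n;0,1,-1)q^n=E_1^{\mathbf 1,\chi_{-3}}(q)$. $M_2(\Gamma_0(3))$: - ${\mathscr A_3}^2=1+12\sum\sigma_1(n;0,1,1)q^n=\frac12[3E_2(q^3)-E_2(q)]$. $M_3(\Gamma_0(3),\chi_{-3})$: - ${\mathscr A_3}^3=1+\sum[-9\sigma_2(n;0,1,-1)+27\sigma^{\mathrm c}_2(n;0,1,-1)]q^n=E_3^{\mathbf 1,\chi_{-3}}(q)+\frac{27}2E_3^{\chi_{-3},\mathbf 1}(q)$; - ${\mathscr B_3}^3=1-9\sum\sigma_2(n;0,1,-1)q^n=E_3^{\mathbf 1,\chi_{-3}}(q)$; - ${\mathscr C_3}^3=27\sum\sigma^{\mathrm c}_2(n;0,1,-1)q^n=\frac{27}2E_3^{\chi_{-3},\mathbf 1}(q)$. $M_4(\Gamma_0(3))$: - ${\mathscr A_3}^4=1+8\sum\sigma_3(n;4,3,3)q^n=\frac1{10}[9E_4(q^3)+E_4(q)]$;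 - $\mathscr A_3{\mathscr B_3}^3=1-3\sum\sigma_3(n;-2,1,1)q^n=\frac1{80}[81E_4(q^3)-E_4(q)]$; - $\mathscr A_3{\mathscr C_3}^3=\sum\sigma_3(n;26,27,27)q^n=-\frac9{80}[E_4(q^3)-E_4(q)]$. $M_5(\Gamma_0(3),\chi_{-3})$: - ${\mathscr A_3}^5=1+\sum[3\sigma_4(n;0,1,-1)+27\sigma^{\mathrm c}_4(n;0,1,-1)]q^n=E_5^{\mathbf 1,\chi_{-3}}(q)+\frac{27}2E_5^{\chi_{-3},\mathbf 1}(q)$; - ${\mathscr A_3}^2{\mathscr B_3}^3=1+3\sum\sigma_4(n;0,1,-1)q^n=E_5^{\mathbf 1,\chi_{-3}}(q)$; - ${\mathscr A_3}^2{\mathscr C_3}^3=27\sum\sigma^{\mathrm c}_4(n;0,1,-1)q^n=\frac{27}2E_5^{\chi_{-3},\mathbf 1}(q)$. $M_1(\Gamma_0(4),\chi_{-4})$: - $\mathscr A_2=1+4\sum\sigma_0(n;0,1,0,-1)q^n=E_1^{\mathbf 1,\chi_{-4}}(q)$. $M_2(\Gamma_0(4))$: - ${\mathscr A_2}^2=1+8\sum\sigma_1(n;0,1,1,1)q^n=\frac13[4E_2(q^4)-E_2(q)]$;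 - ${\mathscr B_2}^2=1-8\sum\sigma_1(n;0,1,-2,1)q^n=\frac13[8E_2(q^4)-6E_2(q^2)+E_2(q)]$; - ${\mathscr C_2}^2=8\sum\sigma_1(n;0,2,-1,2)q^n=-\frac23[2E_2(q^4)-3E_2(q^2)+E_2(q)]$. $M_3(\Gamma_0(4),\chi_{-4})$: - ${\mathscr A_2}^3=1+\sum[-4\sigma_2(n;0,1,0,-1)+16\sigma^{\mathrm c}_2(n;0,1,0,-1)]q^n=E_3^{\mathbf 1,\chi_{-4}}(q)+8E_3^{\chi_{-4},\mathbf 1}(q)$; - $\mathscr A_2{\mathscr B_2}^2=1-4\sum\sigma_2(n;0,1,0,-1)q^n=E_3^{\mathbf 1,\chi_{-4}}(q)$; - $\mathscr A_2{\mathscr C_2}^2=16\sum\sigma^{\mathrm c}_2(n;0,1,0,-1)q^n=8E_3^{\chi_{-4},\mathbf 1}(q)$. $M_4(\Gamma_0(4))$: - ${\mathscr A_2}^4=1+4\sum\sigma_3(n;4,4,3,4)q^n=\frac1{15}[16E_4(q^4)-2E_4(q^2)+E_4(q)]$; - ${\mathscr B_2}^4=1-16\sum\sigma_3(n;-1,1)q^n=\frac1{15}[16E_4(q^2)-E_4(q)]$;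 - ${\mathscr C_2}^4=4\sum\sigma_3(n;7,0,8,0)q^n=-\frac{16}{15}[E_4(q^4)-E_4(q^2)]$; - ${\mathscr A_2}^2{\mathscr B_2}^2=1-2\sum\sigma_3(n;-1,0,1,0)q^n=\frac1{15}[16E_4(q^4)-E_4(q^2)]$; - ${\mathscr A_2}^2{\mathscr C_2}^2=2\sum\sigma_3(n;7,8)q^n=-\frac1{15}[E_4(q^2)-E_4(q)]$; - ${\mathscr B_2}^2{\mathscr C_2}^2=2\sum\sigma_3(n;-7,8,-9,8)q^n=\frac1{15}[16E_4(q^4)-17E_4(q^2)+E_4(q)]$. -/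

import Mathlib

open UpperHalfPlane Filter Topology
open scoped Manifold MatrixGroups ModularForm

namespace RamanujanTriples

noncomputable section

/-! ### Weighted divisor functions -/

/-- `σ_k(n; c(0), …, c(N-1)) = ∑_{d ∣ n} c(d mod N) d^k`. -/
def divSum (k : ℕ) {N : ℕ} [NeZero N] (c : Fin N → ℂ) (n : ℕ) : ℂ :=
  ∑ d ∈ n.divisors, c (Fin.ofNat N d) * (d : ℂ) ^ k

/-- The conjugate function `σᶜ_k(n; c(0), …, c(N-1)) = ∑_{d ∣ n} c((n/d) mod N) d^k`. -/
def conjDivSum (k : ℕ) {N : ℕ} [NeZero N] (c : Fin N → ℂ) (n : ℕ) : ℂ :=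
  ∑ d ∈ n.divisors, c (Fin.ofNat N (n / d)) * (d : ℂ) ^ k

/-! ### Eisenstein series, as functions of `q`, `|q| < 1` -/

/-- `q = exp(2πiτ)`. -/
def nome (τ : ℍ) : ℂ := Complex.exp (2 * Real.pi * Complex.I * (τ : ℂ))

/-- `Ê_k(ψ, φ)(q) = ∑_{n ≥ 1} (∑_{d ∣ n} ψ(n/d) φ(d) d^{k-1}) q^n`. -/
def eisensteinHat (k : ℕ) {u v : ℕ} (ψ : DirichletCharacter ℂ u) (φ : DirichletCharacter ℂ v)
    (q : ℂ) : ℂ :=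
  ∑' n : ℕ+, (∑ d ∈ (n : ℕ).divisors,
    ψ (((n : ℕ) / d : ℕ) : ZMod u) * φ (d : ZMod v) * (d : ℂ) ^ (k - 1)) * q ^ (n : ℕ)

/-- `E_k^{ψ,φ}(q)` for primitive characters `ψ` mod `u` and `φ` mod `v` (so `ψ` is the trivial
character of period one exactly when `u = 1`) and `k ≥ 1`. It is
`1 + (2 / L(1-k, φ)) Ê_k(ψ, φ)` if `u = 1`, and `2 Ê_k(ψ, φ)` otherwise. -/
def eisenstein (k : ℕ) {u v : ℕ} [NeZero v] (ψ : DirichletCharacter ℂ u)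
    (φ : DirichletCharacter ℂ v) (q : ℂ) : ℂ :=
  if u = 1 then 1 + 2 / φ.LFunction (1 - (k : ℂ)) * eisensteinHat k ψ φ q
  else 2 * eisensteinHat k ψ φ q

/-- The trivial character of period one. -/
def triv : DirichletCharacter ℂ 1 := 1

/-- `E_k = E_k^{1,1}`, the Eisenstein series on the full modular group. -/
def E (k : ℕ) (q : ℂ) : ℂ := eisenstein k triv triv q

/-- The quadratic character `d ↦ (d/3)` mod `3`, with values `0, 1, -1`. -/
def chi3 : DirichletCharacter ℂ 3 := (quadraticChar (ZMod 3)).ringHomComp (Int.castRingHom ℂ)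

/-- The quadratic character `d ↦ (-4/d)` mod `4`, with values `0, 1, 0, -1`. -/
def chi4 : DirichletCharacter ℂ 4 := ZMod.χ₄.ringHomComp (Int.castRingHom ℂ)

/-! ### The forms `𝒜_r`, `ℬ_r`, `𝒞_r` -/

/-- `[δ]`, the function `τ ↦ η(δτ)`. -/
def etaMul (δ : ℕ) (τ : ℍ) : ℂ := ModularForm.eta (δ * (τ : ℂ))

def B₄ (τ : ℍ) : ℂ := etaMul 1 τ ^ 4 / etaMul 2 τ ^ 2

def C₄ (τ : ℍ) : ℂ := ((2 : ℝ) ^ (3 / 2 : ℝ) : ℝ) * etaMul 2 τ ^ 4 / etaMul 1 τ ^ 2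

def B₃ (τ : ℍ) : ℂ := etaMul 1 τ ^ 3 / etaMul 3 τ

def C₃ (τ : ℍ) : ℂ := 3 * etaMul 3 τ ^ 3 / etaMul 1 τ

def B₂ (τ : ℍ) : ℂ := etaMul 1 τ ^ 4 / etaMul 2 τ ^ 2

def C₂ (τ : ℍ) : ℂ := 2 ^ 2 * etaMul 4 τ ^ 4 / etaMul 2 τ ^ 2

/-- Near `i∞`, `𝒜₄ = (2⁶[2]²⁴ + [1]²⁴)^{1/4} / ([1]²[2]²)`, with the branch that tends to `1` at
`i∞`. The fourth power of the right-hand side tends to `1` at `i∞`, so this branch is its principal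
fourth root. The values far from `i∞` are not used. -/
def A₄Germ (τ : ℍ) : ℂ :=
  ((2 ^ 6 * etaMul 2 τ ^ 24 + etaMul 1 τ ^ 24) / (etaMul 1 τ ^ 2 * etaMul 2 τ ^ 2) ^ 4)
    ^ (1 / 4 : ℂ)

/-- Near `i∞`, `𝒜₃ = (3³[3]¹² + [1]¹²)^{1/3} / ([1][3])`, with the branch that tends to `1`. -/
def A₃Germ (τ : ℍ) : ℂ :=
  ((3 ^ 3 * etaMul 3 τ ^ 12 + etaMul 1 τ ^ 12) / (etaMul 1 τ * etaMul 3 τ) ^ 3) ^ (1 / 3 : ℂ)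

/-- Near `i∞`, `𝒜₂ = (2⁴[4]⁸ + [1]⁸)^{1/2} / [2]²`, with the branch that tends to `1`. -/
def A₂Germ (τ : ℍ) : ℂ :=
  ((2 ^ 4 * etaMul 4 τ ^ 8 + etaMul 1 τ ^ 8) / (etaMul 2 τ ^ 2) ^ 2) ^ (1 / 2 : ℂ)

/-- `f` is a (single-valued) holomorphic continuation to the whole upper half-plane of the
germ at `i∞` of `g`. -/
def IsContinuation (g f : ℍ → ℂ) : Prop :=
  MDifferentiable 𝓘(ℂ) 𝓘(ℂ) f ∧ f =ᶠ[atImInfty] g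

/-- There is at most one continuation. -/
theorem IsContinuation.unique {g f₁ f₂ : ℍ → ℂ} (h₁ : IsContinuation g f₁)
    (h₂ : IsContinuation g f₂) : f₁ = f₂ := by
  have hev : f₁ =ᶠ[atImInfty] f₂ := h₁.2.trans h₂.2.symm
  obtain ⟨Y, hY⟩ := (atImInfty_mem _).1 hev
  have d₁ := UpperHalfPlane.mdifferentiable_iff.1 h₁.1
  have d₂ := UpperHalfPlane.mdifferentiable_iff.1 h₂.1
  have hopen : IsOpen {z : ℂ | 0 < z.im} := isOpen_lt continuous_const Complex.continuous_im
  have hconn : IsPreconnected {z : ℂ | 0 < z.im} :=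
    (convex_halfSpace_im_gt 0).isPreconnected
  have key := (d₁.analyticOnNhd hopen).eqOn_of_preconnected_of_eventuallyEq
    (d₂.analyticOnNhd hopen) hconn (z₀ := ((|Y| + 1 : ℝ) : ℂ) * Complex.I)
    (by
      have : 0 < |Y| + 1 := by positivity
      simpa using this)
    (by
      have hU : IsOpen {z : ℂ | |Y| < z.im} := isOpen_lt continuous_const Complex.continuous_im
      filter_upwards [hU.mem_nhds (by simp : ((|Y| + 1 : ℝ) : ℂ) * Complex.I ∈ _)] with z hz
      have hz0 : 0 < z.im := lt_of_le_of_lt (abs_nonneg Y) hz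
      simp only [Function.comp_apply, ofComplex_apply_of_im_pos hz0]
      exact hY ⟨z, hz0⟩ ((le_abs_self Y).trans (le_of_lt hz)))
  funext τ
  have := key τ.im_pos
  simpa using this

open Classical in
/-- The holomorphic continuation to the upper half-plane of the germ of `g` at `i∞`, if there
is one. -/
def continuation (g : ℍ → ℂ) : ℍ → ℂ :=
  if h : ∃ f, IsContinuation g f then h.choose else 0

/-- `𝒜₄²`, a single-valued function (whereas `𝒜₄` is multivalued on the upper half-plane). -/
def A₄Sq : ℍ → ℂ := continuation (fun τ => A₄Germ τ ^ 2)

def A₃ : ℍ → ℂ := continuation A₃Germ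

def A₂ : ℍ → ℂ := continuation A₂Germ

/-! ### Modular forms with character, and the rows of the table -/

/-- `f ∈ M_k(Γ₀(N), χ)`. -/
structure IsModularFormWithChar (N : ℕ) (χ : DirichletCharacter ℂ N) (k : ℕ) (f : ℍ → ℂ) :
    Prop where
  holo : MDifferentiable 𝓘(ℂ) 𝓘(ℂ) f
  transform : ∀ γ ∈ CongruenceSubgroup.Gamma0 N, ∀ τ : ℍ,
    f (γ • τ) = χ ((γ 1 1 : ℤ) : ZMod N) * ((γ 1 0 : ℤ) * (τ : ℂ) + (γ 1 1 : ℤ)) ^ k * f τ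
  bdd_at_cusps : ∀ γ : SL(2, ℤ), IsBoundedAtImInfty (f ∣[(k : ℤ)] γ)

/-- A row of the table: `f` belongs to `M_k(Γ₀(N), χ)`, it has the convergent expansion
`f = a₀ + ∑_{n ≥ 1} a(n) q^n`, and it is equal to the function `e` of `q`. -/
structure Row (N : ℕ) (χ : DirichletCharacter ℂ N) (k : ℕ) (f : ℍ → ℂ) (a₀ : ℂ) (a : ℕ → ℂ)
    (e : ℂ → ℂ) : Prop where
  modular : IsModularFormWithChar N χ k f
  qExpansion : ∀ τ : ℍ, HasSum (fun n : ℕ+ => a n * nome τ ^ (n : ℕ)) (f τ - a₀)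
  eisenstein : ∀ τ : ℍ, f τ = e (nome τ)

end

end RamanujanTriples

open RamanujanTriples

/-!
The functions in the table are holomorphic functions of the nome `q` on the unit disc (`IsQ`), and
their transforms under the Fricke involution `W : τ ↦ -1/(Nτ)` are known explicitly. For `N ≤ 4`
this is enough for modularity: `Γ₀(N)` is generated by `-1`, the translation `T` and the
`W`-conjugate of `T` (`gamma0_le`, a Euclidean algorithm), and every unit modulo `N` is `± 1`, so
that only the parity of the character matters. The cusps are `i∞`, its `W`-image `0`, and for `N =
4` also `1/2`, which is reached by means of the translation by one half. A pair of functions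
exchanged by `W`, bounded at the cusp `1/2` if `N = 4`, is a `FrickePair`; its first member is a
modular form (`FrickePair.isModularFormWithChar`), and in weight zero it is constant
(`FrickePair.eq_const`).

The functions `ℬ_r` and `𝒞_r` are eta quotients: they have no zeros on `ℍ`, `ℬ_r` is `1` at `i∞` and
`𝒞_r` is `0` there, and `W` exchanges `ℬ_r^r` and `𝒞_r^r` up to a constant. Hence two forms of the
same weight, both vanishing at the cusp `0`, can be compared through their quotient, if the
denominator is such an eta quotient (`eq_mul_of_fricke`), and a form of small weight that vanishes
at `i∞` is zero (`eq_zero_of_fricke`). In this way the basic identities reduce to one or two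
coefficients at `i∞`.

The continuations of the germs are given in closed form: `𝒜₄²` is the Eisenstein series `eisTwo`,
`𝒜₃` is the quotient `cubicA` of an Eisenstein series of weight four by `ℬ₃³`, and `𝒜₂` is the eta
quotient `thetaSq`. The relations `𝒜_r^r = ℬ_r^r + 𝒞_r^r` (`eisTwo_sq`, `cubicA_pow_three`,
`thetaSq_sq`) show that they agree with the germs near `i∞`, where the principal root is the one
with limit `1`.

* Even weight: the transformation of `E₂`, `E₄`, `E₆` under `τ ↦ -1/τ` yields that of the series in
  `q^M`, and the identities of the table follow by comparison as above. At level four they are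
  derived from those at level two by `τ ↦ 2τ` and by taking square roots of functions of the nome.
* Weight one: `𝒜₃²` and `𝒜₂²` are already known in terms of `E₂`. The squares of the Lambert series
  `1 + 6 ∑ χ₋₃(d) q^(dm)` and `1 + 4 ∑ χ₋₄(d) q^(dm)` have the same expressions: they are the
  squares of bilateral series `∑ x / (1 + s x + x²)` over `x = qᵐ`, `s = 1, 0`, and are evaluated by
  partial fractions (`sq_tsum_kernel`, `sq_lambert_three`, `sq_lambert_four`).
* Weights three and five: the Lambert series attached to the two characters are lattice sums up to
  constants, by the Lipschitz formula. A lattice sum is transformed by `τ ↦ -1/τ` by renaming the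
  summation indices, and each character is its own Fourier transform up to a Gauss sum; hence `W`
  exchanges the two Lambert series of a character (`lambert_fricke`), up to a constant that the
  comparison determines.
* The normalizing factors of the Eisenstein series are values of `L`-functions: at `-2` and `-4`
  these are values of Bernoulli polynomials, and at `0` they come from the partial fractions of the
  cotangent at `s = 1` and the functional equation (`hurwitzZetaOdd_one`, `hurwitzZetaOdd_zero`).
-/

open UpperHalfPlane Filter Topology
open scoped Manifold MatrixGroups ModularForm

namespace RamanujanTriples

/-! ### Holomorphic functions of the nome -/

lemma nome_eq_qParam (τ : ℍ) : nome τ = Function.Periodic.qParam 1 τ := by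
  simp [nome, Function.Periodic.qParam]

lemma nome_ne_zero (τ : ℍ) : nome τ ≠ 0 := Complex.exp_ne_zero _

lemma norm_nome_lt_one (τ : ℍ) : ‖nome τ‖ < 1 := by
  simpa [nome_eq_qParam] using UpperHalfPlane.norm_qParam_lt_one 1 τ

lemma nome_mem_ball (τ : ℍ) : nome τ ∈ Metric.ball (0 : ℂ) 1 := by
  simpa using norm_nome_lt_one τ

lemma tendsto_nome : Tendsto nome atImInfty (𝓝 0) := by
  simpa [funext nome_eq_qParam] using UpperHalfPlane.qParam_tendsto_atImInfty one_pos

lemma exists_nome_eq {q : ℂ} (hq : ‖q‖ < 1) (h0 : q ≠ 0) : ∃ τ : ℍ, nome τ = q :=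
  ⟨⟨_, Function.Periodic.im_invQParam_pos_of_norm_lt_one one_pos hq h0⟩, by
    rw [nome_eq_qParam]; exact Function.Periodic.qParam_right_inv one_ne_zero h0⟩

lemma nome_eq_of_coe_eq_add_int {τ τ' : ℍ} {m : ℤ} (h : (τ' : ℂ) = τ + m) :
    nome τ' = nome τ := by
  rw [nome, nome, h, mul_add, Complex.exp_add,
    show 2 * (Real.pi : ℂ) * Complex.I * m = m * (2 * Real.pi * Complex.I) by ring,
    Complex.exp_int_mul_two_pi_mul_I, mul_one]

lemma nome_eq_pow {τ τ' : ℍ} {m : ℕ} (h : (τ' : ℂ) = m * τ) : nome τ' = nome τ ^ m := by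
  rw [nome, nome, h, ← Complex.exp_nat_mul]
  ring_nf

/-- `f` is a holomorphic function of `q = nome τ` on the open unit disc (the origin included),
with expansion `a₀ + a₁ q + O(q²)`. Such an `f` is at once holomorphic on `ℍ`, invariant under
`τ ↦ τ + 1` and holomorphic at `i∞`. -/
def IsQ (f : ℍ → ℂ) (a₀ a₁ : ℂ) : Prop :=
  ∃ Φ : ℂ → ℂ, DifferentiableOn ℂ Φ (Metric.ball 0 1) ∧ Φ 0 = a₀ ∧ HasDerivAt Φ a₁ 0 ∧
    ∀ τ, f τ = Φ (nome τ)

lemma ball_mem_nhds_of_mem {q : ℂ} (hq : q ∈ Metric.ball (0 : ℂ) 1) :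
    Metric.ball (0 : ℂ) 1 ∈ 𝓝 q := Metric.isOpen_ball.mem_nhds hq

lemma IsQ.of_differentiableOn {f : ℍ → ℂ} {Φ : ℂ → ℂ}
    (hΦ : DifferentiableOn ℂ Φ (Metric.ball 0 1)) (h : ∀ τ, f τ = Φ (nome τ)) :
    ∃ a₁, IsQ f (Φ 0) a₁ :=
  ⟨_, Φ, hΦ, rfl, ((hΦ 0 (by simp)).differentiableAt
    (ball_mem_nhds_of_mem (by simp))).hasDerivAt, h⟩

namespace IsQ

variable {f g : ℍ → ℂ} {a₀ a₁ b₀ b₁ : ℂ}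

lemma const (c : ℂ) : IsQ (fun _ => c) c 0 :=
  ⟨fun _ => c, by fun_prop, rfl, hasDerivAt_const _ _, fun _ => rfl⟩

lemma nome_self : IsQ nome 0 1 := ⟨id, differentiableOn_id, rfl, hasDerivAt_id 0, fun _ => rfl⟩

lemma add (hf : IsQ f a₀ a₁) (hg : IsQ g b₀ b₁) :
    IsQ (fun τ => f τ + g τ) (a₀ + b₀) (a₁ + b₁) := by
  obtain ⟨Φ, h1, h2, h3, h4⟩ := hf
  obtain ⟨Ψ, k1, k2, k3, k4⟩ := hg
  exact ⟨fun q => Φ q + Ψ q, h1.add k1, by simp [h2, k2], h3.add k3, fun τ => by simp only [h4, k4]⟩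

lemma mul (hf : IsQ f a₀ a₁) (hg : IsQ g b₀ b₁) :
    IsQ (fun τ => f τ * g τ) (a₀ * b₀) (a₁ * b₀ + a₀ * b₁) := by
  obtain ⟨Φ, h1, h2, h3, h4⟩ := hf
  obtain ⟨Ψ, k1, k2, k3, k4⟩ := hg
  refine ⟨fun q => Φ q * Ψ q, h1.mul k1, by simp [h2, k2], ?_, fun τ => by simp only [h4, k4]⟩
  simpa [h2, k2] using h3.fun_mul k3

lemma const_mul (c : ℂ) (hf : IsQ f a₀ a₁) : IsQ (fun τ => c * f τ) (c * a₀) (c * a₁) := by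
  simpa using (const c).mul hf

lemma sub (hf : IsQ f a₀ a₁) (hg : IsQ g b₀ b₁) :
    IsQ (fun τ => f τ - g τ) (a₀ - b₀) (a₁ - b₁) := by
  simpa [sub_eq_add_neg] using hf.add (hg.const_mul (-1))

lemma congr (hf : IsQ f a₀ a₁) (h : ∀ τ, g τ = f τ) : IsQ g a₀ a₁ := by
  rwa [funext h]

lemma pow (hf : IsQ f a₀ a₁) (n : ℕ) :
    IsQ (fun τ => f τ ^ n) (a₀ ^ n) (n * a₀ ^ (n - 1) * a₁) := by
  obtain ⟨Φ, h1, h2, h3, h4⟩ := hf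
  refine ⟨fun q => Φ q ^ n, h1.pow n, by simp [h2], ?_, fun τ => by simp only [h4]⟩
  simpa [h2] using h3.fun_pow n

/-- A zero-free function of the nome that does not vanish at `i∞` has an inverse of the same
kind. -/
lemma inv (hf : IsQ f a₀ a₁) (h0 : a₀ ≠ 0) (hne : ∀ τ, f τ ≠ 0) :
    IsQ (fun τ => (f τ)⁻¹) a₀⁻¹ (-a₁ / a₀ ^ 2) := by
  obtain ⟨Φ, h1, h2, h3, h4⟩ := hf
  have hΦ : ∀ q ∈ Metric.ball (0 : ℂ) 1, Φ q ≠ 0 := by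
    intro q hq
    rcases eq_or_ne q 0 with rfl | hq0
    · rwa [h2]
    · obtain ⟨τ, rfl⟩ := exists_nome_eq (by simpa using hq) hq0
      rw [← h4]; exact hne τ
  refine ⟨fun q => (Φ q)⁻¹, h1.inv hΦ, by simp [h2], ?_, fun τ => by simp only [h4]⟩
  simpa [h2] using h3.fun_inv (by rwa [h2])

lemma div (hf : IsQ f a₀ a₁) (hg : IsQ g b₀ b₁) (h0 : b₀ ≠ 0) (hne : ∀ τ, g τ ≠ 0) :
    ∃ c, IsQ (fun τ => f τ / g τ) (a₀ / b₀) c :=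
  ⟨_, by simpa [div_eq_mul_inv] using hf.mul (hg.inv h0 hne)⟩

/-- A function of the nome that vanishes at `i∞` is divisible by the nome. -/
lemma factor (hf : IsQ f 0 a₁) : ∃ b, IsQ (fun τ => f τ / nome τ) a₁ b := by
  obtain ⟨Φ, h1, h2, h3, h4⟩ := hf
  have hd : DifferentiableOn ℂ (dslope Φ 0) (Metric.ball 0 1) :=
    (Complex.differentiableOn_dslope (ball_mem_nhds_of_mem (by simp))).2 h1
  have := IsQ.of_differentiableOn (f := fun τ => f τ / nome τ) hd fun τ => by
    rw [dslope_of_ne _ (nome_ne_zero τ), slope_def_field, h2, h4]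
    simp
  rwa [dslope_same, h3.deriv] at this

/-- The quotient of two functions with a zero at `i∞`, the zero of the denominator being simple and
its only one. -/
lemma div_of_zero (hf : IsQ f 0 a₁) (hg : IsQ g 0 b₁) (h0 : b₁ ≠ 0) (hne : ∀ τ, g τ ≠ 0) :
    ∃ c, IsQ (fun τ => f τ / g τ) (a₁ / b₁) c := by
  obtain ⟨_, hf'⟩ := hf.factor
  obtain ⟨_, hg'⟩ := hg.factor
  obtain ⟨c, hc⟩ := hf'.div hg' h0 fun τ => div_ne_zero (hne τ) (nome_ne_zero τ)
  refine ⟨c, hc.congr fun τ => ?_⟩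
  have := nome_ne_zero τ
  field_simp

lemma tendsto (hf : IsQ f a₀ a₁) : Tendsto f atImInfty (𝓝 a₀) := by
  obtain ⟨Φ, h1, h2, h3, h4⟩ := hf
  rw [funext h4, ← h2]
  exact h3.continuousAt.tendsto.comp tendsto_nome

lemma isBoundedAtImInfty (hf : IsQ f a₀ a₁) : IsBoundedAtImInfty f :=
  hf.tendsto.isBigO_one ℝ

lemma eq_of_coe_eq_add_int (hf : IsQ f a₀ a₁) {τ τ' : ℍ} {m : ℤ} (h : (τ' : ℂ) = τ + m) :
    f τ' = f τ := by
  obtain ⟨Φ, h1, h2, h3, h4⟩ := hf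
  rw [h4, h4, nome_eq_of_coe_eq_add_int h]

lemma coeff_unique (hf : IsQ f a₀ a₁) (hf' : IsQ f b₀ b₁) : a₀ = b₀ ∧ a₁ = b₁ := by
  have h := hf.sub hf'
  have h0 : a₀ - b₀ = 0 := tendsto_nhds_unique h.tendsto (by simp)
  rw [h0] at h
  obtain ⟨b, hb⟩ := h.factor
  have h1 : a₁ - b₁ = 0 := tendsto_nhds_unique hb.tendsto (by simp)
  exact ⟨sub_eq_zero.1 h0, sub_eq_zero.1 h1⟩

lemma mdifferentiable (hf : IsQ f a₀ a₁) : MDifferentiable 𝓘(ℂ) 𝓘(ℂ) f := by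
  obtain ⟨Φ, h1, h2, h3, h4⟩ := hf
  rw [UpperHalfPlane.mdifferentiable_iff]
  have : DifferentiableOn ℂ (fun z : ℂ => Φ (Complex.exp (2 * Real.pi * Complex.I * z)))
      {z | 0 < z.im} := by
    refine h1.comp (by fun_prop) fun z hz => ?_
    exact nome_mem_ball ⟨z, hz⟩
  refine this.congr fun z hz => ?_
  simp only [Function.comp_apply, h4, ofComplex_apply_of_im_pos hz]
  rfl

/-- A convergent `q`-series is a holomorphic function of the nome. -/
lemma of_hasSum {a : ℕ → ℂ}
    (h : ∀ τ, HasSum (fun n : ℕ+ => a n * nome τ ^ (n : ℕ)) (f τ - a₀)) :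
    IsQ f a₀ (a 1) := by
  set c : ℕ → ℂ := fun n => if n = 0 then a₀ else a n with hc
  have hs : ∀ τ, HasSum (fun n => c n * nome τ ^ n) (f τ) := by
    intro τ
    rw [← hasSum_nat_add_iff' 1]
    have h' := (Equiv.pnatEquivNat.symm.hasSum_iff).2 (h τ)
    simpa [hc, Function.comp_def] using h'
  have hrad : 1 ≤ (FormalMultilinearSeries.ofScalars ℂ c).radius := by
    refine le_of_forall_lt_imp_le_of_dense fun r hr => ?_
    rcases eq_or_ne r 0 with rfl | hr'
    · simp
    · lift r to NNReal using hr.ne_top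
      apply FormalMultilinearSeries.le_radius_of_summable
      obtain ⟨τ, hτ⟩ := exists_nome_eq (q := ((r : ℝ) : ℂ)) (by simpa using hr) (mod_cast hr')
      have := (hs τ).summable.norm
      rw [hτ] at this
      simpa using this
  have hp : HasFPowerSeriesOnBall (FormalMultilinearSeries.ofScalars ℂ c).sum
      (FormalMultilinearSeries.ofScalars ℂ c) 0 1 :=
    ((FormalMultilinearSeries.ofScalars ℂ c).hasFPowerSeriesOnBall
      (lt_of_lt_of_le one_pos hrad)).mono one_pos hrad
  refine ⟨(FormalMultilinearSeries.ofScalars ℂ c).sum, ?_, ?_, ?_, fun τ => ?_⟩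
  · have := hp.differentiableOn
    rwa [← ENNReal.coe_one, Metric.eball_coe, NNReal.coe_one] at this
  · simpa [hc, FormalMultilinearSeries.coeff_ofScalars] using (hp.coeff_zero (fun _ => 0)).symm
  · have := hp.hasFPowerSeriesAt.hasDerivAt
    simpa [FormalMultilinearSeries.coeff_ofScalars, hc] using this
  · rw [← (hs τ).tsum_eq, FormalMultilinearSeries.sum]
    simp [mul_comm]

end IsQ

/-- Two holomorphic functions of the nome with the same square and with limit `1` at `i∞` are
equal. -/
lemma eq_of_sq_eq {f g : ℍ → ℂ} {a₁ b₁ : ℂ} (hf : IsQ f 1 a₁) (hg : IsQ g 1 b₁)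
    (h : ∀ τ, f τ ^ 2 = g τ ^ 2) (τ : ℍ) : f τ = g τ := by
  obtain ⟨Φ, h1, h2, h3, h4⟩ := hf
  obtain ⟨Ψ, k1, k2, k3, k4⟩ := hg
  have hsum : ∀ᶠ q in 𝓝 (0 : ℂ), Φ q + Ψ q ≠ 0 := by
    have := (h3.continuousAt.add k3.continuousAt)
    refine this.eventually_ne ?_
    simp only [Pi.add_apply, h2, k2]; norm_num
  have hev : Φ =ᶠ[𝓝 0] Ψ := by
    filter_upwards [hsum, ball_mem_nhds_of_mem (q := 0) (by simp)] with q hq hb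
    rcases eq_or_ne q 0 with rfl | hq0
    · rw [h2, k2]
    · obtain ⟨σ, rfl⟩ := exists_nome_eq (by simpa using hb) hq0
      have := h σ
      rw [h4, k4, sq_eq_sq_iff_eq_or_eq_neg] at this
      rcases this with this | this
      · exact this
      · exact absurd (by rw [this]; ring) hq
  have := (h1.analyticOnNhd Metric.isOpen_ball).eqOn_of_preconnected_of_eventuallyEq
    (k1.analyticOnNhd Metric.isOpen_ball) (convex_ball _ _).isPreconnected
    (z₀ := 0) (by simp) hev
  rw [h4, k4]
  exact this (nome_mem_ball τ)

/-- A product of two holomorphic functions of the nome vanishes only if the one that does vanish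
identically; here the first factor is known to be nonzero near `i∞`. -/
lemma eq_zero_of_mul_eq_zero {f g : ℍ → ℂ} {a₁ b₀ b₁ : ℂ} (hf : IsQ f 1 a₁) (hg : IsQ g b₀ b₁)
    (h : ∀ τ, f τ * g τ = 0) (τ : ℍ) : g τ = 0 := by
  obtain ⟨Φ, h1, h2, h3, h4⟩ := hf
  obtain ⟨Ψ, k1, k2, k3, k4⟩ := hg
  have hne : ∀ᶠ q in 𝓝[≠] (0 : ℂ), Ψ q = 0 := by
    have h0 := (h3.continuousAt.eventually_ne (y := 0) (by rw [h2]; exact one_ne_zero))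
    filter_upwards [h0.filter_mono nhdsWithin_le_nhds, self_mem_nhdsWithin,
      mem_nhdsWithin_of_mem_nhds (ball_mem_nhds_of_mem (q := 0) (by simp))] with q hq hq0 hb
    obtain ⟨σ, rfl⟩ := exists_nome_eq (by simpa using hb) hq0
    have := h σ
    rw [h4, k4] at this
    exact (mul_eq_zero.1 this).resolve_left hq
  have := (k1.analyticOnNhd Metric.isOpen_ball).eqOn_zero_of_preconnected_of_frequently_eq_zero
    (convex_ball _ _).isPreconnected (z₀ := 0) (by simp) hne.frequently
  rw [k4]
  exact this (nome_mem_ball τ)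

/-! ### Modularity from the Fricke involution -/

lemma coe_ne_zero (τ : ℍ) : (τ : ℂ) ≠ 0 := UpperHalfPlane.ne_zero τ

/-- The point `Mτ` of the upper half-plane. -/
noncomputable def scale (M : ℕ) [NeZero M] (τ : ℍ) : ℍ :=
  ⟨M * τ, by
    have : (0 : ℝ) < M := by exact_mod_cast NeZero.pos M
    simpa using mul_pos this τ.im_pos⟩

@[simp] lemma coe_scale (M : ℕ) [NeZero M] (τ : ℍ) : (scale M τ : ℂ) = M * τ := rfl

/-- The Fricke involution `τ ↦ -1 / (Nτ)`. -/
noncomputable def fricke (N : ℕ) [NeZero N] (τ : ℍ) : ℍ :=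
  ⟨-1 / (N * τ), by
    have := UpperHalfPlane.im_inv_neg_coe_pos (scale N τ)
    rwa [inv_neg, ← one_div, ← neg_div, coe_scale] at this⟩

@[simp] lemma coe_fricke (N : ℕ) [NeZero N] (τ : ℍ) : (fricke N τ : ℂ) = -1 / (N * τ) := rfl

@[simp] lemma fricke_fricke (N : ℕ) [NeZero N] (τ : ℍ) : fricke N (fricke N τ) = τ := by
  have hN : (N : ℂ) ≠ 0 := by exact_mod_cast NeZero.ne N
  have := coe_ne_zero τ
  ext1
  simp only [coe_fricke]
  field_simp

/-- The translation `τ ↦ τ - 1/2`, which normalizes `Γ₀(4)`. -/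
noncomputable def halfShift (τ : ℍ) : ℍ := (-(1 / 2) : ℝ) +ᵥ τ

@[simp] lemma coe_halfShift (τ : ℍ) : (halfShift τ : ℂ) = τ - 1 / 2 := by
  simp [halfShift]; ring

/-- Boundedness at `i∞` is not affected by a change of scale. -/
lemma isBoundedAtImInfty_of_scale {f : ℍ → ℂ} (M : ℕ) [NeZero M] {g : ℍ → ℂ}
    (hg : IsBoundedAtImInfty g) (h : ∀ τ, f (scale M τ) = g τ) : IsBoundedAtImInfty f := by
  rw [isBoundedAtImInfty_iff] at hg ⊢
  obtain ⟨C, A, hA⟩ := hg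
  have hM : (0 : ℝ) < M := by exact_mod_cast NeZero.pos M
  refine ⟨C, M * A, fun τ hτ => ?_⟩
  let σ : ℍ := ⟨τ / M, by
    rw [Complex.div_natCast_im]; exact div_pos τ.im_pos hM⟩
  have hσ : scale M σ = τ := by
    ext1
    have : (M : ℂ) ≠ 0 := by exact_mod_cast NeZero.ne M
    simp only [coe_scale, σ]
    field_simp
  rw [← hσ, h]
  refine hA σ ?_
  have : σ.im = τ.im / M := by
    change ((τ : ℂ) / M).im = _
    rw [Complex.div_natCast_im]; rfl
  rw [this, le_div_iff₀ hM]
  linarith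

/-- The matrix `(1 0; m 1)`. -/
def lowerUnip (m : ℤ) : SL(2, ℤ) := ⟨!![1, 0; m, 1], by simp⟩

lemma coe_lowerUnip (m : ℤ) : (lowerUnip m : Matrix (Fin 2) (Fin 2) ℤ) = !![1, 0; m, 1] := rfl

/-- Rounding: a residue class modulo `c ≠ 0` has a representative of absolute value at most
`|c| / 2`. -/
lemma exists_two_mul_natAbs_le (d : ℤ) {c : ℤ} (hc : c ≠ 0) :
    ∃ j : ℤ, 2 * (d + j * c).natAbs ≤ c.natAbs := by
  have h1 := Int.emod_add_mul_ediv d c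
  have h2 := Int.emod_nonneg d hc
  have h3 := Int.emod_lt_abs d hc
  rw [Int.abs_eq_natAbs] at h3
  by_cases h : 2 * (d % c) ≤ c.natAbs
  · refine ⟨-(d / c), ?_⟩
    have : d + -(d / c) * c = d % c := by linear_combination -h1
    rw [this]; omega
  · rcases le_or_gt 0 c with hc0 | hc0
    · refine ⟨-(d / c) - 1, ?_⟩
      have : d + (-(d / c) - 1) * c = d % c - c := by linear_combination -h1
      rw [this]; omega
    · refine ⟨-(d / c) + 1, ?_⟩
      have : d + (-(d / c) + 1) * c = d % c + c := by linear_combination -h1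
      rw [this]; omega

/-- For `N ≤ 4` the group `Γ₀(N)` is generated by `-1`, the translations and the matrices
`(1 0; Ni 1)`: a double Euclidean step replaces the lower left entry `c` by one of absolute value at
most `N|c| / 4`, and for `N = 4` equality is excluded by coprimality of the lower row. -/
lemma gamma0_le {N : ℕ} (h2 : 2 ≤ N) (h4 : N ≤ 4) (H : Subgroup SL(2, ℤ)) (hneg : (-1) ∈ H)
    (hT : ∀ j : ℤ, ModularGroup.T ^ j ∈ H) (hV : ∀ i : ℤ, lowerUnip (N * i) ∈ H) :
    CongruenceSubgroup.Gamma0 N ≤ H := by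
  suffices ∀ n : ℕ, ∀ γ : SL(2, ℤ), (γ 1 0).natAbs = n → (N : ℤ) ∣ γ 1 0 → γ ∈ H by
    intro γ hγ
    exact this _ γ rfl ((ZMod.intCast_zmod_eq_zero_iff_dvd _ _).1
      (CongruenceSubgroup.Gamma0_mem.1 hγ))
  intro n
  induction n using Nat.strong_induction_on with
  | _ n ih =>
    intro γ hn hdvd
    have hdet : γ 0 0 * γ 1 1 - γ 0 1 * γ 1 0 = 1 := by
      have := Matrix.SpecialLinearGroup.det_coe γ
      rwa [Matrix.det_fin_two] at this
    by_cases hc : γ 1 0 = 0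
    · rw [hc, mul_zero, sub_zero] at hdet
      rcases Int.mul_eq_one_iff_eq_one_or_neg_one.1 hdet with ⟨ha, hd⟩ | ⟨ha, hd⟩
      · have : γ = ModularGroup.T ^ (γ 0 1) := by
          ext i j
          rw [ModularGroup.coe_T_zpow]
          fin_cases i <;> fin_cases j <;> simp [ha, hd, hc]
        rw [this]; exact hT _
      · have : γ = -1 * ModularGroup.T ^ (-γ 0 1) := by
          ext i j
          rw [Matrix.SpecialLinearGroup.coe_mul, ModularGroup.coe_T_zpow]
          fin_cases i <;> fin_cases j <;> simp [ha, hd, hc]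
        rw [this]; exact H.mul_mem hneg (hT _)
    · obtain ⟨j, hj⟩ := exists_two_mul_natAbs_le (γ 1 1) hc
      set d' := γ 1 1 + j * γ 1 0 with hd'
      have hdet' : γ 0 0 * d' - (γ 0 1 + j * γ 0 0) * γ 1 0 = 1 := by
        rw [hd']; linear_combination hdet
      have hd0 : d' ≠ 0 := by
        intro h0
        rw [h0, mul_zero, zero_sub] at hdet'
        have h1 : (N : ℤ) ∣ 1 := by
          rw [← hdet']
          exact (dvd_neg.2 (hdvd.mul_left _))
        have := Int.le_of_dvd one_pos h1
        omega
      have hNd : (N : ℤ) * d' ≠ 0 := mul_ne_zero (by omega) hd0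
      obtain ⟨i, hi⟩ := exists_two_mul_natAbs_le (γ 1 0) hNd
      set c' := γ 1 0 + i * (N * d') with hc'
      have hmem : γ * ModularGroup.T ^ j * lowerUnip (N * i) ∈ H := by
        have hentry : (γ * ModularGroup.T ^ j * lowerUnip (N * i)) 1 0 = c' := by
          rw [Matrix.SpecialLinearGroup.coe_mul, Matrix.SpecialLinearGroup.coe_mul,
            ModularGroup.coe_T_zpow, coe_lowerUnip]
          simp only [Matrix.mul_apply, Fin.sum_univ_two, Matrix.of_apply, Matrix.cons_val_zero,
            Matrix.cons_val_one, Matrix.cons_val', Matrix.cons_val_fin_one]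
          rw [hc', hd']; ring
        refine ih _ ?_ _ rfl ?_
        · rw [hentry, ← hn]
          rw [Int.natAbs_mul, Int.natAbs_natCast] at hi
          have hi' : 2 * c'.natAbs ≤ N * d'.natAbs := hi
          have hle : N * d'.natAbs ≤ 4 * d'.natAbs := Nat.mul_le_mul_right _ h4
          by_contra hlt
          push Not at hlt
          -- equality throughout: `N = 4`, `|c| = 2|d'|`, and then `d' = ± 1`, `c = ± 2`
          have e1 : (γ 1 0).natAbs = 2 * d'.natAbs := by omega
          have e2 : N * d'.natAbs = 4 * d'.natAbs := by omega
          have e3 : N = 4 := Nat.eq_of_mul_eq_mul_right (Int.natAbs_pos.2 hd0) e2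
          have hdc : d' ∣ γ 1 0 := by
            rw [← Int.natAbs_dvd_natAbs, e1]; exact Dvd.intro_left 2 rfl
          have : d' ∣ 1 := by
            rw [← hdet']; exact dvd_sub (Dvd.intro_left _ rfl) (hdc.mul_left _)
          have hd1 : d'.natAbs = 1 := by
            have := Int.natAbs_dvd_natAbs.2 this
            simpa using this
          rw [e3] at hdvd
          have := Int.natAbs_dvd_natAbs.2 hdvd
          rw [e1, hd1] at this
          norm_num at this
        · rw [hentry, hc']
          exact dvd_add hdvd ((Dvd.intro _ rfl).mul_left _)
      have : γ = γ * ModularGroup.T ^ j * lowerUnip (N * i) * (lowerUnip (N * i))⁻¹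
          * (ModularGroup.T ^ j)⁻¹ := by group
      rw [this]
      exact H.mul_mem (H.mul_mem hmem (H.inv_mem (hV i))) (H.inv_mem (hT j))

/-- `f` and `g` are holomorphic functions of the nome, and `f(-1/(Nτ)) = τᵏ g(τ)`. For `N = 4` the
group `Γ₀(N)` has a third cusp `1/2`; it is the image of `i∞` under
`τ ↦ W(W(τ) - 1/2)`, where `W(τ) = -1/(4τ)`, and the last condition says that `f` is bounded
there. -/
structure FrickePair (N : ℕ) [NeZero N] (k : ℕ) (f g : ℍ → ℂ) : Prop where
  left : ∃ a₀ a₁, IsQ f a₀ a₁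
  right : ∃ b₀ b₁, IsQ g b₀ b₁
  law : ∀ τ, f (fricke N τ) = (τ : ℂ) ^ k * g τ
  half : N = 4 → ∃ h : ℍ → ℂ, IsBoundedAtImInfty h ∧
    ∀ τ, g (halfShift (fricke N τ)) = (τ : ℂ) ^ k * h τ

lemma SL_mul_apply (a b : SL(2, ℤ)) (i j : Fin 2) :
    (a * b) i j = a i 0 * b 0 j + a i 1 * b 1 j := by
  rw [Matrix.SpecialLinearGroup.coe_mul, Matrix.mul_apply, Fin.sum_univ_two]

lemma SL_inv_row_one (a : SL(2, ℤ)) : a⁻¹ 0 0 = a 1 1 ∧ a⁻¹ 1 0 = -a 1 0 := by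
  rw [Matrix.SpecialLinearGroup.SL2_inv_expl]; exact ⟨rfl, rfl⟩

lemma coe_SL_smul (γ : SL(2, ℤ)) (τ : ℍ) :
    ((γ • τ : ℍ) : ℂ) = ((γ 0 0 : ℤ) * τ + (γ 0 1 : ℤ)) / ((γ 1 0 : ℤ) * τ + (γ 1 1 : ℤ)) := by
  rw [UpperHalfPlane.coe_specialLinearGroup_apply]; simp

lemma SL_slash_eq (k : ℕ) (f : ℍ → ℂ) (γ : SL(2, ℤ)) (τ : ℍ) :
    (f ∣[(k : ℤ)] γ) τ = f (γ • τ) * (((γ 1 0 : ℤ) * (τ : ℂ) + (γ 1 1 : ℤ)) ^ k)⁻¹ := by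
  rw [ModularForm.SL_slash_apply, zpow_neg, zpow_natCast]; simp [UpperHalfPlane.denom]

lemma SL_denom_ne_zero (γ : SL(2, ℤ)) (τ : ℍ) :
    (γ 1 0 : ℤ) * (τ : ℂ) + (γ 1 1 : ℤ) ≠ 0 := by
  have := UpperHalfPlane.denom_ne_zero (Matrix.SpecialLinearGroup.mapGL ℝ γ) τ
  simpa [UpperHalfPlane.denom] using this

namespace FrickePair

variable {N : ℕ} [NeZero N] {k : ℕ} {f g : ℍ → ℂ}

lemma slash_T (h : FrickePair N k f g) (j : ℤ) : f ∣[(k : ℤ)] (ModularGroup.T ^ j) = f := by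
  ext τ
  obtain ⟨_, _, hf⟩ := h.left
  rw [SL_slash_eq, hf.eq_of_coe_eq_add_int (τ := τ) (m := j)]
  · simp [ModularGroup.coe_T_zpow]
  · rw [coe_SL_smul, ModularGroup.coe_T_zpow]; simp

/-- The matrix `(1 0; Ni 1)` is the conjugate of the translation by `-i` under the Fricke
involution, so that the periodicity of `g` turns into the invariance of `f`. -/
lemma slash_lowerUnip (h : FrickePair N k f g) (i : ℤ) :
    f ∣[(k : ℤ)] (lowerUnip (N * i)) = f := by
  ext τ
  have hN : (N : ℂ) ≠ 0 := by exact_mod_cast NeZero.ne N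
  have hτ := coe_ne_zero τ
  obtain ⟨_, _, hg⟩ := h.right
  have hden := SL_denom_ne_zero (lowerUnip (N * i)) τ
  rw [SL_slash_eq]
  simp only [coe_lowerUnip, Matrix.of_apply, Matrix.cons_val_zero, Matrix.cons_val_one,
    Matrix.cons_val', Matrix.cons_val_fin_one, Int.cast_mul, Int.cast_natCast, Int.cast_one]
    at hden ⊢
  set σ : ℍ := fricke N (lowerUnip (N * i) • τ) with hσ
  have h1 : (σ : ℂ) = fricke N τ + (-i : ℤ) := by
    rw [hσ, coe_fricke, coe_fricke, coe_SL_smul, coe_lowerUnip]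
    simp only [Matrix.of_apply, Matrix.cons_val_zero, Matrix.cons_val_one,
    Matrix.cons_val', Matrix.cons_val_fin_one, Int.cast_mul, Int.cast_natCast, Int.cast_one,
    Int.cast_zero, Int.cast_neg, one_mul, add_zero]
    field_simp
    ring
  have h2 : f (lowerUnip (N * i) • τ) = (σ : ℂ) ^ k * g σ := by
    rw [← h.law, hσ, fricke_fricke]
  have h3 : f τ = (fricke N τ : ℂ) ^ k * g (fricke N τ) := by
    rw [← h.law, fricke_fricke]
  rw [h2, h3, hg.eq_of_coe_eq_add_int h1, mul_right_comm, ← inv_pow, ← mul_pow, h1, coe_fricke]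
  congr 2
  rw [← div_eq_mul_inv, div_eq_iff hden]
  push_cast
  field_simp
  ring

/-- Modularity of the first member of a Fricke pair, for any character of the right parity; modulo
`2`, `3` and `4` every unit is `± 1`. -/
lemma slash_gamma0 (h : FrickePair N k f g) (h2 : 2 ≤ N) (h4 : N ≤ 4)
    (χ : DirichletCharacter ℂ N) (hχ : χ (-1) = (-1) ^ k) {γ : SL(2, ℤ)}
    (hγ : γ ∈ CongruenceSubgroup.Gamma0 N) :
    f ∣[(k : ℤ)] γ = χ ((γ 1 1 : ℤ) : ZMod N) • f := by
  let H : Subgroup SL(2, ℤ) :=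
    { carrier := {γ | γ ∈ CongruenceSubgroup.Gamma0 N ∧
        f ∣[(k : ℤ)] γ = χ ((γ 1 1 : ℤ) : ZMod N) • f}
      mul_mem' := by
        rintro a b ⟨ha, ha'⟩ ⟨hb, hb'⟩
        refine ⟨mul_mem ha hb, ?_⟩
        have : (((a * b) 1 1 : ℤ) : ZMod N) = (a 1 1 : ℤ) * (b 1 1 : ℤ) := by
          rw [CongruenceSubgroup.Gamma0_mem] at ha
          rw [Matrix.SpecialLinearGroup.coe_mul, Matrix.mul_apply, Fin.sum_univ_two]
          push_cast
          rw [ha]; ring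
        rw [SlashAction.slash_mul, ha', ModularForm.SL_smul_slash, hb', smul_smul, this, map_mul]
      one_mem' := ⟨one_mem _, by simp⟩
      inv_mem' := by
        rintro a ⟨ha, ha'⟩
        refine ⟨inv_mem ha, ?_⟩
        have hdet : a 0 0 * a 1 1 - a 0 1 * a 1 0 = 1 := by
          have := Matrix.SpecialLinearGroup.det_coe a
          rwa [Matrix.det_fin_two] at this
        have hmul : χ ((a⁻¹ 1 1 : ℤ) : ZMod N) * χ ((a 1 1 : ℤ) : ZMod N) = 1 := by
          rw [CongruenceSubgroup.Gamma0_mem] at ha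
          rw [← map_mul, Matrix.SpecialLinearGroup.SL2_inv_expl]
          have := congrArg (Int.cast : ℤ → ZMod N) hdet
          push_cast at this
          rw [ha, mul_zero, sub_zero] at this
          simpa using congrArg χ this
        have h1 : (f ∣[(k : ℤ)] a) ∣[(k : ℤ)] a⁻¹ = f := by
          rw [← SlashAction.slash_mul, mul_inv_cancel, SlashAction.slash_one]
        rw [ha', ModularForm.SL_smul_slash] at h1
        conv_rhs => rw [← h1]
        rw [smul_smul, hmul, one_smul] }
  have hV0 (i : ℤ) : ((lowerUnip (N * i) 1 1 : ℤ) : ZMod N) = 1 := by simp [coe_lowerUnip]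
  have hT0 (j : ℤ) : (((ModularGroup.T ^ j) 1 1 : ℤ) : ZMod N) = 1 := by
    simp [ModularGroup.coe_T_zpow]
  refine (gamma0_le h2 h4 H ⟨?_, ?_⟩ (fun j => ⟨?_, ?_⟩) (fun i => ⟨?_, ?_⟩) hγ).2
  · simp [CongruenceSubgroup.Gamma0_mem]
  · ext τ
    rw [SL_slash_eq]
    have : ((-1 : SL(2, ℤ)) • τ : ℍ) = τ := by
      ext1; rw [coe_SL_smul]; simp
    rw [this]
    simp [hχ, mul_comm, ← inv_pow, inv_neg]
  · simp [CongruenceSubgroup.Gamma0_mem, ModularGroup.coe_T_zpow]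
  · rw [hT0, map_one, one_smul, h.slash_T]
  · simp [CongruenceSubgroup.Gamma0_mem, coe_lowerUnip]
  · rw [hV0, map_one, one_smul, h.slash_lowerUnip]

/-- Boundedness at the cusp `0`. -/
lemma bounded_slash_S (h : FrickePair N k f g) :
    IsBoundedAtImInfty (f ∣[(k : ℤ)] ModularGroup.S) := by
  obtain ⟨_, _, hg⟩ := h.right
  refine isBoundedAtImInfty_of_scale N (hg.const_mul ((N : ℂ) ^ k)⁻¹).isBoundedAtImInfty fun τ => ?_
  have hN : (N : ℂ) ≠ 0 := by exact_mod_cast NeZero.ne N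
  have hτ := coe_ne_zero τ
  have : ModularGroup.S • scale N τ = fricke N τ := by
    ext1; rw [coe_SL_smul]; simp [ModularGroup.S]
  rw [SL_slash_eq, this, h.law]
  simp [ModularGroup.S, mul_pow]
  field_simp

/-- Boundedness at the cusp `1/2` of `Γ₀(4)`. -/
lemma bounded_slash_half (h : FrickePair N k f g) (hN4 : N = 4) :
    IsBoundedAtImInfty (f ∣[(k : ℤ)] (lowerUnip 2)) := by
  obtain ⟨h', hb, hh⟩ := h.half hN4
  have hb' : IsBoundedAtImInfty (fun τ => (-1 / 4 : ℂ) ^ k * h' τ) := by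
    exact Asymptotics.IsBigO.const_mul_left hb _
  convert! hb' using 1
  ext τ
  have hτ := coe_ne_zero τ
  subst hN4
  have hden := SL_denom_ne_zero (lowerUnip 2) τ
  have h1 : lowerUnip 2 • τ = fricke 4 (halfShift (fricke 4 τ)) := by
    have : lowerUnip 2 • τ = fricke 4 (fricke 4 (lowerUnip 2 • τ)) := by simp
    rw [this]
    congr 1
    ext1
    rw [coe_halfShift, coe_fricke, coe_fricke, coe_SL_smul]
    simp [coe_lowerUnip] at hden ⊢
    field_simp
    ring
  have e : (halfShift (fricke 4 τ) : ℂ) * τ =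
      -1 / 4 * ((lowerUnip 2 1 0 : ℤ) * (τ : ℂ) + (lowerUnip 2 1 1 : ℤ)) := by
    simp [coe_lowerUnip]
    field_simp
    ring
  rw [SL_slash_eq, h1, h.law, hh, ← div_eq_mul_inv, div_eq_iff (pow_ne_zero _ hden), ← mul_assoc,
    ← mul_pow, e, mul_pow]
  ring

lemma bounded_mul {f : ℍ → ℂ} {γ : SL(2, ℤ)} {γ₀ r : SL(2, ℤ)} {c : ℂ}
    (hγ : γ = γ₀ * r) (h0 : f ∣[(k : ℤ)] γ₀ = c • f) (hr : IsBoundedAtImInfty (f ∣[(k : ℤ)] r)) :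
    IsBoundedAtImInfty (f ∣[(k : ℤ)] γ) := by
  rw [hγ, SlashAction.slash_mul, h0, ModularForm.SL_smul_slash]
  exact Asymptotics.IsBigO.const_mul_left hr c

/-- A Fricke pair is bounded at every cusp: each element of `SL₂(ℤ)` is the product of one of
`Γ₀(N)` with a power of `T`, a matrix `S Tʲ`, or (`N = 4`) the matrix `(1 0; 2 1)`. -/
lemma bounded_slash (h : FrickePair N k f g) (h2 : 2 ≤ N) (h4 : N ≤ 4)
    (χ : DirichletCharacter ℂ N) (hχ : χ (-1) = (-1) ^ k) (γ : SL(2, ℤ)) :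
    IsBoundedAtImInfty (f ∣[(k : ℤ)] γ) := by
  obtain ⟨_, _, hf⟩ := h.left
  by_cases hc : (N : ℤ) ∣ γ 1 0
  · have hγ : γ ∈ CongruenceSubgroup.Gamma0 N :=
      CongruenceSubgroup.Gamma0_mem.2 ((ZMod.intCast_zmod_eq_zero_iff_dvd _ _).2 hc)
    refine bounded_mul (r := 1) (by simp) (h.slash_gamma0 h2 h4 χ hχ hγ) ?_
    simpa using hf.isBoundedAtImInfty
  by_cases hcop : IsCoprime (γ 1 0) (N : ℤ)
  · obtain ⟨u, v, huv⟩ := hcop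
    set j := u * γ 1 1 with hj
    set r : SL(2, ℤ) := ModularGroup.S * ModularGroup.T ^ j with hr
    have hγ : γ * r⁻¹ ∈ CongruenceSubgroup.Gamma0 N := by
      refine CongruenceSubgroup.Gamma0_mem.2 ((ZMod.intCast_zmod_eq_zero_iff_dvd _ _).2 ?_)
      have : (γ * r⁻¹) 1 0 = γ 1 0 * j - γ 1 1 := by
        rw [SL_mul_apply, (SL_inv_row_one r).1, (SL_inv_row_one r).2, hr, SL_mul_apply,
          SL_mul_apply, ModularGroup.coe_T_zpow]
        simp [ModularGroup.S]
        ring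
      rw [this]
      exact ⟨-v * γ 1 1, by rw [hj]; linear_combination γ 1 1 * huv⟩
    refine bounded_mul (r := r) (by group) (h.slash_gamma0 h2 h4 χ hχ hγ) ?_
    rw [hr, SlashAction.slash_mul]
    refine h.bounded_slash_S.slash (g := (ModularGroup.T ^ j : SL(2, ℤ))) (k : ℤ) ?_
    have := congrFun (congrFun (ModularGroup.coe_T_zpow j) 1) 0
    change (((ModularGroup.T ^ j) 1 0 : ℤ) : ℝ) = 0
    rw [this]; simp
  · have hN4 : N = 4 ∧ (4 : ℤ) ∣ γ 1 0 - 2 * γ 1 1 := by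
      have hdet : γ 0 0 * γ 1 1 - γ 0 1 * γ 1 0 = 1 := by
        have := Matrix.SpecialLinearGroup.det_coe γ
        rwa [Matrix.det_fin_two] at this
      have key : ∀ u v : ℤ, γ 1 0 * u + N * v ≠ 1 := fun u v huv =>
        hcop ⟨u, v, by linear_combination huv⟩
      interval_cases N
      · exact absurd (key 1 (-(γ 1 0 / 2))) (by push_cast at hc ⊢; omega)
      · exfalso
        have h1 := key 1 (-(γ 1 0 / 3))
        have h3 := key (-1) (γ 1 0 / 3 + 1)
        push_cast at hc h1 h3
        omega
      · refine ⟨rfl, ?_⟩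
        have h1 := key 1 (-(γ 1 0 / 4))
        have h3 := key (-1) (γ 1 0 / 4 + 1)
        push_cast at hc h1 h3
        have e : γ 1 0 % 4 = 2 := by omega
        have ho : γ 1 1 % 2 = 1 := by
          rcases Int.emod_two_eq_zero_or_one (γ 1 1) with h0 | h0
          · exfalso
            have e1 : (2 : ℤ) ∣ γ 1 1 := Int.dvd_of_emod_eq_zero h0
            have e2 : (2 : ℤ) ∣ γ 1 0 := by omega
            have : (2 : ℤ) ∣ 1 := by
              rw [← hdet]; exact dvd_sub (e1.mul_left _) (e2.mul_left _)
            omega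
          · exact h0
        omega
    have hγ : γ * (lowerUnip 2)⁻¹ ∈ CongruenceSubgroup.Gamma0 N := by
      refine CongruenceSubgroup.Gamma0_mem.2 ((ZMod.intCast_zmod_eq_zero_iff_dvd _ _).2 ?_)
      have : (γ * (lowerUnip 2)⁻¹) 1 0 = γ 1 0 - 2 * γ 1 1 := by
        rw [SL_mul_apply, (SL_inv_row_one _).1, (SL_inv_row_one _).2]
        simp [coe_lowerUnip]
        ring
      rw [this, hN4.1]
      exact hN4.2
    exact bounded_mul (r := lowerUnip 2) (by group) (h.slash_gamma0 h2 h4 χ hχ hγ)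
      (h.bounded_slash_half hN4.1)

theorem isModularFormWithChar (h : FrickePair N k f g) (h2 : 2 ≤ N) (h4 : N ≤ 4)
    (χ : DirichletCharacter ℂ N) (hχ : χ (-1) = (-1) ^ k) : IsModularFormWithChar N χ k f where
  holo := by obtain ⟨_, _, hf⟩ := h.left; exact hf.mdifferentiable
  transform γ hγ τ := by
    have := congrFun (h.slash_gamma0 h2 h4 χ hχ hγ) τ
    rw [SL_slash_eq, Pi.smul_apply, smul_eq_mul,
      mul_inv_eq_iff_eq_mul₀ (pow_ne_zero _ (SL_denom_ne_zero γ τ))] at this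
    rw [this]; ring
  bdd_at_cusps := h.bounded_slash h2 h4 χ hχ

/-- A modular function without poles is constant. -/
theorem eq_const (h : FrickePair N 0 f g) (h2 : 2 ≤ N) (h4 : N ≤ 4) : ∃ c, ∀ τ, f τ = c := by
  obtain ⟨_, _, hf⟩ := h.left
  let F : ModularForm
      ((CongruenceSubgroup.Gamma0 N : Subgroup SL(2, ℤ)) : Subgroup (GL (Fin 2) ℝ)) 0 :=
    { toFun := f
      slash_action_eq' := by
        rintro _ ⟨γ, hγ, rfl⟩
        have := h.slash_gamma0 h2 h4 1 (by
          have : IsUnit (-1 : ZMod N) := isUnit_one.neg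
          rw [MulChar.one_apply this, pow_zero]) hγ
        rw [MulChar.one_apply] at this
        · rw [one_smul] at this
          exact this
        · have hdet : γ 0 0 * γ 1 1 - γ 0 1 * γ 1 0 = 1 := by
            have := Matrix.SpecialLinearGroup.det_coe γ
            rwa [Matrix.det_fin_two] at this
          have e := congrArg (Int.cast : ℤ → ZMod N) hdet
          push_cast at e
          have hγ' := CongruenceSubgroup.Gamma0_mem.1 hγ
          rw [hγ', mul_zero, sub_zero] at e
          exact IsUnit.of_mul_eq_one_right _ e
      holo' := hf.mdifferentiable
      bdd_at_cusps' := by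
        intro c hc
        rw [Subgroup.IsArithmetic.isCusp_iff_isCusp_SL2Z] at hc
        rw [OnePoint.isBoundedAt_iff_forall_SL2Z hc]
        intro γ _
        refine h.bounded_slash h2 h4 1 ?_ γ
        have : IsUnit (-1 : ZMod N) := isUnit_one.neg
        rw [MulChar.one_apply this, pow_zero] }
  obtain ⟨c, hc⟩ := ModularForm.eq_const_of_weight_zero F
  exact ⟨c, fun τ => congrFun hc τ⟩

end FrickePair

section uniqueness

variable {N : ℕ} [NeZero N] {k : ℕ} {f g F G : ℍ → ℂ}

/-- If `F` has its only zeros at the cusp `0` (of order one) and, for `N = 4`, at the cusp `1/2`,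
then a form of the same weight with at least these zeros is proportional to `F`. -/
lemma eq_mul_of_fricke (h2 : 2 ≤ N) (h4 : N ≤ 4) {a₀ a₁ A b B : ℂ} (hf : IsQ f a₀ a₁)
    (hg : IsQ g 0 b) (hF : IsQ F 1 A) (hG : IsQ G 0 B) (hB : B ≠ 0) (hF0 : ∀ τ, F τ ≠ 0)
    (hG0 : ∀ τ, G τ ≠ 0) (hfg : ∀ τ, f (fricke N τ) = (τ : ℂ) ^ k * g τ)
    (hFG : ∀ τ, F (fricke N τ) = (τ : ℂ) ^ k * G τ)
    (half : N = 4 → ∃ h : ℍ → ℂ, IsBoundedAtImInfty h ∧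
      ∀ τ, g (halfShift (fricke N τ)) / G (halfShift (fricke N τ)) = h τ) (τ : ℍ) :
    f τ = a₀ * F τ := by
  obtain ⟨_, hl⟩ := hf.div hF one_ne_zero hF0
  obtain ⟨_, hr⟩ := hg.div_of_zero hG hB hG0
  have hp : FrickePair N 0 (fun τ => f τ / F τ) (fun τ => g τ / G τ) :=
    { left := ⟨_, _, hl⟩
      right := ⟨_, _, hr⟩
      law := fun τ => by
        have := coe_ne_zero τ
        simp only [hfg, hFG, pow_zero, one_mul]
        field_simp
      half := by simpa using half }
  obtain ⟨c, hc⟩ := hp.eq_const h2 h4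
  have hca : c = a₀ := by
    have h1 := hl.tendsto
    simp only [hc, div_one] at h1
    exact tendsto_nhds_unique tendsto_const_nhds h1
  rw [← div_eq_iff (hF0 τ), hc τ, hca]

/-- For `N = 2, 3` let `F` be a form of weight `c` whose only zero is a simple one at `i∞`. A form
`f` of weight `k` that vanishes at `i∞` is zero if `k / c` is less than one: for `k m = c n` with
`n < m` the quotient `fᵐ / Fⁿ` is a modular function without poles and with a zero at `i∞`. -/
lemma eq_zero_of_fricke (h2 : 2 ≤ N) (h4 : N < 4) {a b₀ b₁ A B₀ B₁ : ℂ} {c m n : ℕ}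
    (hf : IsQ f 0 a) (hg : IsQ g b₀ b₁) (hF : IsQ F 0 A) (hG : IsQ G B₀ B₁) (hA : A ≠ 0)
    (hB : B₀ ≠ 0) (hF0 : ∀ τ, F τ ≠ 0) (hG0 : ∀ τ, G τ ≠ 0)
    (hfg : ∀ τ, f (fricke N τ) = (τ : ℂ) ^ k * g τ)
    (hFG : ∀ τ, F (fricke N τ) = (τ : ℂ) ^ c * G τ) (hkc : k * m = c * n) (hnm : n < m) (τ : ℍ) :
    f τ = 0 := by
  obtain ⟨_, hq⟩ := hf.div_of_zero hF hA hF0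
  have hl := (hq.pow n).mul (hf.pow (m - n))
  rw [zero_pow (by omega : m - n ≠ 0), mul_zero] at hl
  have hl' : ∀ τ, (f τ / F τ) ^ n * f τ ^ (m - n) = f τ ^ m / F τ ^ n := fun τ => by
    rw [div_pow, div_mul_eq_mul_div, ← pow_add, Nat.add_sub_cancel' hnm.le]
  obtain ⟨_, hr⟩ := (hg.pow m).div (hG.pow n) (pow_ne_zero _ hB) fun τ => pow_ne_zero _ (hG0 τ)
  have hp : FrickePair N 0 (fun τ => f τ ^ m / F τ ^ n) (fun τ => g τ ^ m / G τ ^ n) :=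
    { left := ⟨_, _, hl.congr fun τ => (hl' τ).symm⟩
      right := ⟨_, _, hr⟩
      law := fun τ => by
        have := coe_ne_zero τ
        simp only [hfg, hFG, pow_zero, one_mul, mul_pow, ← pow_mul, hkc]
        field_simp
      half := by omega }
  obtain ⟨d, hd⟩ := hp.eq_const h2 h4.le
  have hd0 : d = 0 := by
    have h1 := (hl.congr fun τ => (hl' τ).symm).tendsto
    simp only [hd] at h1
    exact tendsto_nhds_unique tendsto_const_nhds h1
  have := hd τ
  rw [hd0, div_eq_zero_iff] at this
  exact pow_eq_zero_iff (by omega) |>.1 (this.resolve_right (pow_ne_zero _ (hF0 τ)))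

end uniqueness

/-! ### Eta quotients -/

/-- The function `τ ↦ ∏ (1 - q^(δn))`, that is `η(δτ)` without its factor `q^(δ/24)`. -/
noncomputable def eulerProd (δ : ℕ) (τ : ℍ) : ℂ := ∏' n : ℕ, (1 - (nome τ ^ δ) ^ (n + 1))

/-- `q^(1/24)`. -/
noncomputable def nomeRoot (τ : ℍ) : ℂ := Complex.exp (2 * Real.pi * Complex.I * τ / 24)

lemma nomeRoot_ne_zero (τ : ℍ) : nomeRoot τ ≠ 0 := Complex.exp_ne_zero _

lemma nomeRoot_pow (τ : ℍ) : nomeRoot τ ^ 24 = nome τ := by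
  rw [nomeRoot, nome, ← Complex.exp_nat_mul]
  congr 1; push_cast; ring

lemma etaMul_eq (δ : ℕ) (τ : ℍ) : etaMul δ τ = nomeRoot τ ^ δ * eulerProd δ τ := by
  rw [etaMul, ModularForm.eta, eulerProd, nomeRoot, ← Complex.exp_nat_mul]
  congr 1
  · rw [Function.Periodic.qParam]; congr 1; push_cast; ring
  · refine tprod_congr fun n => ?_
    rw [ModularForm.eta_q_eq_pow, nome, ← Complex.exp_nat_mul _ δ]
    congr 3; ring

lemma etaMul_ne_zero {δ : ℕ} (hδ : δ ≠ 0) (τ : ℍ) : etaMul δ τ ≠ 0 := by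
  have : NeZero δ := ⟨hδ⟩
  exact ModularForm.eta_ne_zero (scale δ τ).im_pos

lemma eulerProd_ne_zero {δ : ℕ} (hδ : δ ≠ 0) (τ : ℍ) : eulerProd δ τ ≠ 0 := by
  have := etaMul_ne_zero hδ τ
  rw [etaMul_eq] at this
  exact right_ne_zero_of_mul this

lemma isQ_eulerProd {δ : ℕ} (hδ : δ ≠ 0) : ∃ a, IsQ (eulerProd δ) 1 a := by
  have h : DifferentiableOn ℂ (fun q : ℂ => ∏' n : ℕ, (1 - (q ^ δ) ^ (n + 1)))
      (Metric.ball 0 1) :=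
    ModularForm.differentiableOn_tprod_one_sub_pow.comp (by fun_prop) fun q hq => by
      rw [mem_ball_zero_iff] at hq ⊢
      rw [norm_pow]
      exact pow_lt_one₀ (norm_nonneg _) hq hδ
  have := IsQ.of_differentiableOn (f := eulerProd δ) h fun τ => rfl
  simpa [hδ] using this

lemma etaMul_scale (δ M : ℕ) [NeZero M] (τ : ℍ) : etaMul δ (scale M τ) = etaMul (δ * M) τ := by
  simp [etaMul, mul_assoc]

/-- `√(-iτ)`, the automorphy factor of `η` under `τ ↦ -1/τ`. -/
noncomputable def etaFactor (τ : ℍ) : ℂ := (Complex.sqrt Complex.I)⁻¹ * Complex.sqrt τ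

lemma etaFactor_sq (τ : ℍ) : etaFactor τ ^ 2 = -Complex.I * τ := by
  rw [etaFactor, mul_pow, inv_pow]
  simp [Complex.sqrt]

lemma etaFactor_ne_zero (τ : ℍ) : etaFactor τ ≠ 0 := by
  have : etaFactor τ ^ 2 ≠ 0 := by
    rw [etaFactor_sq]; exact mul_ne_zero (by simp) (coe_ne_zero τ)
  exact fun h => this (by rw [h]; simp)

/-- The behaviour of `η(δτ)` under the Fricke involution of level `N = δM`. -/
lemma etaMul_fricke {N δ M : ℕ} [NeZero N] (h : N = δ * M) (τ : ℍ) :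
    etaMul δ (fricke N τ) = (√M : ℝ) * etaFactor τ * etaMul M τ := by
  have hN : N ≠ 0 := NeZero.ne N
  have hδ : (δ : ℂ) ≠ 0 := by
    rintro h0; rw [Nat.cast_eq_zero] at h0; simp [h, h0] at hN
  have hM0 : M ≠ 0 := by rintro rfl; simp [h] at hN
  have : NeZero M := ⟨hM0⟩
  have hM : (M : ℂ) ≠ 0 := by exact_mod_cast hM0
  have hτ := coe_ne_zero τ
  have key := ModularForm.eta_comp_eq_csqrt_I_inv (scale M τ).im_pos
  have e : (δ : ℂ) * (fricke N τ : ℂ) = -1 / (scale M τ : ℂ) := by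
    rw [coe_fricke, coe_scale, h]; push_cast; field_simp
  have hs : Complex.sqrt (M * τ) = (√M : ℝ) * Complex.sqrt τ := by
    rw [Complex.sqrt, Complex.sqrt, Complex.cpow_def_of_ne_zero (mul_ne_zero hM hτ),
      Complex.cpow_def_of_ne_zero hτ, ← Complex.ofReal_natCast,
      Complex.log_ofReal_mul (Nat.cast_pos.2 (Nat.pos_of_ne_zero hM0)) hτ, add_mul, Complex.exp_add]
    congr 1
    rw [Real.sqrt_eq_rpow, Real.rpow_def_of_pos (Nat.cast_pos.2 (Nat.pos_of_ne_zero hM0))]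
    push_cast
    norm_num
  rw [etaMul, e]
  refine key.trans ?_
  simp only [Pi.smul_apply, Pi.mul_apply, smul_eq_mul, coe_scale]
  rw [hs, etaFactor, etaMul]
  ring

lemma sqrt_natCast_sq (M : ℕ) : (((√M : ℝ) : ℝ) : ℂ) ^ 2 = M := by
  rw [← Complex.ofReal_pow, Real.sq_sqrt (Nat.cast_nonneg M), Complex.ofReal_natCast]

/-- The constant `2^(3/2)` in `𝒞₄`. -/
lemma two_rpow_sq : ((((2 : ℝ) ^ (3 / 2 : ℝ) : ℝ)) : ℂ) ^ 2 = 8 := by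
  rw [← Complex.ofReal_pow, ← Real.rpow_natCast, ← Real.rpow_mul (by norm_num)]
  norm_num

lemma B₄_ne_zero (τ : ℍ) : B₄ τ ≠ 0 :=
  div_ne_zero (pow_ne_zero _ (etaMul_ne_zero (by norm_num) τ))
    (pow_ne_zero _ (etaMul_ne_zero (by norm_num) τ))

lemma C₄_pow_four (τ : ℍ) : C₄ τ ^ 4 = 64 * etaMul 2 τ ^ 16 / etaMul 1 τ ^ 8 := by
  rw [C₄, div_pow, mul_pow, show ((((2 : ℝ) ^ (3 / 2 : ℝ) : ℝ)) : ℂ) ^ 4 = 64 by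
    rw [show 4 = 2 * 2 by rfl, pow_mul, two_rpow_sq]; norm_num]
  ring

lemma C₄_pow_ne_zero (τ : ℍ) : C₄ τ ^ 4 ≠ 0 := by
  rw [C₄_pow_four]
  exact div_ne_zero (mul_ne_zero (by norm_num) (pow_ne_zero _ (etaMul_ne_zero (by norm_num) τ)))
    (pow_ne_zero _ (etaMul_ne_zero (by norm_num) τ))

lemma B₄_pow_fricke (τ : ℍ) : B₄ (fricke 2 τ) ^ 4 = (τ : ℂ) ^ 4 * (4 * C₄ τ ^ 4) := by
  have h1 := etaMul_ne_zero (δ := 1) (by norm_num) τ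
  have hs := etaFactor_ne_zero τ
  rw [C₄_pow_four, B₄, etaMul_fricke (δ := 1) (M := 2) (by norm_num),
    etaMul_fricke (δ := 2) (M := 1) (by norm_num)]
  have ha := sqrt_natCast_sq 2
  have hs2 := etaFactor_sq τ
  simp only [Nat.cast_one, Real.sqrt_one, Complex.ofReal_one, one_mul] at *
  have h4 : (-Complex.I * (τ : ℂ)) ^ 4 = (τ : ℂ) ^ 4 := by
    rw [mul_pow, neg_pow, Complex.I_pow_four]; norm_num
  set a : ℂ := ((√(2 : ℕ) : ℝ) : ℂ)
  calc _ = (a ^ 2) ^ 8 * (etaFactor τ ^ 2) ^ 4 * (etaMul 2 τ ^ 16 / etaMul 1 τ ^ 8) := by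
        field_simp
    _ = _ := by rw [ha, hs2, h4]; push_cast; ring

lemma C₄_pow_fricke (τ : ℍ) : C₄ (fricke 2 τ) ^ 4 = (τ : ℂ) ^ 4 * (4 * B₄ τ ^ 4) := by
  have h := B₄_pow_fricke (fricke 2 τ)
  rw [fricke_fricke] at h
  have hτ := coe_ne_zero τ
  rw [h, coe_fricke]
  push_cast
  field_simp
  norm_num

lemma isQ_B₄_pow : ∃ a, IsQ (fun τ => B₄ τ ^ 4) 1 a := by
  obtain ⟨a, h1⟩ := isQ_eulerProd (δ := 1) (by norm_num)
  obtain ⟨b, h2⟩ := isQ_eulerProd (δ := 2) (by norm_num)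
  obtain ⟨c, h3⟩ := (h1.pow 16).div (h2.pow 8) (by simp)
    fun τ => pow_ne_zero _ (eulerProd_ne_zero (by norm_num) τ)
  have h := h3.congr (g := fun τ => B₄ τ ^ 4) fun τ => by
    have := nomeRoot_ne_zero τ
    have := eulerProd_ne_zero (δ := 2) (by norm_num) τ
    rw [B₄, etaMul_eq, etaMul_eq]
    field_simp
  exact ⟨c, by simpa using h⟩

lemma isQ_C₄_pow : IsQ (fun τ => C₄ τ ^ 4) 0 64 := by
  obtain ⟨a, h1⟩ := isQ_eulerProd (δ := 1) (by norm_num)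
  obtain ⟨b, h2⟩ := isQ_eulerProd (δ := 2) (by norm_num)
  obtain ⟨c, h3⟩ := (h2.pow 16).div (h1.pow 8) (by simp)
    fun τ => pow_ne_zero _ (eulerProd_ne_zero (by norm_num) τ)
  have h := (IsQ.nome_self.mul (h3.const_mul 64)).congr (g := fun τ => C₄ τ ^ 4) fun τ => by
    have := nomeRoot_ne_zero τ
    have := eulerProd_ne_zero (δ := 1) (by norm_num) τ
    rw [C₄_pow_four, etaMul_eq, etaMul_eq, ← nomeRoot_pow]
    field_simp
  simpa using h

/-! #### Level three -/

lemma B₃_ne_zero (τ : ℍ) : B₃ τ ≠ 0 :=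
  div_ne_zero (pow_ne_zero _ (etaMul_ne_zero (by norm_num) τ)) (etaMul_ne_zero (by norm_num) τ)

lemma C₃_ne_zero (τ : ℍ) : C₃ τ ≠ 0 :=
  div_ne_zero (mul_ne_zero (by norm_num) (pow_ne_zero _ (etaMul_ne_zero (by norm_num) τ)))
    (etaMul_ne_zero (by norm_num) τ)

/-- The constant `i 3√3` that relates `ℬ₃³` and `𝒞₃³` under the Fricke involution. -/
noncomputable def kappa : ℂ := 3 * (√(3 : ℕ) : ℝ) * Complex.I

lemma kappa_sq : kappa ^ 2 = -27 := by
  rw [kappa, mul_pow, mul_pow, sqrt_natCast_sq, Complex.I_sq]; push_cast; norm_num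

lemma kappa_ne_zero : kappa ≠ 0 := by
  intro h
  have := kappa_sq
  rw [h] at this
  norm_num at this

lemma B₃_pow_fricke (τ : ℍ) : B₃ (fricke 3 τ) ^ 3 = (τ : ℂ) ^ 3 * (kappa * C₃ τ ^ 3) := by
  have h1 := etaMul_ne_zero (δ := 1) (by norm_num) τ
  have hs := etaFactor_ne_zero τ
  rw [C₃, B₃, etaMul_fricke (δ := 1) (M := 3) (by norm_num),
    etaMul_fricke (δ := 3) (M := 1) (by norm_num), kappa]
  have ha := sqrt_natCast_sq 3
  have hs2 := etaFactor_sq τ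
  simp only [Nat.cast_one, Real.sqrt_one, Complex.ofReal_one, one_mul] at *
  have h4 : (-Complex.I * (τ : ℂ)) ^ 3 = Complex.I * (τ : ℂ) ^ 3 := by
    rw [mul_pow, neg_pow, Complex.I_pow_three]; ring
  set a : ℂ := ((√(3 : ℕ) : ℝ) : ℂ)
  calc _ = a * (a ^ 2) ^ 4 * (etaFactor τ ^ 2) ^ 3 * (etaMul 3 τ ^ 9 / etaMul 1 τ ^ 3) := by
        field_simp
    _ = _ := by rw [ha, hs2, h4]; push_cast; ring

lemma C₃_pow_fricke (τ : ℍ) : C₃ (fricke 3 τ) ^ 3 = (τ : ℂ) ^ 3 * (kappa * B₃ τ ^ 3) := by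
  have h := B₃_pow_fricke (fricke 3 τ)
  rw [fricke_fricke, coe_fricke] at h
  have hτ := coe_ne_zero τ
  have hk := kappa_ne_zero
  rw [h]
  push_cast
  field_simp
  linear_combination C₃ (fricke 3 τ) ^ 3 * kappa_sq

lemma isQ_B₃_pow : ∃ a, IsQ (fun τ => B₃ τ ^ 3) 1 a := by
  obtain ⟨a, h1⟩ := isQ_eulerProd (δ := 1) (by norm_num)
  obtain ⟨b, h2⟩ := isQ_eulerProd (δ := 3) (by norm_num)
  obtain ⟨c, h3⟩ := (h1.pow 9).div (h2.pow 3) (by simp)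
    fun τ => pow_ne_zero _ (eulerProd_ne_zero (by norm_num) τ)
  have h := h3.congr (g := fun τ => B₃ τ ^ 3) fun τ => by
    have := nomeRoot_ne_zero τ
    have := eulerProd_ne_zero (δ := 3) (by norm_num) τ
    rw [B₃, etaMul_eq, etaMul_eq]
    field_simp
  exact ⟨c, by simpa using h⟩

lemma isQ_C₃_pow : IsQ (fun τ => C₃ τ ^ 3) 0 27 := by
  obtain ⟨a, h1⟩ := isQ_eulerProd (δ := 1) (by norm_num)
  obtain ⟨b, h2⟩ := isQ_eulerProd (δ := 3) (by norm_num)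
  obtain ⟨c, h3⟩ := (h2.pow 9).div (h1.pow 3) (by simp)
    fun τ => pow_ne_zero _ (eulerProd_ne_zero (by norm_num) τ)
  have h := (IsQ.nome_self.mul (h3.const_mul 27)).congr (g := fun τ => C₃ τ ^ 3) fun τ => by
    have := nomeRoot_ne_zero τ
    have := eulerProd_ne_zero (δ := 1) (by norm_num) τ
    rw [C₃, etaMul_eq, etaMul_eq, ← nomeRoot_pow]
    field_simp
    ring
  simpa using h

/-! #### Level four -/

/-- The eta quotient `[2]¹⁰ / ([1]⁴ [4]⁴)`, which is `𝒜₂`. -/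
noncomputable def thetaSq (τ : ℍ) : ℂ := etaMul 2 τ ^ 10 / (etaMul 1 τ ^ 4 * etaMul 4 τ ^ 4)

lemma thetaSq_ne_zero (τ : ℍ) : thetaSq τ ≠ 0 :=
  div_ne_zero (pow_ne_zero _ (etaMul_ne_zero (by norm_num) τ))
    (mul_ne_zero (pow_ne_zero _ (etaMul_ne_zero (by norm_num) τ))
      (pow_ne_zero _ (etaMul_ne_zero (by norm_num) τ)))

lemma B₂_ne_zero (τ : ℍ) : B₂ τ ≠ 0 := B₄_ne_zero τ

lemma C₂_ne_zero (τ : ℍ) : C₂ τ ≠ 0 :=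
  div_ne_zero (mul_ne_zero (by norm_num) (pow_ne_zero _ (etaMul_ne_zero (by norm_num) τ)))
    (pow_ne_zero _ (etaMul_ne_zero (by norm_num) τ))

lemma sqrt_four : ((√(4 : ℕ) : ℝ) : ℂ) = 2 := by
  rw [show ((4 : ℕ) : ℝ) = 2 ^ 2 by norm_num, Real.sqrt_sq (by norm_num)]; norm_num

lemma thetaSq_fricke (τ : ℍ) : thetaSq (fricke 4 τ) = -2 * Complex.I * τ * thetaSq τ := by
  have h1 := etaMul_ne_zero (δ := 1) (by norm_num) τ
  have h4 := etaMul_ne_zero (δ := 4) (by norm_num) τ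
  have hs := etaFactor_ne_zero τ
  rw [thetaSq, thetaSq, etaMul_fricke (δ := 1) (M := 4) (by norm_num),
    etaMul_fricke (δ := 2) (M := 2) (by norm_num), etaMul_fricke (δ := 4) (M := 1) (by norm_num),
    sqrt_four]
  have ha := sqrt_natCast_sq 2
  have hs2 := etaFactor_sq τ
  simp only [Nat.cast_one, Real.sqrt_one, Complex.ofReal_one, one_mul] at *
  set a : ℂ := ((√(2 : ℕ) : ℝ) : ℂ)
  calc _ = (a ^ 2) ^ 5 / 16 * etaFactor τ ^ 2 *
        (etaMul 2 τ ^ 10 / (etaMul 1 τ ^ 4 * etaMul 4 τ ^ 4)) := by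
        field_simp; ring
    _ = _ := by rw [ha, hs2]; push_cast; ring

lemma B₂_fricke (τ : ℍ) : B₂ (fricke 4 τ) = -2 * Complex.I * τ * C₂ τ := by
  have h2 := etaMul_ne_zero (δ := 2) (by norm_num) τ
  have hs := etaFactor_ne_zero τ
  rw [B₂, C₂, etaMul_fricke (δ := 1) (M := 4) (by norm_num),
    etaMul_fricke (δ := 2) (M := 2) (by norm_num), sqrt_four]
  have ha := sqrt_natCast_sq 2
  have hs2 := etaFactor_sq τ
  have ha0 : ((√(2 : ℕ) : ℝ) : ℂ) ≠ 0 := fun h => by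
    rw [h] at ha; norm_num at ha
  set a : ℂ := ((√(2 : ℕ) : ℝ) : ℂ)
  calc _ = 16 / a ^ 2 * etaFactor τ ^ 2 * (etaMul 4 τ ^ 4 / etaMul 2 τ ^ 2) := by
        field_simp; ring
    _ = _ := by rw [ha, hs2]; push_cast; ring

lemma C₂_fricke (τ : ℍ) : C₂ (fricke 4 τ) = -2 * Complex.I * τ * B₂ τ := by
  have h := B₂_fricke (fricke 4 τ)
  rw [fricke_fricke, coe_fricke] at h
  have hτ := coe_ne_zero τ
  rw [h]
  push_cast
  field_simp
  linear_combination (4 * C₂ (fricke 4 τ)) * Complex.I_sq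

lemma isQ_thetaSq : ∃ a, IsQ thetaSq 1 a := by
  obtain ⟨a, h1⟩ := isQ_eulerProd (δ := 1) (by norm_num)
  obtain ⟨b, h2⟩ := isQ_eulerProd (δ := 2) (by norm_num)
  obtain ⟨b, h4⟩ := isQ_eulerProd (δ := 4) (by norm_num)
  obtain ⟨c, h3⟩ := (h2.pow 10).div ((h1.pow 4).mul (h4.pow 4)) (by simp)
    fun τ => mul_ne_zero (pow_ne_zero _ (eulerProd_ne_zero (by norm_num) τ))
      (pow_ne_zero _ (eulerProd_ne_zero (by norm_num) τ))
  have h := h3.congr (g := thetaSq) fun τ => by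
    have := nomeRoot_ne_zero τ
    have := eulerProd_ne_zero (δ := 1) (by norm_num) τ
    have := eulerProd_ne_zero (δ := 4) (by norm_num) τ
    rw [thetaSq, etaMul_eq, etaMul_eq, etaMul_eq]
    field_simp
  exact ⟨c, by simpa using h⟩

lemma isQ_B₂ : ∃ a, IsQ B₂ 1 a := by
  obtain ⟨a, h1⟩ := isQ_eulerProd (δ := 1) (by norm_num)
  obtain ⟨b, h2⟩ := isQ_eulerProd (δ := 2) (by norm_num)
  obtain ⟨c, h3⟩ := (h1.pow 4).div (h2.pow 2) (by simp)
    fun τ => pow_ne_zero _ (eulerProd_ne_zero (by norm_num) τ)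
  have h := h3.congr (g := B₂) fun τ => by
    have := nomeRoot_ne_zero τ
    have := eulerProd_ne_zero (δ := 2) (by norm_num) τ
    rw [B₂, etaMul_eq, etaMul_eq]
    field_simp
  exact ⟨c, by simpa using h⟩

/-- `𝒞₂²` is `16 q` times a function of `q²`; the square root `𝒞₂` itself is a function of
`q^(1/2)` only. -/
lemma C₂_sq_eq (τ : ℍ) : C₂ τ ^ 2 = nome τ * (16 * (eulerProd 4 τ ^ 8 / eulerProd 2 τ ^ 4)) := by
  have := nomeRoot_ne_zero τ
  have := eulerProd_ne_zero (δ := 2) (by norm_num) τ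
  rw [C₂, etaMul_eq, etaMul_eq, ← nomeRoot_pow]
  field_simp
  ring

lemma isQ_C₂_sq : IsQ (fun τ => C₂ τ ^ 2) 0 16 := by
  obtain ⟨b, h2⟩ := isQ_eulerProd (δ := 2) (by norm_num)
  obtain ⟨b, h4⟩ := isQ_eulerProd (δ := 4) (by norm_num)
  obtain ⟨c, h3⟩ := (h4.pow 8).div (h2.pow 4) (by simp)
    fun τ => pow_ne_zero _ (eulerProd_ne_zero (by norm_num) τ)
  simpa using (IsQ.nome_self.mul (h3.const_mul 16)).congr (g := fun τ => C₂ τ ^ 2) C₂_sq_eq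

/-- `𝒞₂(2τ)` is a function of the nome with a simple zero at `i∞`. -/
lemma isQ_C₂_scale : IsQ (fun τ => C₂ (scale 2 τ)) 0 4 := by
  obtain ⟨b, h2⟩ := isQ_eulerProd (δ := 4) (by norm_num)
  obtain ⟨b, h4⟩ := isQ_eulerProd (δ := 8) (by norm_num)
  obtain ⟨c, h3⟩ := (h4.pow 4).div (h2.pow 2) (by simp)
    fun τ => pow_ne_zero _ (eulerProd_ne_zero (by norm_num) τ)
  have h := (IsQ.nome_self.mul (h3.const_mul 4)).congr (g := fun τ => C₂ (scale 2 τ)) fun τ => by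
    have := nomeRoot_ne_zero τ
    have := eulerProd_ne_zero (δ := 4) (by norm_num) τ
    rw [C₂, etaMul_scale, etaMul_scale, etaMul_eq, etaMul_eq, ← nomeRoot_pow]
    field_simp
    ring
  simpa using h

lemma isBoundedAtImInfty_C₂ : IsBoundedAtImInfty C₂ :=
  isBoundedAtImInfty_of_scale 2 isQ_C₂_scale.isBoundedAtImInfty fun _ => rfl

/-! The eta quotients of level four in terms of those of level two. -/

lemma thetaSq_mul_C₂_sq (τ : ℍ) : thetaSq τ ^ 2 * C₂ τ ^ 2 = C₄ τ ^ 4 / 4 := by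
  have := etaMul_ne_zero (δ := 1) (by norm_num) τ
  have := etaMul_ne_zero (δ := 2) (by norm_num) τ
  have := etaMul_ne_zero (δ := 4) (by norm_num) τ
  rw [C₄_pow_four, thetaSq, C₂]
  field_simp
  norm_num

lemma thetaSq_mul_B₂_sq (τ : ℍ) : thetaSq τ ^ 2 * B₂ τ ^ 2 = B₄ (scale 2 τ) ^ 4 := by
  have := etaMul_ne_zero (δ := 1) (by norm_num) τ
  have := etaMul_ne_zero (δ := 2) (by norm_num) τ
  have := etaMul_ne_zero (δ := 4) (by norm_num) τ
  rw [thetaSq, B₂, B₄, etaMul_scale, etaMul_scale]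
  field_simp

lemma C₂_pow_four (τ : ℍ) : C₂ τ ^ 4 = 4 * C₄ (scale 2 τ) ^ 4 := by
  rw [C₄_pow_four, C₂, etaMul_scale, etaMul_scale]
  ring

/-! ### Lambert series -/

/-- `∑_{d ∣ n} a(d, n/d) d^k`, the common form of all the divisor sums in the table. -/
noncomputable def weightedDivSum (k : ℕ) (a : ℕ → ℕ → ℂ) (n : ℕ) : ℂ :=
  ∑ d ∈ n.divisors, a d (n / d) * (d : ℂ) ^ k

lemma summable_weighted_prod {a : ℕ → ℕ → ℂ} {K : ℝ} (ha : ∀ d m, ‖a d m‖ ≤ K) (k : ℕ) {q : ℂ}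
    (hq : ‖q‖ < 1) :
    Summable fun p : ℕ+ × ℕ+ => a p.1 p.2 * (p.1 : ℂ) ^ k * q ^ (p.1 * p.2 : ℕ) := by
  have h := (summable_prod_mul_pow (𝕜 := ℂ) k hq).prod_symm.norm.mul_left K
  refine Summable.of_norm_bounded h fun p => ?_
  simp only [Prod.fst_swap, Prod.snd_swap, norm_mul, mul_assoc, mul_comm (p.2 : ℕ) (p.1 : ℕ)]
  exact mul_le_mul_of_nonneg_right (ha _ _) (by positivity)

/-- Rearrangement of a double series over `(d, m)` along the products `n = dm`. -/
lemma hasSum_weightedDivSum {a : ℕ → ℕ → ℂ} {K : ℝ} (ha : ∀ d m, ‖a d m‖ ≤ K) (k : ℕ) {q : ℂ}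
    (hq : ‖q‖ < 1) :
    HasSum (fun n : ℕ+ => weightedDivSum k a n * q ^ (n : ℕ))
      (∑' p : ℕ+ × ℕ+, a p.1 p.2 * (p.1 : ℂ) ^ k * q ^ (p.1 * p.2 : ℕ)) := by
  have h := sigmaAntidiagonalEquivProd.hasSum_iff.2 (summable_weighted_prod ha k hq).hasSum
  convert h.sigma fun n => hasSum_fintype _ using 2 with n
  change _ = ∑ b : {x // x ∈ (n : ℕ).divisorsAntidiagonal},
    a b.1.1 b.1.2 * (b.1.1 : ℂ) ^ k * q ^ (b.1.1 * b.1.2)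
  rw [Finset.univ_eq_attach, (n : ℕ).divisorsAntidiagonal.sum_attach
    (fun x : ℕ × ℕ => a x.1 x.2 * (x.1 : ℂ) ^ k * q ^ (x.1 * x.2)),
    Nat.sum_divisorsAntidiagonal fun x y => a x y * (x : ℂ) ^ k * q ^ (x * y),
    weightedDivSum, Finset.sum_mul]
  exact Finset.sum_congr rfl fun d hd => by rw [Nat.mul_div_cancel' (Nat.dvd_of_mem_divisors hd)]

lemma weightedDivSum_const_mul (k : ℕ) (a : ℕ → ℕ → ℂ) (c : ℂ) (n : ℕ) :
    weightedDivSum k (fun d m => c * a d m) n = c * weightedDivSum k a n := by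
  simp [weightedDivSum, Finset.mul_sum, mul_assoc]

lemma weightedDivSum_add (k : ℕ) (a b : ℕ → ℕ → ℂ) (n : ℕ) :
    weightedDivSum k (fun d m => a d m + b d m) n =
      weightedDivSum k a n + weightedDivSum k b n := by
  simp [weightedDivSum, Finset.sum_add_distrib, add_mul]

lemma divSum_eq_weightedDivSum (k : ℕ) {N : ℕ} [NeZero N] (c : Fin N → ℂ) (n : ℕ) :
    divSum k c n = weightedDivSum k (fun d _ => c (Fin.ofNat N d)) n := rfl

lemma conjDivSum_eq_weightedDivSum (k : ℕ) {N : ℕ} [NeZero N] (c : Fin N → ℂ) (n : ℕ) :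
    conjDivSum k c n = weightedDivSum k (fun _ m => c (Fin.ofNat N m)) n := rfl

/-- The weight `d ↦ M^(-k)` on the multiples of `M`, `0` elsewhere. -/
noncomputable def multWeight (k M d : ℕ) : ℂ := if M ∣ d then ((M : ℂ) ^ k)⁻¹ else 0

/-- Substitution of `q^M` for `q` in the Lambert series of `d^k` amounts to a weight on `d`. -/
lemma hasSum_comp_pow {k M : ℕ} (hM : M ≠ 0) {q x : ℂ}
    (h : HasSum (fun n : ℕ+ => weightedDivSum k (fun _ _ => 1) n * (q ^ M) ^ (n : ℕ)) x) :
    HasSum (fun n : ℕ+ => weightedDivSum k (fun d _ => multWeight k M d) n * q ^ (n : ℕ)) x := by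
  let M' : ℕ+ := ⟨M, Nat.pos_of_ne_zero hM⟩
  have hMc : (M : ℂ) ≠ 0 := by exact_mod_cast hM
  have hinj : Function.Injective fun n : ℕ+ => M' * n := fun a b hab => mul_left_cancel hab
  have hval : ∀ n : ℕ, weightedDivSum k (fun d _ => multWeight k M d) (M * n) =
      weightedDivSum k (fun _ _ => 1) n := by
    intro n
    rcases eq_or_ne n 0 with rfl | hn
    · simp [weightedDivSum]
    refine (Finset.sum_of_injOn (fun d => M * d) (fun a _ b _ hab => Nat.eq_of_mul_eq_mul_left
      (Nat.pos_of_ne_zero hM) hab) (fun d hd => ?_) (fun d hd hd' => ?_) fun d hd => ?_).symm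
    · simp only [Finset.mem_coe, Nat.mem_divisors] at hd ⊢
      exact ⟨Nat.mul_dvd_mul_left M hd.1, mul_ne_zero hM hn⟩
    · have : ¬ M ∣ d := by
        rintro ⟨e, rfl⟩
        refine hd' ⟨e, ?_, rfl⟩
        simp only [Finset.mem_coe, Nat.mem_divisors] at hd ⊢
        exact ⟨Nat.dvd_of_mul_dvd_mul_left (Nat.pos_of_ne_zero hM) hd.1, hn⟩
      simp [multWeight, this]
    · simp [multWeight, mul_pow]
      field_simp
  refine (hinj.hasSum_iff ?_).1 ?_
  · intro n hn
    have : weightedDivSum k (fun d _ => multWeight k M d) n = 0 := by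
      refine Finset.sum_eq_zero fun d hd => ?_
      have : ¬ M ∣ d := by
        rintro ⟨e, rfl⟩
        obtain ⟨f, hf⟩ := Nat.dvd_of_mem_divisors hd
        refine hn ⟨⟨e * f, Nat.pos_of_ne_zero fun h0 => n.ne_zero (by
          rw [hf, mul_assoc, h0, mul_zero])⟩, ?_⟩
        apply PNat.coe_injective
        change M * (e * f) = n
        rw [hf, mul_assoc]
      simp [multWeight, this]
    rw [this, zero_mul]
  · convert h using 2 with n
    change weightedDivSum k (fun d _ => multWeight k M d) (M * n) * q ^ (M * n : ℕ) = _
    rw [hval, pow_mul]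

/-! ### The Eisenstein series of level one -/

lemma eisensteinHat_triv (k : ℕ) (q : ℂ) : eisensteinHat k triv triv q =
    ∑' n : ℕ+, weightedDivSum (k - 1) (fun _ _ => 1) n * q ^ (n : ℕ) := by
  have (x : ZMod 1) : triv x = 1 := by rw [Subsingleton.elim x 1, map_one]
  simp only [eisensteinHat, this, weightedDivSum, mul_one]

/-- The constants `2 / ζ(1-k)` in `E₂`, `E₄`, `E₆`. -/
def eisConst (k : ℕ) : ℂ := if k = 2 then -24 else if k = 4 then 240 else -504

lemma two_div_riemannZeta {k : ℕ} (hk : k = 2 ∨ k = 4 ∨ k = 6) :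
    2 / riemannZeta (1 - (k : ℂ)) = eisConst k := by
  have h6 : bernoulli' 6 = 1 / 42 := by
    rw [bernoulli'_def]
    norm_num [Finset.sum_range_succ, bernoulli'_def 5, bernoulli'_four, Nat.choose]
  rcases hk with rfl | rfl | rfl
  · have := riemannZeta_neg_nat_eq_bernoulli' 1
    norm_num at this
    norm_num [eisConst, this]
  · have := riemannZeta_neg_nat_eq_bernoulli' 3
    norm_num [bernoulli'_four] at this
    norm_num [eisConst, this]
  · have := riemannZeta_neg_nat_eq_bernoulli' 5
    norm_num [h6] at this
    norm_num [eisConst, this]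

lemma E_eq {k : ℕ} (hk : k = 2 ∨ k = 4 ∨ k = 6) (q : ℂ) : E k q = 1 + eisConst k *
    ∑' n : ℕ+, weightedDivSum (k - 1) (fun _ _ => 1) n * q ^ (n : ℕ) := by
  rw [E, eisenstein, if_pos rfl, DirichletCharacter.LFunction_modOne_eq, two_div_riemannZeta hk,
    eisensteinHat_triv]

lemma hasSum_E {k : ℕ} (hk : k = 2 ∨ k = 4 ∨ k = 6) {M : ℕ} (hM : M ≠ 0) (τ : ℍ) :
    HasSum (fun n : ℕ+ => eisConst k *
      weightedDivSum (k - 1) (fun d _ => multWeight (k - 1) M d) n * nome τ ^ (n : ℕ))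
      (E k (nome τ ^ M) - 1) := by
  have hq : ‖nome τ ^ M‖ < 1 := by
    rw [norm_pow]; exact pow_lt_one₀ (norm_nonneg _) (norm_nome_lt_one τ) hM
  have h := (hasSum_weightedDivSum (a := fun _ _ => 1) (K := 1) (by simp) (k - 1)
    hq).summable.hasSum
  have h2 := (hasSum_comp_pow hM h).mul_left (eisConst k)
  rw [E_eq hk, add_sub_cancel_left]
  simpa only [mul_assoc] using h2

/-- Combinations of Eisenstein series of level one in terms of weighted divisor sums; the
coefficients need to be compared for the residues modulo `N` only. -/
lemma hasSum_divSum {k : ℕ} (hk : k = 2 ∨ k = 4 ∨ k = 6) {N : ℕ} [NeZero N] {c : Fin N → ℂ}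
    {κ α β γ : ℂ} (L M : ℕ) (hL : L ∣ N) (hM : M ∣ N)
    (h : ∀ i : Fin N, κ * c i = eisConst k *
      (α + β * multWeight (k - 1) L i + γ * multWeight (k - 1) M i)) (τ : ℍ) :
    HasSum (fun n : ℕ+ => κ * divSum (k - 1) c n * nome τ ^ (n : ℕ))
      (α * E k (nome τ) + β * E k (nome τ ^ L) + γ * E k (nome τ ^ M) - (α + β + γ)) := by
  have hw : ∀ {L : ℕ}, L ∣ N → ∀ d, multWeight (k - 1) L (Fin.ofNat N d) =
      multWeight (k - 1) L d := by
    intro L hL d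
    simp only [multWeight, Fin.val_ofNat, Nat.dvd_mod_iff hL]
  have h0 : ∀ {L : ℕ}, L ∣ N → L ≠ 0 := fun hL => ne_zero_of_dvd_ne_zero (NeZero.ne N) hL
  have h1 := (hasSum_E hk one_ne_zero τ).mul_left α
  have h2 := (hasSum_E hk (h0 hL) τ).mul_left β
  have h3 := (hasSum_E hk (h0 hM) τ).mul_left γ
  have e : α * E k (nome τ) + β * E k (nome τ ^ L) + γ * E k (nome τ ^ M) - (α + β + γ) =
      α * (E k (nome τ ^ 1) - 1) + β * (E k (nome τ ^ L) - 1) + γ * (E k (nome τ ^ M) - 1) := by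
    rw [pow_one]; ring
  rw [e]
  refine ((h1.add h2).add h3).congr_fun fun n => ?_
  have : (fun (d : ℕ) (_ : ℕ) => κ * c (Fin.ofNat N d)) = fun d _ =>
      α * (eisConst k * multWeight (k - 1) 1 d) + β * (eisConst k * multWeight (k - 1) L d) +
        γ * (eisConst k * multWeight (k - 1) M d) := by
    ext d _
    rw [h, hw hL, hw hM]
    have h1 : multWeight (k - 1) 1 d = 1 := by simp [multWeight]
    rw [h1]
    ring
  rw [divSum_eq_weightedDivSum, ← weightedDivSum_const_mul, this]
  simp only [weightedDivSum_add, weightedDivSum_const_mul]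
  ring

lemma isQ_E {k : ℕ} (hk : k = 2 ∨ k = 4 ∨ k = 6) {M : ℕ} (hM : M ≠ 0) :
    IsQ (fun τ => E k (nome τ ^ M)) 1 (if M = 1 then eisConst k else 0) := by
  have h := IsQ.of_hasSum (a := fun n => eisConst k *
    weightedDivSum (k - 1) (fun d _ => multWeight (k - 1) M d) n) (hasSum_E hk hM)
  convert h using 1
  simp [weightedDivSum, multWeight]
  by_cases h : M = 1 <;> simp [h]

lemma sigma_eq_weightedDivSum (k n : ℕ) :
    (ArithmeticFunction.sigma k n : ℂ) = weightedDivSum k (fun _ _ => 1) n := by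
  simp [ArithmeticFunction.sigma_apply, weightedDivSum]

lemma nome_def (τ : ℍ) : nome τ = Complex.exp (2 * Real.pi * Complex.I * τ) := rfl

lemma E_two_eq (τ : ℍ) : E 2 (nome τ) = EisensteinSeries.E2 τ := by
  rw [E_eq (Or.inl rfl), EisensteinSeries.E2_eq_tsum_cexp]
  simp only [sigma_eq_weightedDivSum]
  norm_num [eisConst, sub_eq_add_neg, nome_def, Function.Periodic.qParam]

lemma E_four_eq (τ : ℍ) : E 4 (nome τ) = ModularForm.E (k := 4) (by norm_num) τ := by
  rw [E_eq (by simp), EisensteinSeries.q_expansion_bernoulli _ (by decide)]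
  simp only [sigma_eq_weightedDivSum, ← nome_def, zpow_natCast]
  norm_num [eisConst, sub_eq_add_neg, bernoulli_eq_bernoulli'_of_ne_one, bernoulli'_four]

lemma E_six_eq (τ : ℍ) : E 6 (nome τ) = ModularForm.E (k := 6) (by norm_num) τ := by
  have h6 : bernoulli 6 = 1 / 42 := by
    rw [bernoulli_eq_bernoulli'_of_ne_one (by norm_num), bernoulli'_def]
    norm_num [Finset.sum_range_succ, bernoulli'_def 5, bernoulli'_four, Nat.choose]
  rw [E_eq (by simp), EisensteinSeries.q_expansion_bernoulli _ (by decide)]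
  simp only [sigma_eq_weightedDivSum, ← nome_def, zpow_natCast]
  norm_num [eisConst, sub_eq_add_neg, h6]

lemma S_smul_eq_fricke (τ : ℍ) : ModularGroup.S • τ = fricke 1 τ := by
  ext1; rw [coe_SL_smul]; simp [ModularGroup.S]

lemma nome_scale (M : ℕ) [NeZero M] (τ : ℍ) : nome (scale M τ) = nome τ ^ M :=
  nome_eq_pow (coe_scale M τ)

lemma scale_fricke {N M M' : ℕ} [NeZero N] [NeZero M] [NeZero M'] (h : N = M * M') (τ : ℍ) :
    scale M (fricke N τ) = fricke 1 (scale M' τ) := by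
  have h1 : (M : ℂ) ≠ 0 := by exact_mod_cast NeZero.ne M
  have h2 : (M' : ℂ) ≠ 0 := by exact_mod_cast NeZero.ne M'
  have := coe_ne_zero τ
  ext1
  simp only [coe_scale, coe_fricke, h]
  push_cast
  field_simp

lemma levelOne_fricke {k : ℕ} (hk : 3 ≤ k) (τ : ℍ) :
    ModularForm.E hk (fricke 1 τ) = (τ : ℂ) ^ k * ModularForm.E hk τ := by
  have h := congrFun (SlashInvariantForm.slash_action_eqn (ModularForm.E hk)
    (ModularGroup.S : GL (Fin 2) ℝ) ⟨_, rfl⟩) τ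
  have h2 := SL_slash_eq k (ModularForm.E hk) ModularGroup.S τ
  have hτ := coe_ne_zero τ
  rw [show (⇑(ModularForm.E hk) ∣[(k : ℤ)] ModularGroup.S) τ = ModularForm.E hk τ from h,
    S_smul_eq_fricke] at h2
  simp [ModularGroup.S] at h2
  rw [h2]
  field_simp

/-- The series `E_k(q^M)` and `E_k(q^M')` with `M M' = N` are exchanged by the Fricke involution of
level `N`. -/
lemma E_fricke {k : ℕ} (hk : k = 4 ∨ k = 6) {N M M' : ℕ} [NeZero N] (h : N = M * M') (τ : ℍ) :
    E k (nome (fricke N τ) ^ M) = (τ : ℂ) ^ k * (M' ^ k * E k (nome τ ^ M')) := by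
  have : NeZero M := ⟨fun h0 => NeZero.ne N (by rw [h, h0, zero_mul])⟩
  have : NeZero M' := ⟨fun h0 => NeZero.ne N (by rw [h, h0, mul_zero])⟩
  rw [← nome_scale, ← nome_scale, scale_fricke h]
  rcases hk with rfl | rfl
  · rw [E_four_eq, E_four_eq, levelOne_fricke, coe_scale]; ring
  · rw [E_six_eq, E_six_eq, levelOne_fricke, coe_scale]; ring

/-- The analogue in weight two: `E₂` is only quasimodular, with a correction term that cancels in
the combinations `N E₂(q^N) - E₂(q)`. -/
lemma E_two_fricke {N M M' : ℕ} [NeZero N] (h : N = M * M') (τ : ℍ) :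
    E 2 (nome (fricke N τ) ^ M) = (τ : ℂ) ^ 2 * (M' ^ 2 * E 2 (nome τ ^ M')) +
      6 / (Real.pi * Complex.I) * (M' * τ) := by
  have : NeZero M := ⟨fun h0 => NeZero.ne N (by rw [h, h0, zero_mul])⟩
  have : NeZero M' := ⟨fun h0 => NeZero.ne N (by rw [h, h0, mul_zero])⟩
  rw [← nome_scale, ← nome_scale, scale_fricke h, E_two_eq, E_two_eq, ← S_smul_eq_fricke]
  set σ := scale M' τ with hσ
  have key := congrFun (EisensteinSeries.E2_slash_action ModularGroup.S) σ
  have hs := coe_ne_zero σ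
  have hp : (Real.pi : ℂ) ≠ 0 := by exact_mod_cast Real.pi_ne_zero
  have h2 := SL_slash_eq 2 EisensteinSeries.E2 ModularGroup.S σ
  rw [Nat.cast_ofNat, key, Pi.sub_apply, Pi.smul_apply, EisensteinSeries.D2_S,
    riemannZeta_two] at h2
  simp [ModularGroup.S] at h2
  have h3 : EisensteinSeries.E2 (ModularGroup.S • σ) = (σ : ℂ) ^ 2 * EisensteinSeries.E2 σ -
     (σ : ℂ) ^ 2 * ((6 / (Real.pi : ℂ) ^ 2 * 2⁻¹) * (2 * Real.pi * Complex.I / σ)) := by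
    field_simp at h2 ⊢
    exact h2.symm
  rw [h3, hσ, coe_scale]
  have hτ := coe_ne_zero τ
  have hM : (M' : ℂ) ≠ 0 := by exact_mod_cast NeZero.ne M'
  field_simp
  linear_combination -6 * Complex.I_sq

/-! ### Products of Fricke pairs -/

namespace FrickePair

variable {N : ℕ} [NeZero N] {k l : ℕ} {f g f' g' : ℍ → ℂ}

lemma mul (h : FrickePair N k f g) (h' : FrickePair N l f' g') :
    FrickePair N (k + l) (fun τ => f τ * f' τ) (fun τ => g τ * g' τ) where
  left := by
    obtain ⟨_, _, h1⟩ := h.left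
    obtain ⟨_, _, h2⟩ := h'.left
    exact ⟨_, _, h1.mul h2⟩
  right := by
    obtain ⟨_, _, h1⟩ := h.right
    obtain ⟨_, _, h2⟩ := h'.right
    exact ⟨_, _, h1.mul h2⟩
  law τ := by rw [h.law, h'.law]; ring
  half hN := by
    obtain ⟨u, hu, hu'⟩ := h.half hN
    obtain ⟨v, hv, hv'⟩ := h'.half hN
    exact ⟨fun τ => u τ * v τ, hu.mul hv, fun τ => by rw [hu', hv']; ring⟩

lemma one : FrickePair N 0 (fun _ => 1) (fun _ => 1) where
  left := ⟨_, _, IsQ.const 1⟩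
  right := ⟨_, _, IsQ.const 1⟩
  law τ := by simp
  half _ := ⟨fun _ => 1, (IsQ.const 1).isBoundedAtImInfty, fun _ => by simp⟩

lemma pow (h : FrickePair N k f g) (n : ℕ) :
    FrickePair N (k * n) (fun τ => f τ ^ n) (fun τ => g τ ^ n) := by
  induction n with
  | zero => simpa using one
  | succ n ih => simpa only [pow_succ, mul_add, mul_one] using ih.mul h

end FrickePair

/-! ### Level two -/

lemma isQ_E_comb {k : ℕ} (hk : k = 2 ∨ k = 4 ∨ k = 6) {M : ℕ} (hM : 2 ≤ M) (α β : ℂ) :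
    IsQ (fun τ => α * E k (nome τ ^ M) + β * E k (nome τ)) (α + β) (β * eisConst k) := by
  have h1 := isQ_E hk one_ne_zero
  have h2 := isQ_E hk (show M ≠ 0 by omega)
  rw [if_neg (by omega)] at h2
  simpa using (h2.const_mul α).add (h1.const_mul β)

/-- The Eisenstein series that is `𝒜₄²`. -/
noncomputable def eisTwo (τ : ℍ) : ℂ := 2 * E 2 (nome τ ^ 2) - E 2 (nome τ)

lemma isQ_eisTwo : IsQ eisTwo 1 24 := by
  have h := (isQ_E_comb (k := 2) (by simp) (M := 2) le_rfl 2 (-1)).congr (g := eisTwo)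
    fun τ => by rw [eisTwo]; ring
  norm_num [eisConst] at h
  exact h

lemma eisTwo_fricke (τ : ℍ) : eisTwo (fricke 2 τ) = (τ : ℂ) ^ 2 * (-2 * eisTwo τ) := by
  have h1 := E_two_fricke (N := 2) (M := 1) (M' := 2) rfl τ
  have h2 := E_two_fricke (N := 2) (M := 2) (M' := 1) rfl τ
  rw [pow_one] at h1 h2
  rw [eisTwo, eisTwo, h1, h2]
  push_cast
  ring

lemma E_fricke_left {k : ℕ} (hk : k = 4 ∨ k = 6) (N : ℕ) [NeZero N] (τ : ℍ) :
    E k (nome (fricke N τ)) = (τ : ℂ) ^ k * (N ^ k * E k (nome τ ^ N)) := by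
  have := E_fricke hk (N := N) (M := 1) (M' := N) (by simp) τ
  rwa [pow_one] at this

lemma E_fricke_right {k : ℕ} (hk : k = 4 ∨ k = 6) (N : ℕ) [NeZero N] (τ : ℍ) :
    E k (nome (fricke N τ) ^ N) = (τ : ℂ) ^ k * E k (nome τ) := by
  have := E_fricke hk (N := N) (M := N) (M' := 1) (by simp) τ
  simpa using this

lemma B₄_pow_eq (τ : ℍ) : B₄ τ ^ 4 = 1 / 15 * (16 * E 4 (nome τ ^ 2) - E 4 (nome τ)) := by
  obtain ⟨b, hB⟩ := isQ_B₄_pow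
  have h1 := isQ_E_comb (k := 4) (by simp) (M := 2) le_rfl (16 / 15) (-1 / 15)
  have h2 := isQ_E_comb (k := 4) (by simp) (M := 2) le_rfl (-16 / 15) (16 / 15)
  norm_num at h1 h2
  have h := eq_mul_of_fricke (N := 2) (k := 4) le_rfl (by norm_num) h1 h2 hB
    (by simpa using isQ_C₄_pow.const_mul 4) (by norm_num) (fun τ => pow_ne_zero _ (B₄_ne_zero τ))
    (fun τ => mul_ne_zero (by norm_num) (C₄_pow_ne_zero τ))
    (fun τ => by
      rw [E_fricke_left (by simp), E_fricke_right (by simp)]; push_cast; ring)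
    B₄_pow_fricke (by norm_num) τ
  rw [one_mul] at h
  rw [← h]
  ring

lemma C₄_pow_eq (τ : ℍ) : C₄ τ ^ 4 = -(4 / 15) * (E 4 (nome τ ^ 2) - E 4 (nome τ)) := by
  have h := B₄_pow_fricke τ
  rw [B₄_pow_eq, E_fricke_left (by simp), E_fricke_right (by simp)] at h
  have hτ := pow_ne_zero 4 (coe_ne_zero τ)
  apply mul_left_cancel₀ hτ
  push_cast at h
  linear_combination -(1 / 4) * h

lemma eisTwo_sq (τ : ℍ) : eisTwo τ ^ 2 = B₄ τ ^ 4 + C₄ τ ^ 4 := by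
  obtain ⟨b, hB⟩ := isQ_B₄_pow
  have h1 := (isQ_eisTwo.pow 2).sub isQ_C₄_pow
  have h2 := ((isQ_eisTwo.pow 2).const_mul 4).sub (hB.const_mul 4)
  norm_num at h1 h2
  have h := eq_mul_of_fricke (N := 2) (k := 4) le_rfl (by norm_num) h1 h2 hB
    (by simpa using isQ_C₄_pow.const_mul 4) (by norm_num) (fun τ => pow_ne_zero _ (B₄_ne_zero τ))
    (fun τ => mul_ne_zero (by norm_num) (C₄_pow_ne_zero τ))
    (fun τ => by rw [eisTwo_fricke, C₄_pow_fricke]; ring)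
    B₄_pow_fricke (by norm_num) τ
  linear_combination h

/-- The Eisenstein series `(64 E₆(q²) - E₆(q)) / 63` vanishes at the cusp `0`, so that its quotient
by `ℬ₄⁴` has no poles; being of weight two, it is determined by its value at `i∞`. -/
lemma eisTwo_mul_B₄_pow (τ : ℍ) :
    eisTwo τ * B₄ τ ^ 4 = 1 / 63 * (64 * E 6 (nome τ ^ 2) - E 6 (nome τ)) := by
  obtain ⟨b, hB⟩ := isQ_B₄_pow
  have hB0 : ∀ τ, B₄ τ ^ 4 ≠ 0 := fun τ => pow_ne_zero _ (B₄_ne_zero τ)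
  have h1 := isQ_E_comb (k := 6) (by simp) (M := 2) le_rfl (64 / 63) (-1 / 63)
  have h2 := isQ_E_comb (k := 6) (by simp) (M := 2) le_rfl (8 / 63) (-8 / 63)
  norm_num [eisConst] at h1 h2
  obtain ⟨_, h3⟩ := h1.div hB one_ne_zero hB0
  obtain ⟨_, h4⟩ := h2.div_of_zero isQ_C₄_pow (by norm_num) C₄_pow_ne_zero
  have h5 := h3.sub isQ_eisTwo
  have h6 := (h4.const_mul (-2)).add (isQ_eisTwo.const_mul 2)
  norm_num at h5 h6
  have h := eq_zero_of_fricke (N := 2) (k := 2) (c := 4) (m := 2) (n := 1) le_rfl (by norm_num)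
    h5 h6 isQ_C₄_pow (hB.const_mul 4) (by norm_num) (by norm_num) C₄_pow_ne_zero
    (fun τ => mul_ne_zero (by norm_num) (hB0 τ))
    (fun τ => by
      have := hB0 τ
      have := C₄_pow_ne_zero τ
      have := coe_ne_zero τ
      rw [eisTwo_fricke, B₄_pow_fricke, E_fricke_left (by simp), E_fricke_right (by simp)]
      push_cast
      field_simp
      ring)
    C₄_pow_fricke (by norm_num) (by norm_num) τ
  have := hB0 τ
  rw [sub_eq_zero, div_eq_iff this] at h
  linear_combination -h

lemma eisTwo_mul_C₄_pow (τ : ℍ) :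
    eisTwo τ * C₄ τ ^ 4 = 8 / 63 * (E 6 (nome τ ^ 2) - E 6 (nome τ)) := by
  have h := eisTwo_mul_B₄_pow (fricke 2 τ)
  rw [eisTwo_fricke, B₄_pow_fricke, E_fricke_left (by simp), E_fricke_right (by simp)] at h
  have hτ := pow_ne_zero 6 (coe_ne_zero τ)
  apply mul_left_cancel₀ hτ
  push_cast at h
  linear_combination -(1 / 8) * h

lemma frickePair_eisTwo : FrickePair 2 2 eisTwo (fun τ => -2 * eisTwo τ) where
  left := ⟨_, _, isQ_eisTwo⟩
  right := ⟨_, _, isQ_eisTwo.const_mul _⟩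
  law := eisTwo_fricke
  half := by norm_num

lemma frickePair_B₄_pow : FrickePair 2 4 (fun τ => B₄ τ ^ 4) (fun τ => 4 * C₄ τ ^ 4) where
  left := ⟨_, isQ_B₄_pow⟩
  right := ⟨_, _, isQ_C₄_pow.const_mul _⟩
  law := B₄_pow_fricke
  half := by norm_num

lemma frickePair_C₄_pow : FrickePair 2 4 (fun τ => C₄ τ ^ 4) (fun τ => 4 * B₄ τ ^ 4) where
  left := ⟨_, _, isQ_C₄_pow⟩
  right := by obtain ⟨_, h⟩ := isQ_B₄_pow; exact ⟨_, _, h.const_mul _⟩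
  law := C₄_pow_fricke
  half := by norm_num

/-! ### Level three -/

lemma B₃_pow_ne_zero (τ : ℍ) : B₃ τ ^ 3 ≠ 0 := pow_ne_zero _ (B₃_ne_zero τ)

lemma C₃_pow_ne_zero (τ : ℍ) : C₃ τ ^ 3 ≠ 0 := pow_ne_zero _ (C₃_ne_zero τ)

/-- The Eisenstein series that is `𝒜₃²`. -/
noncomputable def eisThree (τ : ℍ) : ℂ := 1 / 2 * (3 * E 2 (nome τ ^ 3) - E 2 (nome τ))

lemma isQ_eisThree : IsQ eisThree 1 12 := by
  have h := (isQ_E_comb (k := 2) (by simp) (M := 3) (by norm_num) (3 / 2) (-1 / 2)).congr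
    (g := eisThree) fun τ => by rw [eisThree]; ring
  norm_num [eisConst] at h
  exact h

lemma eisThree_fricke (τ : ℍ) : eisThree (fricke 3 τ) = (τ : ℂ) ^ 2 * (-3 * eisThree τ) := by
  have h1 := E_two_fricke (N := 3) (M := 1) (M' := 3) rfl τ
  have h2 := E_two_fricke (N := 3) (M := 3) (M' := 1) rfl τ
  rw [pow_one] at h1 h2
  rw [eisThree, eisThree, h1, h2]
  push_cast
  ring

/-- The function `𝒜₃`, defined by the formula for `𝒜₃ ℬ₃³`. -/
noncomputable def cubicA (τ : ℍ) : ℂ := 1 / 80 * (81 * E 4 (nome τ ^ 3) - E 4 (nome τ)) / B₃ τ ^ 3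

lemma cubicA_mul_B₃_pow (τ : ℍ) :
    cubicA τ * B₃ τ ^ 3 = 1 / 80 * (81 * E 4 (nome τ ^ 3) - E 4 (nome τ)) :=
  div_mul_cancel₀ _ (B₃_pow_ne_zero τ)

/-- The image of `𝒜₃` under the Fricke involution, up to a factor; it is again `𝒜₃`. -/
noncomputable def cubicA' (τ : ℍ) : ℂ := -(9 / 80) * (E 4 (nome τ ^ 3) - E 4 (nome τ)) / C₃ τ ^ 3

lemma exists_isQ_cubicA : ∃ a, IsQ cubicA 1 a := by
  obtain ⟨b, hB⟩ := isQ_B₃_pow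
  have h1 := isQ_E_comb (k := 4) (by simp) (M := 3) (by norm_num) (81 / 80) (-1 / 80)
  obtain ⟨a, h⟩ := h1.div hB one_ne_zero B₃_pow_ne_zero
  have h' := h.congr (g := cubicA) fun τ => by rw [cubicA]; ring
  norm_num at h'
  exact ⟨a, h'⟩

lemma exists_isQ_cubicA' : ∃ a, IsQ cubicA' 1 a := by
  have h1 := isQ_E_comb (k := 4) (by simp) (M := 3) (by norm_num) (-9 / 80) (9 / 80)
  norm_num [eisConst] at h1
  obtain ⟨a, h⟩ := h1.div_of_zero isQ_C₃_pow (by norm_num) C₃_pow_ne_zero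
  have h' := h.congr (g := cubicA') fun τ => by rw [cubicA']; ring
  norm_num at h'
  exact ⟨a, h'⟩

lemma cubicA_fricke' (τ : ℍ) : cubicA (fricke 3 τ) = τ * (9 / kappa * cubicA' τ) := by
  have := B₃_pow_ne_zero τ
  have := C₃_pow_ne_zero τ
  have := coe_ne_zero τ
  have := kappa_ne_zero
  rw [cubicA, cubicA', B₃_pow_fricke, E_fricke_left (by simp), E_fricke_right (by simp)]
  push_cast
  field_simp
  ring

lemma nine_div_kappa_sq : (9 / kappa) ^ 2 = -3 := by
  rw [div_pow, kappa_sq]; norm_num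

lemma nine_div_kappa_pow_three : (9 / kappa) ^ 3 = kappa := by
  have := kappa_ne_zero
  rw [pow_succ, nine_div_kappa_sq]
  field_simp
  linear_combination -kappa_sq

/-- `𝒜₃² - (3E₂(q³) - E₂(q)) / 2` has weight two, is holomorphic and vanishes at `i∞`, whereas the
form `𝒞₃³` of weight three has a simple zero there and no other. -/
lemma cubicA_sq (τ : ℍ) : cubicA τ ^ 2 = eisThree τ := by
  obtain ⟨b, hB⟩ := isQ_B₃_pow
  obtain ⟨_, h1⟩ := exists_isQ_cubicA
  obtain ⟨_, h2⟩ := exists_isQ_cubicA'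
  have h3 := (h1.pow 2).sub isQ_eisThree
  have h4 := ((h2.pow 2).const_mul (-3)).add (isQ_eisThree.const_mul 3)
  norm_num at h3
  have h := eq_zero_of_fricke (N := 3) (k := 2) (c := 3) (m := 3) (n := 2) (by norm_num)
    (by norm_num) h3 h4 isQ_C₃_pow (hB.const_mul kappa) (by norm_num)
    (by simpa using kappa_ne_zero) C₃_pow_ne_zero
    (fun τ => mul_ne_zero kappa_ne_zero (B₃_pow_ne_zero τ))
    (fun τ => by
      rw [cubicA_fricke', eisThree_fricke, mul_pow, mul_pow, nine_div_kappa_sq]; ring)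
    C₃_pow_fricke (by norm_num) (by norm_num) τ
  exact sub_eq_zero.1 h

lemma cubicA'_eq (τ : ℍ) : cubicA' τ = cubicA τ := by
  obtain ⟨_, h1⟩ := exists_isQ_cubicA
  obtain ⟨_, h2⟩ := exists_isQ_cubicA'
  refine eq_of_sq_eq h2 h1 (fun τ => ?_) τ
  have h := cubicA_sq (fricke 3 τ)
  rw [cubicA_fricke', eisThree_fricke, mul_pow, mul_pow, nine_div_kappa_sq] at h
  have hτ := pow_ne_zero 2 (coe_ne_zero τ)
  rw [cubicA_sq]
  apply mul_left_cancel₀ hτ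
  linear_combination -(1 / 3) * h

lemma cubicA_fricke (τ : ℍ) : cubicA (fricke 3 τ) = τ * (9 / kappa * cubicA τ) := by
  rw [cubicA_fricke', cubicA'_eq]

lemma cubicA_mul_C₃_pow (τ : ℍ) :
    cubicA τ * C₃ τ ^ 3 = -(9 / 80) * (E 4 (nome τ ^ 3) - E 4 (nome τ)) := by
  rw [← cubicA'_eq]
  exact div_mul_cancel₀ _ (C₃_pow_ne_zero τ)

lemma isQ_cubicA : IsQ cubicA 1 6 := by
  obtain ⟨a, h⟩ := exists_isQ_cubicA
  have h2 := (((h.pow 2).congr fun τ => (cubicA_sq τ).symm).coeff_unique isQ_eisThree).2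
  have : a = 6 := by
    norm_num at h2
    linear_combination (1 / 2) * h2
  rwa [this] at h

lemma cubicA_pow_three (τ : ℍ) : cubicA τ ^ 3 = B₃ τ ^ 3 + C₃ τ ^ 3 := by
  obtain ⟨b, hB⟩ := isQ_B₃_pow
  have h1 := (isQ_cubicA.pow 3).sub isQ_C₃_pow
  have h2 := ((isQ_cubicA.pow 3).sub hB).const_mul kappa
  have hC := isQ_C₃_pow.const_mul kappa
  norm_num at h1 h2 hC
  have h := eq_mul_of_fricke (N := 3) (k := 3) (by norm_num) (by norm_num) h1 h2 hB
    hC (by simpa using kappa_ne_zero) B₃_pow_ne_zero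
    (fun τ => mul_ne_zero kappa_ne_zero (C₃_pow_ne_zero τ))
    (fun τ => by
      rw [cubicA_fricke, C₃_pow_fricke, mul_pow, mul_pow, nine_div_kappa_pow_three]; ring)
    B₃_pow_fricke (by norm_num) τ
  linear_combination h

lemma isQ_B₃_pow_three : IsQ (fun τ => B₃ τ ^ 3) 1 (-9) := by
  have h := ((isQ_cubicA.pow 3).sub isQ_C₃_pow).congr (g := fun τ => B₃ τ ^ 3) fun τ => by
    rw [cubicA_pow_three]; ring
  norm_num at h
  exact h

lemma frickePair_cubicA : FrickePair 3 1 cubicA (fun τ => 9 / kappa * cubicA τ) where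
  left := ⟨_, _, isQ_cubicA⟩
  right := ⟨_, _, isQ_cubicA.const_mul _⟩
  law τ := by rw [cubicA_fricke, pow_one]
  half := by norm_num

lemma frickePair_B₃_pow : FrickePair 3 3 (fun τ => B₃ τ ^ 3) (fun τ => kappa * C₃ τ ^ 3) where
  left := ⟨_, _, isQ_B₃_pow_three⟩
  right := ⟨_, _, isQ_C₃_pow.const_mul _⟩
  law := B₃_pow_fricke
  half := by norm_num

lemma frickePair_C₃_pow : FrickePair 3 3 (fun τ => C₃ τ ^ 3) (fun τ => kappa * B₃ τ ^ 3) where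
  left := ⟨_, _, isQ_C₃_pow⟩
  right := ⟨_, _, isQ_B₃_pow_three.const_mul _⟩
  law := C₃_pow_fricke
  half := by norm_num

/-! ### Level four -/

lemma nome_halfShift (τ : ℍ) : nome (halfShift τ) = -nome τ := by
  rw [nome, nome, coe_halfShift, mul_sub, Complex.exp_sub,
    show 2 * (Real.pi : ℂ) * Complex.I * (1 / 2) = Real.pi * Complex.I by ring,
    Complex.exp_pi_mul_I, div_neg, div_one]

lemma IsQ.comp_halfShift {f : ℍ → ℂ} {a₀ a₁ : ℂ} (hf : IsQ f a₀ a₁) :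
    IsQ (fun τ => f (halfShift τ)) a₀ (-a₁) := by
  obtain ⟨Φ, h1, h2, h3, h4⟩ := hf
  refine ⟨fun q => Φ (-q), h1.comp (by fun_prop) fun q hq => by simpa using hq,
    by simpa using h2, ?_, fun τ => by simp only [h4, nome_halfShift]⟩
  have h3' : HasDerivAt Φ a₁ (-0) := by simpa using h3
  simpa [Function.comp_def] using h3'.comp 0 (hasDerivAt_neg (0 : ℂ))

/-- The two expressions `ℬ₂⁴ + 𝒜₂² 𝒞₂²` and `𝒜₂² ℬ₂² + 𝒞₂⁴` are both equal to `E₄(q²)`; their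
difference is `(ℬ₂² - 𝒞₂²)(ℬ₂² + 𝒞₂² - 𝒜₂²)`, and the first factor tends to `1` at `i∞`. -/
lemma thetaSq_sq (τ : ℍ) : thetaSq τ ^ 2 = B₂ τ ^ 2 + C₂ τ ^ 2 := by
  obtain ⟨_, hB⟩ := isQ_B₂
  obtain ⟨_, hA⟩ := isQ_thetaSq
  have h1 := (hB.pow 2).sub isQ_C₂_sq
  have h2 := ((hB.pow 2).add isQ_C₂_sq).sub (hA.pow 2)
  norm_num at h1
  have := eq_zero_of_mul_eq_zero h1 h2 (fun τ => by
    have e1 : B₂ τ ^ 4 = _ := B₄_pow_eq τ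
    have e2 := thetaSq_mul_C₂_sq τ
    have e3 := thetaSq_mul_B₂_sq τ
    have e4 := C₂_pow_four τ
    rw [C₄_pow_eq] at e2 e4
    rw [B₄_pow_eq] at e3
    simp only [nome_scale] at e3 e4
    linear_combination e1 + e2 - e3 - e4) τ
  linear_combination -this

lemma eisTwo_eq (τ : ℍ) : eisTwo τ = B₂ τ ^ 2 + 2 * C₂ τ ^ 2 := by
  obtain ⟨_, hB⟩ := isQ_B₂
  have h1 := (hB.pow 2).add (isQ_C₂_sq.const_mul 2)
  norm_num at h1
  refine eq_of_sq_eq isQ_eisTwo h1 (fun τ => ?_) τ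
  have e1 : B₂ τ ^ 4 = B₄ τ ^ 4 := rfl
  linear_combination eisTwo_sq τ - e1 - 4 * thetaSq_mul_C₂_sq τ + 4 * C₂ τ ^ 2 * thetaSq_sq τ

lemma IsQ.comp_scale_two {f : ℍ → ℂ} {a₀ a₁ : ℂ} (hf : IsQ f a₀ a₁) :
    ∃ b, IsQ (fun τ => f (scale 2 τ)) a₀ b := by
  obtain ⟨Φ, h1, h2, h3, h4⟩ := hf
  have := IsQ.of_differentiableOn (f := fun τ => f (scale 2 τ)) (Φ := fun q => Φ (q ^ 2))
    (h1.comp (by fun_prop) fun q hq => by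
      simp only [mem_ball_zero_iff, norm_pow] at hq ⊢
      exact pow_lt_one₀ (norm_nonneg _) hq two_ne_zero) fun τ => by rw [h4, nome_scale]
  simpa [h2] using this

lemma eisTwo_scale_two_eq (τ : ℍ) : eisTwo (scale 2 τ) = B₂ τ ^ 2 + 1 / 2 * C₂ τ ^ 2 := by
  obtain ⟨_, hB⟩ := isQ_B₂
  obtain ⟨_, hA⟩ := isQ_eisTwo.comp_scale_two
  have h1 := (hB.pow 2).add (isQ_C₂_sq.const_mul (1 / 2))
  norm_num at h1
  have h := eq_of_sq_eq hA h1 (fun τ => ?_) τ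
  · rw [h, one_div]
  rw [eisTwo_sq]
  linear_combination B₂ τ ^ 2 * thetaSq_sq τ - thetaSq_mul_B₂_sq τ - 1 / 4 * C₂_pow_four τ

lemma eisTwo_scale_two (τ : ℍ) : eisTwo (scale 2 τ) = 2 * E 2 (nome τ ^ 4) - E 2 (nome τ ^ 2) := by
  rw [eisTwo, nome_scale, ← pow_mul]

lemma C₂_sq_eq_eis (τ : ℍ) : C₂ τ ^ 2 =
    -(2 / 3) * (2 * E 2 (nome τ ^ 4) - 3 * E 2 (nome τ ^ 2) + E 2 (nome τ)) := by
  have h1 := eisTwo_eq τ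
  have h2 := eisTwo_scale_two_eq τ
  rw [eisTwo_scale_two] at h2
  rw [eisTwo] at h1
  linear_combination -2 / 3 * h1 + 2 / 3 * h2

lemma B₂_sq_eq_eis (τ : ℍ) : B₂ τ ^ 2 =
    1 / 3 * (8 * E 2 (nome τ ^ 4) - 6 * E 2 (nome τ ^ 2) + E 2 (nome τ)) := by
  have h1 := eisTwo_eq τ
  rw [eisTwo, C₂_sq_eq_eis] at h1
  linear_combination -h1

lemma thetaSq_sq_eq_eis (τ : ℍ) :
    thetaSq τ ^ 2 = 1 / 3 * (4 * E 2 (nome τ ^ 4) - E 2 (nome τ)) := by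
  rw [thetaSq_sq, C₂_sq_eq_eis, B₂_sq_eq_eis]
  ring

/-! #### Translation by one half -/

lemma eulerProd_halfShift {δ : ℕ} (hδ : Even δ) (τ : ℍ) :
    eulerProd δ (halfShift τ) = eulerProd δ τ := by
  rw [eulerProd, eulerProd, nome_halfShift, hδ.neg_pow]

lemma C₂_sq_halfShift (τ : ℍ) : C₂ (halfShift τ) ^ 2 = -C₂ τ ^ 2 := by
  rw [C₂_sq_eq, C₂_sq_eq, eulerProd_halfShift (by decide), eulerProd_halfShift (by decide),
    nome_halfShift]
  ring

lemma B₄_scale_two_pow (τ : ℍ) : B₄ (scale 2 τ) ^ 4 = eulerProd 2 τ ^ 16 / eulerProd 4 τ ^ 8 := by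
  have := nomeRoot_ne_zero τ
  have := eulerProd_ne_zero (δ := 4) (by norm_num) τ
  rw [B₄, etaMul_scale, etaMul_scale, etaMul_eq, etaMul_eq]
  field_simp
  ring

/-- As `𝒜₂² ℬ₂²` is a function of `q²`, it is invariant under the translation, which changes the
sign of `𝒞₂²`; this makes the product of `ℬ₂(τ - 1/2)² - 𝒜₂(τ)²` and `ℬ₂(τ - 1/2)² + ℬ₂(τ)²` zero,
and the second factor does not vanish at `i∞`. -/
lemma B₂_sq_halfShift (τ : ℍ) : B₂ (halfShift τ) ^ 2 = thetaSq τ ^ 2 := by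
  obtain ⟨_, hB⟩ := isQ_B₂
  obtain ⟨_, hA⟩ := isQ_thetaSq
  have h1 := (((hB.pow 2).comp_halfShift).add (hB.pow 2)).const_mul (1 / 2)
  have h2 := ((hB.pow 2).comp_halfShift).sub (hA.pow 2)
  norm_num at h1
  have h := eq_zero_of_mul_eq_zero h1 h2 (fun τ => by
    have e := thetaSq_mul_B₂_sq (halfShift τ)
    rw [B₄_scale_two_pow, eulerProd_halfShift (by decide), eulerProd_halfShift (by decide),
      ← B₄_scale_two_pow, ← thetaSq_mul_B₂_sq, thetaSq_sq, C₂_sq_halfShift] at e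
    have e2 := thetaSq_sq τ
    linear_combination 1 / 2 * e - 1 / 2 * B₂ (halfShift τ) ^ 2 * e2) τ
  exact sub_eq_zero.1 h

lemma thetaSq_halfShift (τ : ℍ) : thetaSq (halfShift τ) = B₂ τ := by
  obtain ⟨_, hB⟩ := isQ_B₂
  obtain ⟨_, hA⟩ := isQ_thetaSq
  refine eq_of_sq_eq hA.comp_halfShift hB (fun τ => ?_) τ
  rw [thetaSq_sq, B₂_sq_halfShift, C₂_sq_halfShift, thetaSq_sq]
  ring

lemma B₂_halfShift (τ : ℍ) : B₂ (halfShift τ) = thetaSq τ := by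
  obtain ⟨_, hB⟩ := isQ_B₂
  obtain ⟨_, hA⟩ := isQ_thetaSq
  exact eq_of_sq_eq hB.comp_halfShift hA B₂_sq_halfShift τ

lemma frickePair_thetaSq : FrickePair 4 1 thetaSq (fun τ => -2 * Complex.I * thetaSq τ) where
  left := ⟨_, isQ_thetaSq⟩
  right := by obtain ⟨_, h⟩ := isQ_thetaSq; exact ⟨_, _, h.const_mul _⟩
  law τ := by rw [thetaSq_fricke]; ring
  half _ := ⟨fun τ => -4 * C₂ τ, Asymptotics.IsBigO.const_mul_left isBoundedAtImInfty_C₂ _,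
    fun τ => by
      rw [thetaSq_halfShift, B₂_fricke]
      linear_combination 4 * τ * C₂ τ * Complex.I_sq⟩

lemma frickePair_B₂_sq : FrickePair 4 2 (fun τ => B₂ τ ^ 2) (fun τ => -4 * C₂ τ ^ 2) where
  left := by obtain ⟨_, h⟩ := isQ_B₂; exact ⟨_, _, h.pow 2⟩
  right := ⟨_, _, isQ_C₂_sq.const_mul _⟩
  law τ := by
    rw [B₂_fricke]
    linear_combination 4 * (τ : ℂ) ^ 2 * C₂ τ ^ 2 * Complex.I_sq
  half _ := ⟨fun τ => -16 * B₂ τ ^ 2, by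
      obtain ⟨_, h⟩ := isQ_B₂; exact ((h.pow 2).const_mul _).isBoundedAtImInfty,
    fun τ => by
      rw [C₂_sq_halfShift, C₂_fricke]
      linear_combination 16 * (τ : ℂ) ^ 2 * B₂ τ ^ 2 * Complex.I_sq⟩

lemma frickePair_C₂_sq : FrickePair 4 2 (fun τ => C₂ τ ^ 2) (fun τ => -4 * B₂ τ ^ 2) where
  left := ⟨_, _, isQ_C₂_sq⟩
  right := by obtain ⟨_, h⟩ := isQ_B₂; exact ⟨_, _, (h.pow 2).const_mul _⟩
  law τ := by
    rw [C₂_fricke]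
    linear_combination 4 * (τ : ℂ) ^ 2 * B₂ τ ^ 2 * Complex.I_sq
  half _ := ⟨fun τ => 16 * thetaSq τ ^ 2, by
      obtain ⟨_, h⟩ := isQ_thetaSq; exact ((h.pow 2).const_mul _).isBoundedAtImInfty,
    fun τ => by
      rw [B₂_halfShift, thetaSq_fricke]
      linear_combination -16 * (τ : ℂ) ^ 2 * thetaSq τ ^ 2 * Complex.I_sq⟩

lemma isQ_thetaSq_four : IsQ thetaSq 1 4 := by
  obtain ⟨a, h⟩ := isQ_thetaSq
  have h1 := (isQ_E_comb (k := 2) (by simp) (M := 4) (by norm_num) (4 / 3) (-1 / 3)).congr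
    (g := fun τ => thetaSq τ ^ 2) fun τ => by rw [thetaSq_sq_eq_eis]; ring
  have h2 := ((h.pow 2).coeff_unique h1).2
  have : a = 4 := by
    norm_num [eisConst] at h2
    linear_combination (1 / 2) * h2
  rwa [this] at h

lemma isQ_B₂_sq : IsQ (fun τ => B₂ τ ^ 2) 1 (-8) := by
  have h := ((isQ_thetaSq_four.pow 2).sub isQ_C₂_sq).congr (g := fun τ => B₂ τ ^ 2)
    fun τ => by rw [thetaSq_sq]; ring
  norm_num at h
  exact h

/-! ### Lambert series with periodic coefficients -/

section periodic

variable {N : ℕ} [NeZero N]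

lemma norm_le_sum_norm {α : Type*} [Fintype α] (c : α → ℂ) (x : α) : ‖c x‖ ≤ ∑ y, ‖c y‖ :=
  Finset.single_le_sum (f := fun y => ‖c y‖) (fun _ _ => norm_nonneg _) (Finset.mem_univ x)

/-- The Lambert series `∑ a(d) b(m) d^k q^(dm)` with coefficients periodic modulo `N`. -/
noncomputable def lambert (k : ℕ) (a b : ZMod N → ℂ) (q : ℂ) : ℂ :=
  ∑' p : ℕ+ × ℕ+, a (p.1 : ℕ) * b (p.2 : ℕ) * (p.1 : ℂ) ^ k * q ^ (p.1 * p.2 : ℕ)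

lemma norm_mul_le (a b : ZMod N → ℂ) (d m : ℕ) :
    ‖a d * b m‖ ≤ (∑ y, ‖a y‖) * ∑ y, ‖b y‖ := by
  rw [norm_mul]
  exact mul_le_mul (norm_le_sum_norm a _) (norm_le_sum_norm b _) (norm_nonneg _)
    (Finset.sum_nonneg fun _ _ => norm_nonneg _)

lemma hasSum_lambert (k : ℕ) (a b : ZMod N → ℂ) {q : ℂ} (hq : ‖q‖ < 1) :
    HasSum (fun n : ℕ+ => weightedDivSum k (fun d m => a d * b m) n * q ^ (n : ℕ))
      (lambert k a b q) :=
  hasSum_weightedDivSum (a := fun d m => a d * b m) (norm_mul_le a b) k hq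

lemma summable_lambert (k : ℕ) (a b : ZMod N → ℂ) {q : ℂ} (hq : ‖q‖ < 1) :
    Summable fun p : ℕ+ × ℕ+ => a (p.1 : ℕ) * b (p.2 : ℕ) * (p.1 : ℂ) ^ k * q ^ (p.1 * p.2 : ℕ) :=
  summable_weighted_prod (a := fun d m => a d * b m) (norm_mul_le a b) k hq

lemma lambert_eq_tsum_left (k : ℕ) (a b : ZMod N → ℂ) {q : ℂ} (hq : ‖q‖ < 1) :
    lambert k a b q = ∑' d : ℕ+, a (d : ℕ) * (d : ℂ) ^ k *
      ∑' m : ℕ+, b (m : ℕ) * (q ^ (d : ℕ)) ^ (m : ℕ) := by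
  rw [lambert, (summable_lambert k a b hq).tsum_prod]
  refine tsum_congr fun d => ?_
  rw [← tsum_mul_left]
  refine tsum_congr fun m => ?_
  simp only [pow_mul]
  ring

lemma summable_lambert_left (k : ℕ) (a b : ZMod N → ℂ) {q : ℂ} (hq : ‖q‖ < 1) :
    Summable fun d : ℕ+ => a (d : ℕ) * (d : ℂ) ^ k *
      ∑' m : ℕ+, b (m : ℕ) * (q ^ (d : ℕ)) ^ (m : ℕ) := by
  refine (summable_lambert k a b hq).prod.congr fun d => ?_
  rw [← tsum_mul_left]
  refine tsum_congr fun m => ?_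
  simp only [pow_mul]
  ring

lemma lambert_eq_tsum_right (k : ℕ) (a b : ZMod N → ℂ) {q : ℂ} (hq : ‖q‖ < 1) :
    lambert k a b q = ∑' m : ℕ+, b (m : ℕ) *
      ∑' d : ℕ+, a (d : ℕ) * (d : ℂ) ^ k * (q ^ (m : ℕ)) ^ (d : ℕ) := by
  have h := summable_lambert k a b hq
  rw [lambert, h.tsum_prod]
  refine (Summable.tsum_comm (f := fun (d m : ℕ+) => a (d : ℕ) * b (m : ℕ) *
    (d : ℂ) ^ k * q ^ (d * m : ℕ)) h).symm.trans (tsum_congr fun m => ?_)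
  rw [← tsum_mul_left]
  refine tsum_congr fun d => ?_
  rw [mul_comm (d : ℕ), pow_mul]
  ring

lemma summable_periodic (k : ℕ) (c : ZMod N → ℂ) {x : ℂ} (hx : ‖x‖ < 1) :
    Summable fun d : ℕ => c d * (d : ℂ) ^ k * x ^ d := by
  have h := (summable_norm_pow_mul_geometric_of_norm_lt_one k hx).mul_left (∑ y, ‖c y‖)
  refine Summable.of_norm_bounded h fun d => ?_
  rw [mul_assoc, norm_mul]
  exact mul_le_mul_of_nonneg_right (norm_le_sum_norm c _) (norm_nonneg _)

lemma pow_ne_one {x : ℂ} (hx : ‖x‖ < 1) {n : ℕ} (hn : n ≠ 0) : 1 - x ^ n ≠ 0 := by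
  intro h
  have : ‖x ^ n‖ = 1 := by rw [← sub_eq_zero.1 h, norm_one]
  rw [norm_pow] at this
  exact absurd this (pow_lt_one₀ (norm_nonneg _) hx hn).ne

lemma tsum_periodic (c : ZMod N → ℂ) {x : ℂ} (hx : ‖x‖ < 1) :
    ∑' d : ℕ+, c (d : ℕ) * x ^ (d : ℕ) =
      (∑ r ∈ Finset.range N, c (r + 1 : ℕ) * x ^ (r + 1)) / (1 - x ^ N) := by
  have hs : Summable fun d : ℕ => c (d + 1 : ℕ) * x ^ (d + 1) := by
    simpa using (summable_nat_add_iff 1).2 (summable_periodic 0 c hx)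
  rw [tsum_pnat_eq_tsum_succ (f := fun d => c d * x ^ d),
    eq_div_iff (pow_ne_one hx (NeZero.ne N))]
  have h := hs.sum_add_tsum_nat_add N
  have h2 : ∑' d : ℕ, c (d + N + 1 : ℕ) * x ^ (d + N + 1) =
      x ^ N * ∑' d : ℕ, c (d + 1 : ℕ) * x ^ (d + 1) := by
    rw [← tsum_mul_left]
    refine tsum_congr fun d => ?_
    have : ((d + N + 1 : ℕ) : ZMod N) = (d + 1 : ℕ) := by push_cast; simp
    rw [this]; ring
  rw [h2] at h
  linear_combination -h

lemma tsum_periodic_mul (c : ZMod N → ℂ) {x : ℂ} (hx : ‖x‖ < 1) :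
    ∑' d : ℕ+, c (d : ℕ) * d * x ^ (d : ℕ) =
      (∑ r ∈ Finset.range N, c (r + 1 : ℕ) * (r + 1) * x ^ (r + 1) +
        N * x ^ N * ∑' d : ℕ+, c (d : ℕ) * x ^ (d : ℕ)) / (1 - x ^ N) := by
  have hs0 : Summable fun d : ℕ => c (d + 1 : ℕ) * x ^ (d + 1) := by
    simpa using (summable_nat_add_iff 1).2 (summable_periodic 0 c hx)
  have hs : Summable fun d : ℕ => c (d + 1 : ℕ) * (d + 1 : ℕ) * x ^ (d + 1) := by
    simpa using (summable_nat_add_iff 1).2 (summable_periodic 1 c hx)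
  rw [tsum_pnat_eq_tsum_succ (f := fun d => c d * d * x ^ d),
    tsum_pnat_eq_tsum_succ (f := fun d => c d * x ^ d), eq_div_iff (pow_ne_one hx (NeZero.ne N))]
  have h := hs.sum_add_tsum_nat_add N
  have h2 : ∑' d : ℕ, c (d + N + 1 : ℕ) * (d + N + 1 : ℕ) * x ^ (d + N + 1) =
      x ^ N * ∑' d : ℕ, c (d + 1 : ℕ) * (d + 1 : ℕ) * x ^ (d + 1) +
      N * x ^ N * ∑' d : ℕ, c (d + 1 : ℕ) * x ^ (d + 1) := by
    rw [← tsum_mul_left, ← tsum_mul_left, ← (hs.mul_left _).tsum_add (hs0.mul_left _)]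
    refine tsum_congr fun d => ?_
    have : ((d + N + 1 : ℕ) : ZMod N) = (d + 1 : ℕ) := by push_cast; simp
    rw [this]; push_cast; ring
  rw [h2] at h
  simp only [Nat.cast_add, Nat.cast_one] at h ⊢
  linear_combination -h

/-- The Lambert series of `σ₁` in terms of `E₂`. -/
lemma lambert_one_one {q : ℂ} (hq : ‖q‖ < 1) :
    lambert 1 (fun _ : ZMod N => 1) (fun _ => 1) q = (1 - E 2 q) / 24 := by
  rw [E_eq (by simp), ← (hasSum_lambert 1 _ _ hq).tsum_eq]
  norm_num [eisConst]

/-- Indicator function of the multiples of `M` modulo `N`, where `M ∣ N`. -/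
noncomputable def dvdIndicator (M : ℕ) {N : ℕ} (d : ZMod N) : ℂ := if M ∣ d.val then 1 else 0

lemma lambert_dvdIndicator_left (k : ℕ) (b : ZMod N → ℂ) {M : ℕ} (hM : M ∣ N) (q : ℂ) :
    lambert k (dvdIndicator M) b q = M ^ k * lambert k (fun _ => 1) b (q ^ M) := by
  have hM' : 0 < M := Nat.pos_of_ne_zero (ne_zero_of_dvd_ne_zero (NeZero.ne N) hM)
  rw [lambert, lambert, ← tsum_mul_left]
  let M' : ℕ+ := ⟨M, hM'⟩
  have hinj : Function.Injective fun p : ℕ+ × ℕ+ => (M' * p.1, p.2) := by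
    rintro ⟨a, b⟩ ⟨c, d⟩ h
    simp only [Prod.mk.injEq, mul_right_inj] at h
    rw [h.1, h.2]
  refine ((hinj.tsum_eq ?_).symm.trans (tsum_congr fun p => ?_))
  · rintro ⟨d, m⟩ hp
    have : M ∣ (d : ℕ) := by
      by_contra hd
      refine hp ?_
      simp only [dvdIndicator, ZMod.val_natCast, Nat.dvd_mod_iff hM, hd, if_false, zero_mul]
    obtain ⟨e, he⟩ := this
    refine ⟨(⟨e, Nat.pos_of_ne_zero fun h0 => d.ne_zero (by rw [he, h0, mul_zero])⟩, m), ?_⟩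
    refine Prod.ext (PNat.coe_injective ?_) rfl
    exact he.symm
  · have : ((M' * p.1 : ℕ+) : ℕ) = M * p.1 := rfl
    simp only [dvdIndicator, ZMod.val_natCast, Nat.dvd_mod_iff hM, this, dvd_mul_right, if_true]
    push_cast
    rw [mul_assoc M, pow_mul]
    ring

lemma lambert_dvd_left {M : ℕ} (hM : M ∣ N) {q : ℂ} (hq : ‖q‖ < 1) :
    lambert 1 (dvdIndicator (N := N) M) (fun _ => 1) q = M * ((1 - E 2 (q ^ M)) / 24) := by
  have hq' : ‖q ^ M‖ < 1 := by
    rw [norm_pow]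
    exact pow_lt_one₀ (norm_nonneg _) hq (ne_zero_of_dvd_ne_zero (NeZero.ne N) hM)
  rw [lambert_dvdIndicator_left 1 _ hM, lambert_one_one hq', pow_one]

lemma lambert_dvd_right {M : ℕ} (hM : M ∣ N) {q : ℂ} (hq : ‖q‖ < 1) :
    lambert 1 (fun _ => 1) (dvdIndicator (N := N) M) q =
      (1 - E 2 (q ^ M)) / 24 := by
  have hM0 : M ≠ 0 := ne_zero_of_dvd_ne_zero (NeZero.ne N) hM
  have hq' : ‖q ^ M‖ < 1 := by
    rw [norm_pow]; exact pow_lt_one₀ (norm_nonneg _) hq hM0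
  have hM' : 0 < M := Nat.pos_of_ne_zero hM0
  rw [← lambert_one_one (N := N) hq', lambert, lambert]
  let M' : ℕ+ := ⟨M, hM'⟩
  have hinj : Function.Injective fun p : ℕ+ × ℕ+ => (p.1, M' * p.2) := by
    rintro ⟨a, b⟩ ⟨c, d⟩ h
    simp only [Prod.mk.injEq, mul_right_inj] at h
    rw [h.1, h.2]
  refine ((hinj.tsum_eq ?_).symm.trans (tsum_congr fun p => ?_))
  · rintro ⟨d, m⟩ hp
    have : M ∣ (m : ℕ) := by
      by_contra hd
      refine hp ?_
      simp only [dvdIndicator, ZMod.val_natCast, Nat.dvd_mod_iff hM, hd, if_false, zero_mul,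
        mul_zero]
    obtain ⟨e, he⟩ := this
    refine ⟨(d, ⟨e, Nat.pos_of_ne_zero fun h0 => m.ne_zero (by rw [he, h0, mul_zero])⟩), ?_⟩
    refine Prod.ext rfl (PNat.coe_injective ?_)
    exact he.symm
  · have : ((M' * p.2 : ℕ+) : ℕ) = M * p.2 := rfl
    simp only [dvdIndicator, ZMod.val_natCast, Nat.dvd_mod_iff hM, this, dvd_mul_right, if_true]
    rw [mul_left_comm, pow_mul]

lemma lambert_add_left (k : ℕ) (a a' b : ZMod N → ℂ) {q : ℂ} (hq : ‖q‖ < 1) :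
    lambert k (fun d => a d + a' d) b q = lambert k a b q + lambert k a' b q := by
  rw [lambert, lambert, lambert,
    ← (summable_lambert k a b hq).tsum_add (summable_lambert k a' b hq)]
  exact tsum_congr fun p => by ring

lemma lambert_add_right (k : ℕ) (a b b' : ZMod N → ℂ) {q : ℂ} (hq : ‖q‖ < 1) :
    lambert k a (fun d => b d + b' d) q = lambert k a b q + lambert k a b' q := by
  rw [lambert, lambert, lambert,
    ← (summable_lambert k a b hq).tsum_add (summable_lambert k a b' hq)]
  exact tsum_congr fun p => by ring

end periodic

lemma lambert_const_mul_left {N : ℕ} (k : ℕ) (a b : ZMod N → ℂ) (c q : ℂ) :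
    lambert k (fun d => c * a d) b q = c * lambert k a b q := by
  rw [lambert, lambert, ← tsum_mul_left]
  exact tsum_congr fun p => by ring

lemma lambert_const_mul_right {N : ℕ} (k : ℕ) (a b : ZMod N → ℂ) (c q : ℂ) :
    lambert k a (fun d => c * b d) q = c * lambert k a b q := by
  rw [lambert, lambert, ← tsum_mul_left]
  exact tsum_congr fun p => by ring

/-! ### The square of a bilateral series, by partial fractions -/

/-- A two-sided telescoping series: `t` has the limits `± 1/2` at `± ∞`, so that differences of step
`k` add up to `k`. -/
lemma hasSum_telescope {t : ℤ → ℂ} (hs : Summable fun m : ℤ => t (m + 1) - t m)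
    (ht : Tendsto (fun n : ℕ => t n) atTop (𝓝 (1 / 2))) (ht' : ∀ m, t (-m) = -t m) (k : ℕ) :
    HasSum (fun m : ℤ => t (m + k) - t m) k := by
  have h1 : HasSum (fun m : ℤ => t (m + 1) - t m) 1 := by
    obtain ⟨A, hA⟩ := hs
    have h2 := hA.nat_add_neg_add_one.tendsto_sum_nat
    have h3 : (fun n : ℕ => ∑ i ∈ Finset.range n, (t (i + 1) - t i +
        (t (-(i + 1 : ℤ) + 1) - t (-(i + 1 : ℤ))))) = fun n : ℕ => t n - t (-(n : ℤ)) := by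
      funext n
      have := Finset.sum_range_sub (fun n : ℕ => t n - t (-(n : ℤ))) n
      simp only [Nat.cast_zero, neg_zero, sub_self, sub_zero] at this
      rw [← this]
      refine Finset.sum_congr rfl fun i _ => ?_
      rw [show -((i : ℤ) + 1) + 1 = -i by ring]
      push_cast
      ring
    rw [h3] at h2
    have h4 : Tendsto (fun n : ℕ => t n - t (-(n : ℤ))) atTop (𝓝 1) := by
      have := ht.add ht
      norm_num at this
      simpa [ht'] using this
    rwa [tendsto_nhds_unique h2 h4] at hA
  induction k with
  | zero => simp
  | succ k ih =>
    have h2 := (Equiv.addRight (k : ℤ)).hasSum_iff.2 h1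
    convert ih.add h2 using 1
    · ext m
      simp only [Function.comp_apply, Equiv.coe_addRight]
      push_cast
      rw [add_assoc]
      ring
    · push_cast; ring

/-- If the products `u(m) u(m+k)` have a partial fraction decomposition with a telescoping part,
then the square of `∑ u(m)` can be summed along the diagonals `n - m = k`. -/
lemma sq_tsum_int {u t : ℤ → ℂ} {a D : ℕ+ → ℂ} (hu : Summable u)
    (ht : Tendsto (fun n : ℕ => t n) atTop (𝓝 (1 / 2))) (ht' : ∀ m, t (-m) = -t m) (hD : D 1 ≠ 0)
    (h : ∀ (k : ℕ+) (m : ℤ), u m * u (m + k) =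
      a k * (u m + u (m + k)) + D k * (t (m + k) - t m)) :
    (∑' m, u m) ^ 2 = ∑' m, u m ^ 2 + 2 * ∑' k : ℕ+, (2 * a k * ∑' m, u m + k * D k) := by
  have hn := hu.norm
  have hprod := summable_mul_of_summable_norm hn hn
  let e : ℤ × ℤ ≃ ℤ × ℤ :=
    { toFun := fun p => (p.2, p.2 + p.1)
      invFun := fun p => (p.2 - p.1, p.1)
      left_inv := fun p => by simp
      right_inv := fun p => by simp }
  have he := e.summable_iff.2 hprod
  have hshift : ∀ k : ℤ, HasSum (fun m => u (m + k)) (∑' m, u m) := fun k =>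
    (Equiv.addRight k).hasSum_iff.2 hu.hasSum
  have hmul : ∀ k : ℤ, Summable fun m => u m * u (m + k) := fun k => he.prod_factor k
  have hts : Summable fun m : ℤ => t (m + 1) - t m := by
    have h1 := ((hmul 1).sub ((hu.add (hshift 1).summable).mul_left (a 1))).mul_left (D 1)⁻¹
    refine h1.congr fun m => ?_
    have := h 1 m
    rw [PNat.one_coe, Nat.cast_one] at this
    rw [this]
    field_simp
    ring
  have hk : ∀ k : ℕ+, ∑' m, u m * u (m + k) = 2 * a k * ∑' m, u m + k * D k := by
    intro k
    have h1 := ((hu.hasSum.add (hshift (k : ℕ))).mul_left (a k)).add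
      ((hasSum_telescope hts ht ht' k).mul_left (D k))
    rw [tsum_congr (h k), h1.tsum_eq]
    ring
  have heven : ∀ k : ℤ, ∑' m, u m * u (m + -k) = ∑' m, u m * u (m + k) := by
    intro k
    rw [← (Equiv.addRight k).tsum_eq]
    exact tsum_congr fun m => by simp [mul_comm]
  rw [sq, tsum_mul_tsum_of_summable_norm hn hn, ← e.tsum_eq]
  refine (he.tsum_prod).trans ?_
  refine (tsum_int_eq_zero_add_two_mul_tsum_pnat (f := fun k : ℤ => ∑' m, u m * u (m + k))
    heven he.prod).trans ?_
  rw [nsmul_eq_mul, Nat.cast_ofNat]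
  congr 1
  · exact tsum_congr fun m => by rw [add_zero, sq]
  · congr 1
    exact tsum_congr hk

section kernel

variable {s q : ℂ}

lemma kernel_ne_zero (hs : s = 0 ∨ s = 1) {x : ℂ} (hx : ‖x‖ ≠ 1) : 1 + s * x + x ^ 2 ≠ 0 := by
  intro h
  apply hx
  rcases hs with rfl | rfl
  · exact Complex.norm_eq_one_of_pow_eq_one (n := 4) (by linear_combination (x ^ 2 - 1) * h)
      (by norm_num)
  · exact Complex.norm_eq_one_of_pow_eq_one (n := 3) (by linear_combination (x - 1) * h)
      (by norm_num)

lemma norm_zpow_ne_one (hq : ‖q‖ < 1) {m : ℤ} (hm : m ≠ 0) : ‖q ^ m‖ ≠ 1 := by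
  rw [norm_zpow]
  intro h
  exact (zpow_eq_one_iff_right₀ (norm_nonneg q) hq.ne).not.2 hm h

lemma kernel_zpow_ne_zero (hs : s = 0 ∨ s = 1) (hq : ‖q‖ < 1) (m : ℤ) :
    1 + s * q ^ m + (q ^ m) ^ 2 ≠ 0 := by
  rcases eq_or_ne m 0 with rfl | hm
  · rcases hs with rfl | rfl <;> norm_num
  · exact kernel_ne_zero hs (norm_zpow_ne_one hq hm)

/-- The kernel `x / (1 + s x + x²)`, invariant under `x ↦ 1/x`. -/
noncomputable def kernel (s x : ℂ) : ℂ := x / (1 + s * x + x ^ 2)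

lemma kernel_inv (s x : ℂ) (hx : x ≠ 0) : kernel s x⁻¹ = kernel s x := by
  rw [kernel, kernel]
  have : 1 + s * x⁻¹ + x⁻¹ ^ 2 = (1 + s * x + x ^ 2) / x ^ 2 := by
    field_simp; ring
  rw [this]
  rcases eq_or_ne (1 + s * x + x ^ 2) 0 with h | h
  · simp [h]
  · field_simp

lemma summable_kernel_nat (s : ℂ) (hq : ‖q‖ < 1) : Summable fun n : ℕ => kernel s (q ^ n) := by
  have h1 : Tendsto (fun n : ℕ => q ^ n) cofinite (𝓝 0) := by
    rw [Nat.cofinite_eq_atTop]; exact tendsto_pow_atTop_nhds_zero_of_norm_lt_one hq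
  have h2 : Tendsto (fun n : ℕ => (1 + s * q ^ n + (q ^ n) ^ 2)⁻¹) cofinite (𝓝 1) := by
    have := ((h1.const_mul s).const_add 1).add (h1.pow 2)
    simpa using this.inv₀ (by simp)
  have h3 : Summable fun n : ℕ => ‖q ^ n‖ := by
    simpa using summable_geometric_of_lt_one (norm_nonneg q) hq
  simpa only [kernel, div_eq_mul_inv] using h3.mul_tendsto_const h2

lemma summable_kernel (s : ℂ) (hq : ‖q‖ < 1) (h0 : q ≠ 0) :
    Summable fun m : ℤ => kernel s (q ^ m) := by
  refine Summable.of_nat_of_neg ?_ ?_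
  · simpa using summable_kernel_nat s hq
  · refine (summable_kernel_nat s hq).congr fun n => ?_
    rw [zpow_neg, kernel_inv _ _ (zpow_ne_zero _ h0), zpow_natCast]

lemma tsum_int_of_inv {h : ℂ → ℂ} (h0 : q ≠ 0) (hinv : ∀ x, x ≠ 0 → h x⁻¹ = h x)
    (hs : Summable fun m : ℤ => h (q ^ m)) :
    ∑' m : ℤ, h (q ^ m) = h 1 + 2 * ∑' n : ℕ+, h (q ^ (n : ℕ)) := by
  rw [tsum_int_eq_zero_add_two_mul_tsum_pnat (fun n => ?_) hs, nsmul_eq_mul]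
  · simp
  · rw [zpow_neg, hinv _ (zpow_ne_zero _ h0)]

/-- The square of `∑ x / (1 + s x + x²)` over `x = qᵐ`. The product of the terms at `x`
and `xy` is decomposed into partial fractions in `x`; the telescoping part comes from
`t = (1 - x²) / (2 (1 + s x + x²))`. -/
lemma sq_tsum_kernel (hs : s = 0 ∨ s = 1) (hq : ‖q‖ < 1) (h0 : q ≠ 0) :
    (∑' m : ℤ, kernel s (q ^ m)) ^ 2 = ∑' m : ℤ, kernel s (q ^ m) ^ 2 +
      2 * ∑' k : ℕ+, (2 * (-(s / 2) * (q ^ (k : ℕ) / (1 + (2 - s ^ 2) * q ^ (k : ℕ) +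
        (q ^ (k : ℕ)) ^ 2))) * ∑' m : ℤ, kernel s (q ^ m) +
        k * (q ^ (k : ℕ) * (1 + q ^ (k : ℕ)) / ((1 - q ^ (k : ℕ)) *
          (1 + (2 - s ^ 2) * q ^ (k : ℕ) + (q ^ (k : ℕ)) ^ 2)))) := by
  have hy : ∀ k : ℕ+, ‖q ^ (k : ℕ)‖ < 1 := fun k => by
    rw [norm_pow]; exact pow_lt_one₀ (norm_nonneg _) hq k.ne_zero
  have h1 : ∀ y : ℂ, ‖y‖ < 1 → 1 - y ≠ 0 := fun y hy h => by
    rw [← sub_eq_zero.1 h, norm_one] at hy; exact lt_irrefl _ hy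
  have h1' : ∀ y : ℂ, ‖y‖ < 1 → 1 + y ≠ 0 := fun y hy h => by
    have : y = -1 := by linear_combination h
    rw [this, norm_neg, norm_one] at hy; exact lt_irrefl _ hy
  have h2 : ∀ y : ℂ, ‖y‖ < 1 → 1 + (2 - s ^ 2) * y + y ^ 2 ≠ 0 := fun y hy => by
    rcases hs with rfl | rfl
    · have := pow_ne_zero 2 (h1' y hy)
      convert this using 1; ring
    · convert kernel_ne_zero (Or.inr rfl) hy.ne using 1; ring
  refine sq_tsum_int (t := fun m : ℤ => 1 / 2 * (1 - (q ^ m) ^ 2) / (1 + s * q ^ m + (q ^ m) ^ 2))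
    (summable_kernel s hq h0) ?_ ?_ ?_ ?_
  · have h3 : Tendsto (fun n : ℕ => q ^ n) atTop (𝓝 0) :=
      tendsto_pow_atTop_nhds_zero_of_norm_lt_one hq
    have h4 := ((h3.const_mul s).const_add 1).add (h3.pow 2)
    have h5 := (((h3.pow 2).const_sub 1).const_mul (1 / 2)).div h4 (by simp)
    simp only [sub_zero, mul_zero, add_zero, mul_one, div_one, zero_pow two_ne_zero] at h5
    exact h5.congr fun n => by simp
  · intro m
    have hx : q ^ m ≠ 0 := zpow_ne_zero _ h0
    have h3 := kernel_zpow_ne_zero hs hq m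
    have h4 := kernel_zpow_ne_zero hs hq (-m)
    rw [zpow_neg] at h4 ⊢
    have e : 1 + s * (q ^ m)⁻¹ + (q ^ m)⁻¹ ^ 2 = (1 + s * q ^ m + (q ^ m) ^ 2) / (q ^ m) ^ 2 := by
      field_simp; ring
    rw [e]
    generalize 1 + s * q ^ m + (q ^ m) ^ 2 = P at *
    field_simp
    ring
  · have hq1 : ‖q ^ ((1 : ℕ+) : ℕ)‖ < 1 := hy 1
    simp only [PNat.one_coe, pow_one] at hq1 ⊢
    exact div_ne_zero (mul_ne_zero h0 (h1' _ hq1)) (mul_ne_zero (h1 _ hq1) (h2 _ hq1))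
  · intro k m
    have e : q ^ (m + (k : ℕ) : ℤ) = q ^ m * q ^ (k : ℕ) := by
      rw [zpow_add₀ h0, zpow_natCast]
    have h3 := kernel_zpow_ne_zero hs hq m
    have h4 := kernel_zpow_ne_zero hs hq (m + (k : ℕ))
    have h5 := h1 _ (hy k)
    have h6 := h2 _ (hy k)
    simp only [kernel]
    rw [e] at h4 ⊢
    generalize q ^ m = x at *
    generalize q ^ (k : ℕ) = y at *
    generalize hP : 1 + s * x + x ^ 2 = P at *
    generalize hQ : 1 + s * (x * y) + (x * y) ^ 2 = Q at *
    generalize hR : 1 + (2 - s ^ 2) * y + y ^ 2 = R at *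
    field_simp
    rw [← hP, ← hQ, ← hR]
    ring

end kernel

/-! ### The Eisenstein series of weight one -/

lemma chi3_zero : chi3 0 = 0 := by simp [chi3]
lemma chi3_one : chi3 1 = 1 := by simp [chi3]
lemma chi3_two : chi3 2 = -1 := by
  have : quadraticChar (ZMod 3) 2 = -1 := by decide
  simp [chi3, this]

lemma chi4_zero : chi4 0 = 0 := by simp [chi4]
lemma chi4_one : chi4 1 = 1 := by simp [chi4]
lemma chi4_two : chi4 2 = 0 := by
  have : ZMod.χ₄ 2 = 0 := by decide
  simp [chi4, this]
lemma chi4_three : chi4 3 = -1 := by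
  have : ZMod.χ₄ 3 = -1 := by decide
  simp [chi4, this]

lemma chi3_neg_one : chi3 (-1) = -1 := by
  rw [show (-1 : ZMod 3) = 2 by decide, chi3_two]

lemma chi4_neg_one : chi4 (-1) = -1 := by
  rw [show (-1 : ZMod 4) = 3 by decide, chi4_three]

section periodic

variable {x q : ℂ}

lemma sum_range_zmod_three (g : ZMod 3 → ℂ) (h : ℕ → ℂ) :
    ∑ r ∈ Finset.range 3, g (r + 1 : ℕ) * h r = g 1 * h 0 + g 2 * h 1 + g 0 * h 2 := by
  rw [Finset.sum_range_succ, Finset.sum_range_succ, Finset.sum_range_one]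
  rfl

lemma sum_range_zmod_four (g : ZMod 4 → ℂ) (h : ℕ → ℂ) :
    ∑ r ∈ Finset.range 4, g (r + 1 : ℕ) * h r =
      g 1 * h 0 + g 2 * h 1 + g 3 * h 2 + g 0 * h 3 := by
  rw [Finset.sum_range_succ, Finset.sum_range_succ, Finset.sum_range_succ, Finset.sum_range_one]
  rfl

lemma tsum_periodic_three (g : ZMod 3 → ℂ) (hx : ‖x‖ < 1) :
    ∑' d : ℕ+, g (d : ℕ) * x ^ (d : ℕ) = (g 1 * x + g 2 * x ^ 2 + g 0 * x ^ 3) / (1 - x ^ 3) := by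
  rw [tsum_periodic g hx, sum_range_zmod_three g fun r => x ^ (r + 1)]
  simp

lemma tsum_periodic_four (g : ZMod 4 → ℂ) (hx : ‖x‖ < 1) :
    ∑' d : ℕ+, g (d : ℕ) * x ^ (d : ℕ) =
      (g 1 * x + g 2 * x ^ 2 + g 3 * x ^ 3 + g 0 * x ^ 4) / (1 - x ^ 4) := by
  rw [tsum_periodic g hx, sum_range_zmod_four g fun r => x ^ (r + 1)]
  simp

lemma tsum_periodic_mul_three (g : ZMod 3 → ℂ) (hx : ‖x‖ < 1) :
    ∑' d : ℕ+, g (d : ℕ) * d * x ^ (d : ℕ) = (g 1 * x + g 2 * (2 * x ^ 2) + g 0 * (3 * x ^ 3) +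
      3 * x ^ 3 * ((g 1 * x + g 2 * x ^ 2 + g 0 * x ^ 3) / (1 - x ^ 3))) / (1 - x ^ 3) := by
  rw [tsum_periodic_mul g hx, tsum_periodic_three g hx]
  simp only [mul_assoc]
  rw [sum_range_zmod_three g fun r => ((r : ℂ) + 1) * x ^ (r + 1)]
  norm_num

lemma tsum_periodic_mul_four (g : ZMod 4 → ℂ) (hx : ‖x‖ < 1) :
    ∑' d : ℕ+, g (d : ℕ) * d * x ^ (d : ℕ) = (g 1 * x + g 2 * (2 * x ^ 2) + g 3 * (3 * x ^ 3) +
      g 0 * (4 * x ^ 4) + 4 * x ^ 4 * ((g 1 * x + g 2 * x ^ 2 + g 3 * x ^ 3 + g 0 * x ^ 4) /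
      (1 - x ^ 4))) / (1 - x ^ 4) := by
  rw [tsum_periodic_mul g hx, tsum_periodic_four g hx]
  simp only [mul_assoc]
  rw [sum_range_zmod_four g fun r => ((r : ℂ) + 1) * x ^ (r + 1)]
  norm_num

lemma norm_pow_lt_one (hq : ‖q‖ < 1) (k : ℕ+) : ‖q ^ (k : ℕ)‖ < 1 := by
  rw [norm_pow]; exact pow_lt_one₀ (norm_nonneg _) hq k.ne_zero

lemma tsum_kernel_four (hq : ‖q‖ < 1) :
    ∑' m : ℕ+, kernel 0 (q ^ (m : ℕ)) = lambert 0 chi4 (fun _ => 1) q := by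
  rw [lambert_eq_tsum_right _ _ _ hq]
  refine tsum_congr fun m => ?_
  have hx := norm_pow_lt_one hq m
  simp only [pow_zero, mul_one, one_mul]
  rw [tsum_periodic_four _ hx, chi4_zero, chi4_one, chi4_two, chi4_three, kernel,
    div_eq_div_iff (kernel_ne_zero (Or.inl rfl) hx.ne) (pow_ne_one hx four_ne_zero)]
  ring

lemma tsum_kernel_three (hq : ‖q‖ < 1) :
    ∑' m : ℕ+, kernel 1 (q ^ (m : ℕ)) = lambert 0 chi3 (fun _ => 1) q := by
  rw [lambert_eq_tsum_right _ _ _ hq]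
  refine tsum_congr fun m => ?_
  have hx := norm_pow_lt_one hq m
  simp only [pow_zero, mul_one, one_mul]
  rw [tsum_periodic_three _ hx, chi3_zero, chi3_one, chi3_two, kernel,
    div_eq_div_iff (kernel_ne_zero (Or.inr rfl) hx.ne) (pow_ne_one hx three_ne_zero)]
  ring

lemma summable_sq {u : ℤ → ℂ} (hu : Summable u) : Summable fun m => u m ^ 2 := by
  have h := summable_mul_of_summable_norm hu.norm hu.norm
  have hinj : Function.Injective fun m : ℤ => (m, m) := fun a b h => (Prod.mk.inj h).1
  refine (h.comp_injective hinj).congr fun m => ?_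
  simp [sq]

/-- The square of `∑ χ₋₄(d) q^(dm)` in terms of `E₂`, obtained from the partial fractions of
`x / (1 + x²)`. -/
lemma sq_lambert_four (hq : ‖q‖ < 1) (h0 : q ≠ 0) :
    (1 + 4 * lambert 0 chi4 (fun _ => 1) q) ^ 2 = 1 / 3 * (4 * E 2 (q ^ 4) - E 2 q) := by
  have hsum := summable_kernel 0 hq h0
  have h1 := tsum_int_of_inv h0 (kernel_inv 0) hsum
  have h2 := tsum_int_of_inv (h := fun x => kernel 0 x ^ 2) h0
    (fun x hx => by rw [kernel_inv 0 x hx]) (summable_sq hsum)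
  have h3 := sq_tsum_kernel (s := 0) (Or.inl rfl) hq h0
  have v1 : ZMod.val (1 : ZMod 4) = 1 := rfl
  have v2 : ZMod.val (2 : ZMod 4) = 2 := rfl
  have v3 : ZMod.val (3 : ZMod 4) = 3 := rfl
  have e1 : ∑' n : ℕ+, kernel 0 (q ^ (n : ℕ)) ^ 2 = lambert 1
      (fun d : ZMod 4 => 1 / 2 * dvdIndicator 2 d + (-1) * dvdIndicator 4 d) (fun _ => 1) q := by
    rw [lambert_eq_tsum_right _ _ _ hq]
    refine tsum_congr fun m => ?_
    have hx := norm_pow_lt_one hq m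
    have hk := kernel_ne_zero (Or.inl rfl) hx.ne
    have h4 := pow_ne_one hx four_ne_zero
    simp only [pow_one, one_mul]
    rw [tsum_periodic_mul_four (fun d : ZMod 4 => 1 / 2 * dvdIndicator 2 d + (-1) *
      dvdIndicator 4 d) hx]
    have h2 := pow_ne_one hx two_ne_zero
    norm_num [dvdIndicator, v1, v2, v3] at hk ⊢
    rw [kernel, zero_mul, add_zero]
    generalize q ^ (m : ℕ) = x at *
    rw [show 1 - x ^ 4 = (1 - x ^ 2) * (1 + x ^ 2) by ring]
    generalize hP : 1 + x ^ 2 = P at *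
    generalize hR : 1 - x ^ 2 = R at *
    field_simp
    rw [← hP, ← hR]
    ring
  have e2 : ∑' k : ℕ+, k * (q ^ (k : ℕ) * (1 + q ^ (k : ℕ)) / ((1 - q ^ (k : ℕ)) *
          (1 + (2 - 0 ^ 2) * q ^ (k : ℕ) + (q ^ (k : ℕ)) ^ 2))) =
      lambert 1 (fun _ => 1) (fun d : ZMod 4 => 1 + (-1) * dvdIndicator 2 d) q := by
    rw [lambert_eq_tsum_left _ _ _ hq]
    refine tsum_congr fun k => ?_
    have hx := norm_pow_lt_one hq k
    have h4 := pow_ne_one hx four_ne_zero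
    have hm := pow_ne_one hx one_ne_zero
    have hp : 1 + q ^ (k : ℕ) ≠ 0 := fun h => h4 (by
      linear_combination (1 - q ^ (k : ℕ)) * (1 + (q ^ (k : ℕ)) ^ 2) * h)
    rw [tsum_periodic_four (fun d : ZMod 4 => 1 + (-1) * dvdIndicator 2 d) hx]
    norm_num [dvdIndicator, v1, v2, v3] at hm ⊢
    generalize q ^ (k : ℕ) = x at *
    rw [show 1 + 2 * x + x ^ 2 = (1 + x) ^ 2 by ring]
    field_simp
    ring
  rw [lambert_add_left _ _ _ _ hq, lambert_const_mul_left, lambert_const_mul_left,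
    lambert_dvd_left (by norm_num) hq, lambert_dvd_left (by norm_num) hq] at e1
  rw [lambert_add_right _ _ _ _ hq, lambert_const_mul_right, lambert_dvd_right (by norm_num) hq,
    lambert_one_one hq] at e2
  rw [tsum_kernel_four hq] at h1
  rw [e1] at h2
  rw [h2, h1] at h3
  simp only [zero_div, neg_zero, zero_mul, mul_zero, zero_add] at h3
  rw [e2] at h3
  norm_num [kernel] at h3
  linear_combination 4 * h3

/-- The square of `∑ χ₋₃(d) q^(dm)` in terms of `E₂`, obtained from the partial fractions of
`x / (1 + x + x²)`. -/
lemma sq_lambert_three (hq : ‖q‖ < 1) (h0 : q ≠ 0) :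
    (1 + 6 * lambert 0 chi3 (fun _ => 1) q) ^ 2 = 1 / 2 * (3 * E 2 (q ^ 3) - E 2 q) := by
  have hsum := summable_kernel 1 hq h0
  have h1 := tsum_int_of_inv h0 (kernel_inv 1) hsum
  have h2 := tsum_int_of_inv (h := fun x => kernel 1 x + 3 * kernel 1 x ^ 2) h0
    (fun x hx => by rw [kernel_inv 1 x hx]) (hsum.add ((summable_sq hsum).mul_left 3))
  rw [hsum.tsum_add ((summable_sq hsum).mul_left 3), tsum_mul_left] at h2
  have h3 := sq_tsum_kernel (s := 1) (Or.inr rfl) hq h0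
  have v1 : ZMod.val (1 : ZMod 3) = 1 := rfl
  have v2 : ZMod.val (2 : ZMod 3) = 2 := rfl
  have e1 : ∑' n : ℕ+, (kernel 1 (q ^ (n : ℕ)) + 3 * kernel 1 (q ^ (n : ℕ)) ^ 2) = lambert 1
      (fun d : ZMod 3 => 1 + (-3) * dvdIndicator 3 d) (fun _ => 1) q := by
    rw [lambert_eq_tsum_right _ _ _ hq]
    refine tsum_congr fun m => ?_
    have hx := norm_pow_lt_one hq m
    have hk := kernel_ne_zero (Or.inr rfl) hx.ne
    have hm := pow_ne_one hx one_ne_zero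
    simp only [pow_one, one_mul]
    rw [tsum_periodic_mul_three (fun d : ZMod 3 => 1 + (-3) * dvdIndicator 3 d) hx]
    norm_num [dvdIndicator, v1, v2] at hk hm ⊢
    rw [kernel, one_mul]
    generalize q ^ (m : ℕ) = x at *
    rw [show 1 - x ^ 3 = (1 - x) * (1 + x + x ^ 2) by ring]
    generalize hP : 1 + x + x ^ 2 = P at *
    field_simp
    rw [← hP]
    ring
  have e2 : ∀ k : ℕ+, (k : ℂ) * (q ^ (k : ℕ) * (1 + q ^ (k : ℕ)) / ((1 - q ^ (k : ℕ)) *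
          (1 + (2 - 1 ^ 2) * q ^ (k : ℕ) + (q ^ (k : ℕ)) ^ 2))) =
      1 * (k : ℂ) ^ 1 * ∑' m : ℕ+,
        (fun d : ZMod 3 => 1 + (-1) * dvdIndicator 3 d) (m : ℕ) * (q ^ (k : ℕ)) ^ (m : ℕ) := by
    intro k
    have hx := norm_pow_lt_one hq k
    have hk := kernel_ne_zero (Or.inr rfl) hx.ne
    have hm := pow_ne_one hx one_ne_zero
    rw [tsum_periodic_three (fun d : ZMod 3 => 1 + (-1) * dvdIndicator 3 d) hx]
    norm_num [dvdIndicator, v1, v2] at hk hm ⊢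
    generalize q ^ (k : ℕ) = x at *
    rw [show 1 - x ^ 3 = (1 - x) * (1 + x + x ^ 2) by ring]
    ring
  have e3 := summable_lambert_left 1 (fun _ => 1) (fun d : ZMod 3 => 1 + (-1) * dvdIndicator 3 d) hq
  have e4 : ∀ k : ℕ+, 2 * (-(1 / 2) * (q ^ (k : ℕ) / (1 + (2 - 1 ^ 2) * q ^ (k : ℕ) +
        (q ^ (k : ℕ)) ^ 2))) * ∑' m : ℤ, kernel 1 (q ^ m) =
      -(∑' m : ℤ, kernel 1 (q ^ m)) * kernel 1 (q ^ (k : ℕ)) := by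
    intro k
    rw [kernel]
    norm_num
    ring
  have e5 : Summable fun k : ℕ+ => -(∑' m : ℤ, kernel 1 (q ^ m)) * kernel 1 (q ^ (k : ℕ)) :=
    ((summable_kernel_nat 1 hq).comp_injective PNat.coe_injective).mul_left _
  simp only [e2, e4] at h3
  rw [e5.tsum_add e3, ← lambert_eq_tsum_left 1 (fun _ => 1)
    (fun d : ZMod 3 => 1 + (-1) * dvdIndicator 3 d) hq, tsum_mul_left, tsum_kernel_three hq,
    lambert_add_right _ _ _ _ hq, lambert_const_mul_right, lambert_dvd_right (by norm_num) hq,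
    lambert_one_one hq] at h3
  rw [lambert_add_left _ _ _ _ hq, lambert_const_mul_left, lambert_one_one hq,
    lambert_dvd_left (by norm_num) hq] at e1
  rw [tsum_kernel_three hq] at h1
  rw [e1] at h2
  generalize ∑' m : ℤ, kernel 1 (q ^ m) ^ 2 = Q at *
  generalize ∑' m : ℤ, kernel 1 (q ^ m) = S at *
  norm_num [kernel] at h1 h2 h3
  have hl : lambert 0 chi3 (fun _ => 1) q = (S - 1 / 3) / 2 := by rw [h1]; ring
  rw [hl] at h3 ⊢
  linear_combination (9 / 2) * h3 + (3 / 2) * h2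

end periodic

lemma thetaSq_eq_lambert (τ : ℍ) : thetaSq τ = 1 + 4 * lambert 0 chi4 (fun _ => 1) (nome τ) := by
  have h := IsQ.of_hasSum (f := fun τ => 1 + 4 * lambert 0 chi4 (fun _ => 1) (nome τ)) (a₀ := 1)
    (a := fun n => 4 * weightedDivSum 0 (fun d m => chi4 d * 1) n) fun τ => by
      simpa only [mul_assoc, add_sub_cancel_left] using
        (hasSum_lambert 0 chi4 (fun _ => 1) (norm_nome_lt_one τ)).mul_left 4
  refine eq_of_sq_eq isQ_thetaSq_four h (fun τ => ?_) τ
  rw [thetaSq_sq_eq_eis, sq_lambert_four (norm_nome_lt_one τ) (nome_ne_zero τ)]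

lemma cubicA_eq_lambert (τ : ℍ) : cubicA τ = 1 + 6 * lambert 0 chi3 (fun _ => 1) (nome τ) := by
  have h := IsQ.of_hasSum (f := fun τ => 1 + 6 * lambert 0 chi3 (fun _ => 1) (nome τ)) (a₀ := 1)
    (a := fun n => 6 * weightedDivSum 0 (fun d m => chi3 d * 1) n) fun τ => by
      simpa only [mul_assoc, add_sub_cancel_left] using
        (hasSum_lambert 0 chi3 (fun _ => 1) (norm_nome_lt_one τ)).mul_left 6
  refine eq_of_sq_eq isQ_cubicA h (fun τ => ?_) τ
  rw [cubicA_sq, eisThree, sq_lambert_three (norm_nome_lt_one τ) (nome_ne_zero τ)]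

/-! ### Eisenstein series of odd weight as lattice sums -/

/-- The lattice sum `∑ φ(m) ψ(n) (mτ + n)^(-(k+1))`, with the convention that the term
`(m, n) = (0, 0)` is zero. -/
noncomputable def latticeSum {N : ℕ} (k : ℕ) (φ ψ : ZMod N → ℂ) (τ : ℍ) : ℂ :=
  ∑' p : ℤ × ℤ, φ p.1 * ψ p.2 * (((p.1 : ℂ) * τ + p.2) ^ (k + 1))⁻¹

/-- The transformation `τ ↦ -1/τ` exchanges the two coefficient functions. -/
lemma latticeSum_fricke {N : ℕ} (k : ℕ) (φ ψ : ZMod N → ℂ) (τ : ℍ) :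
    latticeSum k φ ψ (fricke 1 τ) = (τ : ℂ) ^ (k + 1) * latticeSum k ψ (fun n => φ (-n)) τ := by
  let e : ℤ × ℤ ≃ ℤ × ℤ :=
    { toFun := fun p => (-p.2, p.1)
      invFun := fun p => (p.2, -p.1)
      left_inv := fun p => by simp
      right_inv := fun p => by simp }
  have hτ := coe_ne_zero τ
  rw [latticeSum, latticeSum, ← e.tsum_eq, ← tsum_mul_left]
  refine tsum_congr fun p => ?_
  simp only [e, Equiv.coe_fn_mk, coe_fricke, Nat.cast_one, one_mul, Int.cast_neg]
  have : -(p.2 : ℂ) * (-1 / τ) + p.1 = (p.1 * τ + p.2) / τ := by field_simp; ring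
  rw [this, div_pow, inv_div]
  ring

section lattice

variable {N : ℕ} [NeZero N]

lemma summable_latticeSum {k : ℕ} (hk : 2 ≤ k) (φ ψ : ZMod N → ℂ) (τ : ℍ) :
    Summable fun p : ℤ × ℤ => φ p.1 * ψ p.2 * (((p.1 : ℂ) * τ + p.2) ^ (k + 1))⁻¹ := by
  have h := (summable_prod_eisSummand (k := k + 1) (by omega) τ).norm.mul_left
    ((∑ y, ‖φ y‖) * ∑ y, ‖ψ y‖)
  refine Summable.of_norm_bounded h fun p => ?_
  rw [norm_mul]
  refine mul_le_mul ?_ (le_of_eq ?_) (norm_nonneg _) (by positivity)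
  · rw [norm_mul]
    exact mul_le_mul (norm_le_sum_norm φ _) (norm_le_sum_norm ψ _) (norm_nonneg _) (by positivity)
  · simp only [EisensteinSeries.eisSummand, Matrix.cons_val_zero, Matrix.cons_val_one, zpow_neg,
      Matrix.cons_val_fin_one]
    rw [zpow_natCast]

/-- The sum over the rows `±m` of the lattice. -/
lemma latticeSum_eq {k : ℕ} (hk : 2 ≤ k) {φ ψ : ZMod N → ℂ}
    (hpar : ∀ m n, φ (-m) * ψ (-n) = (-1) ^ (k + 1) * (φ m * ψ n)) (τ : ℍ) :
    latticeSum k φ ψ τ = φ 0 * ∑' n : ℤ, ψ n * ((n : ℂ) ^ (k + 1))⁻¹ +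
      2 * ∑' m : ℕ+, φ (m : ℕ) * ∑' n : ℤ, ψ n * (((m : ℂ) * τ + n) ^ (k + 1))⁻¹ := by
  have hs := summable_latticeSum hk φ ψ τ
  rw [latticeSum, hs.tsum_prod, tsum_int_eq_zero_add_two_mul_tsum_pnat
    (f := fun m : ℤ => ∑' n : ℤ, φ m * ψ n * (((m : ℂ) * τ + n) ^ (k + 1))⁻¹) (fun m => ?_) hs.prod,
    nsmul_eq_mul, Nat.cast_ofNat]
  · congr 1
    · rw [← tsum_mul_left]
      exact tsum_congr fun n => by simp [mul_assoc]
    · congr 1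
      refine tsum_congr fun m => ?_
      rw [← tsum_mul_left]
      exact tsum_congr fun n => by simp [mul_assoc]
  · beta_reduce
    rw [← (Equiv.neg ℤ).tsum_eq]
    refine tsum_congr fun n => ?_
    simp only [Equiv.neg_apply, Int.cast_neg]
    rw [hpar, show -(m : ℂ) * τ + -n = (-1) * (m * τ + n) by ring, mul_pow, mul_inv,
      ← inv_pow (-1 : ℂ)]
    have : ((-1 : ℂ)) ^ (k + 1) * ((-1 : ℂ)⁻¹) ^ (k + 1) = 1 := by
      rw [← mul_pow]; norm_num
    linear_combination (φ m * ψ n * (((m : ℂ) * τ + n) ^ (k + 1))⁻¹) * this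

/-- The constant `(-2πi)^(k+1) / k!` of the Lipschitz formula. -/
noncomputable def lipschitzConst (k : ℕ) : ℂ :=
  (-2 * Real.pi * Complex.I) ^ (k + 1) / k.factorial

lemma lipschitzConst_ne_zero (k : ℕ) : lipschitzConst k ≠ 0 := by
  have : (Real.pi : ℂ) ≠ 0 := by exact_mod_cast Real.pi_ne_zero
  refine div_ne_zero (pow_ne_zero _ ?_) (by exact_mod_cast k.factorial_ne_zero)
  simp [this]

/-- The Lipschitz formula. -/
lemma lipschitz {k : ℕ} (hk : 1 ≤ k) (z : ℍ) : ∑' n : ℤ, (((z : ℂ) + n) ^ (k + 1))⁻¹ =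
    lipschitzConst k * ∑' j : ℕ+, (j : ℂ) ^ k * nome z ^ (j : ℕ) := by
  simpa only [one_div, nome, lipschitzConst] using EisensteinSeries.qExpansion_identity_pnat hk z

/-- The Lipschitz formula with a coefficient function modulo `N` that is, up to the factor `g`, its
own Fourier transform. -/
lemma lipschitz_twisted {k : ℕ} (hk : 2 ≤ k) {ψ : ZMod N → ℂ} {g : ℂ}
    (hψ : ∀ j : ℕ, ∑ r : Fin N, ψ (r : ℕ) *
      Complex.exp (2 * Real.pi * Complex.I / N) ^ (j * r : ℕ) = g * ψ j) (z : ℍ) :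
    ∑' n : ℤ, ψ n * ((N * (z : ℂ) + n) ^ (k + 1))⁻¹ = lipschitzConst k * g / N ^ (k + 1) *
      ∑' j : ℕ+, ψ (j : ℕ) * (j : ℂ) ^ k * nome z ^ (j : ℕ) := by
  have hN : (N : ℂ) ≠ 0 := by exact_mod_cast NeZero.ne N
  obtain ⟨w, hw⟩ : ∃ w : Fin N → ℍ, ∀ r, (w r : ℂ) = z + r / N :=
    ⟨fun r => ((r : ℝ) / N) +ᵥ z, fun r => by simp [add_comm]⟩
  have hnome : ∀ r, nome (w r) = nome z * Complex.exp (2 * Real.pi * Complex.I / N) ^ (r : ℕ) := by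
    intro r
    rw [nome, nome, hw, ← Complex.exp_nat_mul, ← Complex.exp_add]
    congr 1; ring
  have hsum : ∀ r, Summable fun j : ℕ+ => (j : ℂ) ^ k * nome (w r) ^ (j : ℕ) := fun r =>
    (summable_pow_mul_geometric_of_norm_lt_one k (norm_nome_lt_one (w r))).comp_injective
      PNat.coe_injective
  have hs := (summable_latticeSum hk (fun _ => 1) ψ (scale N z)).prod_factor 1
  simp only [Int.cast_one, one_mul, coe_scale] at hs
  obtain ⟨e, he⟩ : ∃ e : Fin N × ℤ ≃ ℤ, ∀ r m, e (r, m) = m * N + (r : ℕ) :=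
    ⟨(Equiv.prodComm _ _).trans (Int.divModEquiv N).symm, fun _ _ => rfl⟩
  have hterm : ∀ r m, ψ (e (r, m) : ℤ) * ((N * (z : ℂ) + (e (r, m) : ℤ)) ^ (k + 1))⁻¹ =
      ψ (r : ℕ) * ((N : ℂ) ^ (k + 1))⁻¹ * (((w r : ℂ) + m) ^ (k + 1))⁻¹ := by
    intro r m
    have hz : N * (z : ℂ) + (e (r, m) : ℤ) = N * (w r + m) := by
      rw [hw, he]; push_cast; field_simp; ring
    rw [hz, he, mul_pow, mul_inv, mul_assoc]
    simp
  have hs' : Summable fun p => ψ (e p : ℤ) * ((N * (z : ℂ) + (e p : ℤ)) ^ (k + 1))⁻¹ :=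
    e.summable_iff.2 hs
  rw [← e.tsum_eq, hs'.tsum_prod, tsum_fintype]
  have hrow : ∀ r, ∑' m, ψ (e (r, m) : ℤ) * ((N * (z : ℂ) + (e (r, m) : ℤ)) ^ (k + 1))⁻¹ =
      lipschitzConst k / N ^ (k + 1) *
        ∑' j : ℕ+, ψ (r : ℕ) * ((j : ℂ) ^ k * nome (w r) ^ (j : ℕ)) := by
    intro r
    simp_rw [hterm]
    rw [tsum_mul_left, tsum_mul_left, lipschitz (by omega)]
    ring
  rw [Finset.sum_congr rfl fun r _ => hrow r, ← Finset.mul_sum,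
    ← Summable.tsum_finsetSum fun r _ => (hsum r).mul_left _, mul_div_right_comm, mul_assoc,
    ← tsum_mul_left (a := g)]
  congr 1
  refine tsum_congr fun j => ?_
  rw [← mul_assoc, ← mul_assoc, ← hψ, Finset.sum_mul, Finset.sum_mul]
  refine Finset.sum_congr rfl fun r _ => ?_
  rw [hnome, mul_pow, ← pow_mul, mul_comm (r : ℕ)]
  ring

/-- The `q`-expansion of a lattice sum at `Nτ`, row by row from the twisted Lipschitz formula. -/
lemma latticeSum_scale {k : ℕ} (hk : 2 ≤ k) {φ ψ : ZMod N → ℂ} {g : ℂ}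
    (hpar : ∀ m n, φ (-m) * ψ (-n) = (-1) ^ (k + 1) * (φ m * ψ n))
    (hψ : ∀ j : ℕ, ∑ r : Fin N, ψ (r : ℕ) *
      Complex.exp (2 * Real.pi * Complex.I / N) ^ (j * r : ℕ) = g * ψ j) (τ : ℍ) :
    latticeSum k φ ψ (scale N τ) = φ 0 * ∑' n : ℤ, ψ n * ((n : ℂ) ^ (k + 1))⁻¹ +
      2 * (lipschitzConst k * g / N ^ (k + 1)) * lambert k ψ φ (nome τ) := by
  rw [latticeSum_eq hk hpar, lambert_eq_tsum_right _ _ _ (norm_nome_lt_one τ), mul_assoc,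
    ← tsum_mul_left (a := lipschitzConst k * g / N ^ (k + 1))]
  refine congrArg₂ (· + ·) rfl (congrArg (2 * ·) (tsum_congr fun m => ?_))
  have h := lipschitz_twisted hk hψ (scale m τ)
  simp only [nome_scale, coe_scale] at h ⊢
  rw [mul_left_comm (_ / _), ← h]
  congr 1
  exact tsum_congr fun n => by rw [mul_left_comm]

lemma latticeSum_one_right {k : ℕ} (hk : 2 ≤ k) {φ : ZMod N → ℂ}
    (hpar : ∀ m, φ (-m) = (-1) ^ (k + 1) * φ m) (h0 : φ 0 = 0) (τ : ℍ) :
    latticeSum k φ (fun _ => 1) τ = 2 * lipschitzConst k * lambert k (fun _ => 1) φ (nome τ) := by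
  rw [latticeSum_eq hk (by simpa using hpar), lambert_eq_tsum_right _ _ _ (norm_nome_lt_one τ), h0,
    zero_mul, zero_add, mul_assoc, ← tsum_mul_left (a := lipschitzConst k)]
  refine congrArg (2 * ·) (tsum_congr fun m => ?_)
  have h := lipschitz (k := k) (by omega) (scale m τ)
  simp only [nome_scale, coe_scale, one_mul] at h ⊢
  rw [h]
  ring

end lattice

/-! ### The Eisenstein series of weights three and five -/

lemma isQ_lambert {N : ℕ} [NeZero N] (k : ℕ) (a b : ZMod N → ℂ) :
    IsQ (fun τ => lambert k a b (nome τ)) 0 (a 1 * b 1) := by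
  have h := IsQ.of_hasSum (a₀ := 0) (f := fun τ => lambert k a b (nome τ)) fun τ => by
    simpa using hasSum_lambert k a b (norm_nome_lt_one τ)
  simpa [weightedDivSum] using h

/-- The Fricke involution exchanges the two Lambert series attached to an odd function modulo `N`
that is an eigenfunction of the Fourier transform. -/
lemma lambert_fricke {N k : ℕ} [NeZero N] (hk : 2 ≤ k) (hk' : Even k) {χ : ZMod N → ℂ} {g : ℂ}
    (hg : g ≠ 0) (hχ : ∀ m, χ (-m) = -χ m) (h0 : χ 0 = 0)
    (hψ : ∀ j : ℕ, ∑ r : Fin N, χ (r : ℕ) *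
      Complex.exp (2 * Real.pi * Complex.I / N) ^ (j * r : ℕ) = g * χ j) :
    ∃ z, ∀ τ, z + lambert k χ (fun _ => 1) (nome (fricke N τ)) =
      (τ : ℂ) ^ (k + 1) * (N ^ (k + 1) / g * lambert k (fun _ => 1) χ (nome τ)) := by
  have hN : (N : ℂ) ≠ 0 := by exact_mod_cast NeZero.ne N
  have hc := lipschitzConst_ne_zero k
  have hodd : (-1 : ℂ) ^ (k + 1) = -1 := (hk'.add_one).neg_one_pow
  refine ⟨(∑' n : ℤ, χ n * ((n : ℂ) ^ (k + 1))⁻¹) / (2 * (lipschitzConst k * g / N ^ (k + 1))),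
    fun τ => ?_⟩
  have h1 := latticeSum_scale (φ := fun _ => 1) hk (by simp [hχ, hodd]) hψ (fricke N τ)
  have hs : scale 1 τ = τ := by ext1; simp
  rw [scale_fricke (M := N) (M' := 1) (by simp), latticeSum_fricke, hs,
    latticeSum_one_right hk (by simp [hχ, hodd]) h0, one_mul] at h1
  field_simp at h1 ⊢
  linear_combination -h1

/-- The character mod `3` is an eigenfunction of the Fourier transform; the eigenvalue is the Gauss
sum `ζ - ζ²`, where `ζ = exp(2πi/3)`. -/
lemma gaussSum_three : ∃ g : ℂ, g ≠ 0 ∧ ∀ j : ℕ, ∑ r : Fin 3,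
    chi3 (r : ℕ) * Complex.exp (2 * Real.pi * Complex.I / (3 : ℕ)) ^ (j * r : ℕ) = g * chi3 j := by
  have hζ := Complex.isPrimitiveRoot_exp 3 (by norm_num)
  set ζ := Complex.exp (2 * Real.pi * Complex.I / (3 : ℕ))
  refine ⟨ζ - ζ ^ 2, ?_, fun j => ?_⟩
  · intro h
    have := hζ.pow_inj (i := 1) (j := 2) (by norm_num) (by norm_num) (by linear_combination h)
    omega
  · have h3 := hζ.pow_eq_one
    have hj : ∀ r : ℕ, ζ ^ (j * r) = ζ ^ ((j % 3) * r) := fun r => by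
      conv_lhs => rw [← Nat.div_add_mod j 3, add_mul, mul_assoc, pow_add, pow_mul, h3, one_pow,
        one_mul]
    have hj' : (j : ZMod 3) = (j % 3 : ℕ) := by simp
    rw [hj', Finset.sum_congr rfl fun r _ => by rw [hj]]
    have := Nat.mod_lt j (show 3 > 0 by norm_num)
    interval_cases j % 3 <;>
      simp [Fin.sum_univ_three, chi3_zero, chi3_one, chi3_two]
    · ring
    · linear_combination -ζ * h3

/-- The character mod `4` is an eigenfunction of the Fourier transform, with the Gauss sum `2i` as
eigenvalue. -/
lemma gaussSum_four : ∀ j : ℕ, ∑ r : Fin 4,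
    chi4 (r : ℕ) * Complex.exp (2 * Real.pi * Complex.I / (4 : ℕ)) ^ (j * r : ℕ) =
      2 * Complex.I * chi4 j := by
  intro j
  have hζ : Complex.exp (2 * Real.pi * Complex.I / (4 : ℕ)) = Complex.I :=
    (congrArg Complex.exp (by push_cast; ring)).trans Complex.exp_pi_div_two_mul_I
  rw [hζ]
  have hj : ∀ r : ℕ, Complex.I ^ (j * r) = Complex.I ^ ((j % 4) * r) := fun r => by
    conv_lhs => rw [← Nat.div_add_mod j 4, add_mul, mul_assoc, pow_add, pow_mul, Complex.I_pow_four,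
      one_pow, one_mul]
  have hj' : (j : ZMod 4) = (j % 4 : ℕ) := by simp
  rw [hj', Finset.sum_congr rfl fun r _ => by rw [hj]]
  have := Nat.mod_lt j (show 4 > 0 by norm_num)
  interval_cases j % 4 <;>
    simp [Fin.sum_univ_four, chi4_zero, chi4_one, chi4_two, chi4_three] <;>
    ring

lemma chi3_neg (m : ZMod 3) : chi3 (-m) = -chi3 m := by
  rw [neg_eq_neg_one_mul, map_mul, chi3_neg_one, neg_one_mul]

lemma chi4_neg (m : ZMod 4) : chi4 (-m) = -chi4 m := by
  rw [neg_eq_neg_one_mul, map_mul, chi4_neg_one, neg_one_mul]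

lemma lambert_fricke_three {k : ℕ} (hk : 2 ≤ k) (hk' : Even k) : ∃ z D : ℂ,
    ∀ τ, z + lambert k chi3 (fun _ => 1) (nome (fricke 3 τ)) =
      (τ : ℂ) ^ (k + 1) * (D * lambert k (fun _ => 1) chi3 (nome τ)) := by
  obtain ⟨g, hg, h⟩ := gaussSum_three
  obtain ⟨z, hz⟩ := lambert_fricke hk hk' hg chi3_neg chi3_zero h
  exact ⟨z, _, hz⟩

lemma lambert_fricke_four {k : ℕ} (hk : 2 ≤ k) (hk' : Even k) : ∃ z D : ℂ,
    ∀ τ, z + lambert k chi4 (fun _ => 1) (nome (fricke 4 τ)) =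
      (τ : ℂ) ^ (k + 1) * (D * lambert k (fun _ => 1) chi4 (nome τ)) := by
  have hg : (2 * Complex.I) ≠ 0 := by simp
  obtain ⟨z, hz⟩ := lambert_fricke hk hk' hg chi4_neg chi4_zero gaussSum_four
  exact ⟨z, _, hz⟩

lemma isQ_lambert_chi3_left (k : ℕ) : IsQ (fun τ => lambert k chi3 (fun _ => 1) (nome τ)) 0 1 := by
  simpa using isQ_lambert k chi3 fun _ => 1

lemma isQ_lambert_chi3_right (k : ℕ) : IsQ (fun τ => lambert k (fun _ => 1) chi3 (nome τ)) 0 1 := by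
  simpa using isQ_lambert k (fun _ => 1) chi3

lemma isQ_lambert_chi4_left (k : ℕ) : IsQ (fun τ => lambert k chi4 (fun _ => 1) (nome τ)) 0 1 := by
  simpa using isQ_lambert k chi4 fun _ => 1

lemma isQ_lambert_chi4_right (k : ℕ) : IsQ (fun τ => lambert k (fun _ => 1) chi4 (nome τ)) 0 1 := by
  simpa using isQ_lambert k (fun _ => 1) chi4

/-- A proportionality between functions with a simple zero at `i∞` is determined by the leading
coefficients. -/
lemma eq_mul_of_const_mul_eq {f g : ℍ → ℂ} {a c d : ℂ} (hf : IsQ f 0 a) (hg : IsQ g 0 1)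
    (hc : c ≠ 0) (h : ∀ τ, c * f τ = d * g τ) (τ : ℍ) : f τ = a * g τ := by
  have hd := ((hf.const_mul c).congr (fun τ => (h τ).symm)).coeff_unique (hg.const_mul d)
  apply mul_left_cancel₀ hc
  linear_combination h τ - g τ * hd.2

/-- The Fricke image of the first Lambert series, corrected by a constant, vanishes at `i∞`; the
corrected series is therefore proportional to `ℬ₃³`. -/
lemma B₃_pow_C₃_pow_eq_lambert :
    (∀ τ, B₃ τ ^ 3 = 1 - 9 * lambert 2 chi3 (fun _ => 1) (nome τ)) ∧
      ∀ τ, C₃ τ ^ 3 = 27 * lambert 2 (fun _ => 1) chi3 (nome τ) := by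
  obtain ⟨z, D, h⟩ := lambert_fricke_three (k := 2) le_rfl even_two
  have hf := (IsQ.const z).add (isQ_lambert_chi3_left 2)
  have hg := (isQ_lambert_chi3_right 2).const_mul D
  have hG := isQ_C₃_pow.const_mul kappa
  norm_num at hf hg hG
  have key := eq_mul_of_fricke (N := 3) (k := 3) (by norm_num) (by norm_num) hf hg
    isQ_B₃_pow_three hG (by simpa using kappa_ne_zero) B₃_pow_ne_zero
    (fun τ => mul_ne_zero kappa_ne_zero (C₃_pow_ne_zero τ)) h B₃_pow_fricke (by norm_num)
  have hz := (hf.congr fun τ => (key τ).symm).coeff_unique (isQ_B₃_pow_three.const_mul z)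
  have hz' : z = -1 / 9 := by linear_combination (1 / 9) * hz.2
  refine ⟨fun τ => by rw [hz'] at key; linear_combination 9 * key τ, fun τ => ?_⟩
  refine eq_mul_of_const_mul_eq isQ_C₃_pow (isQ_lambert_chi3_right 2) kappa_ne_zero
    (d := -9 * D) (fun τ => ?_) τ
  have h1 := h τ
  rw [key, B₃_pow_fricke, hz'] at h1
  apply mul_left_cancel₀ (pow_ne_zero 3 (coe_ne_zero τ))
  linear_combination -9 * h1

/-- The quotient of the corrected Lambert series of weight five by `ℬ₃³` is a form of weight two
without poles, and such a form is determined by its value at `i∞`. -/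
lemma cubicA_sq_mul_eq_lambert :
    (∀ τ, cubicA τ ^ 2 * B₃ τ ^ 3 = 1 + 3 * lambert 4 chi3 (fun _ => 1) (nome τ)) ∧
      ∀ τ, cubicA τ ^ 2 * C₃ τ ^ 3 = 27 * lambert 4 (fun _ => 1) chi3 (nome τ) := by
  obtain ⟨z, D, h⟩ := lambert_fricke_three (k := 4) (by norm_num) (by decide)
  have hf := (IsQ.const z).add (isQ_lambert_chi3_left 4)
  have hg := (isQ_lambert_chi3_right 4).const_mul D
  have hG := isQ_C₃_pow.const_mul kappa
  norm_num at hf hg hG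
  obtain ⟨_, hl⟩ := hf.div isQ_B₃_pow_three one_ne_zero B₃_pow_ne_zero
  obtain ⟨_, hr⟩ := hg.div_of_zero hG (by simpa using kappa_ne_zero)
    fun τ => mul_ne_zero kappa_ne_zero (C₃_pow_ne_zero τ)
  have hl' := hl.sub ((isQ_cubicA.pow 2).const_mul z)
  have hr' := hr.sub ((isQ_cubicA.pow 2).const_mul (-3 * z))
  norm_num at hl'
  have key' := eq_zero_of_fricke (N := 3) (k := 2) (c := 3) (m := 3) (n := 2) (by norm_num)
    (by norm_num) hl' hr' isQ_C₃_pow (isQ_B₃_pow_three.const_mul kappa) (by norm_num)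
    (by simpa using kappa_ne_zero) C₃_pow_ne_zero
    (fun τ => mul_ne_zero kappa_ne_zero (B₃_pow_ne_zero τ))
    (fun τ => by
      have := coe_ne_zero τ
      have := kappa_ne_zero
      have := C₃_pow_ne_zero τ
      rw [cubicA_fricke, h, B₃_pow_fricke, mul_pow, mul_pow, nine_div_kappa_sq]
      field_simp
      ring)
    C₃_pow_fricke (by norm_num) (by norm_num)
  have key : ∀ τ, z + lambert 4 chi3 (fun _ => 1) (nome τ) = z * (cubicA τ ^ 2 * B₃ τ ^ 3) := by
    intro τ
    have := key' τ
    rw [sub_eq_zero, div_eq_iff (B₃_pow_ne_zero τ)] at this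
    rw [this, mul_assoc]
  have hz := (hf.congr fun τ => (key τ).symm).coeff_unique
    (((isQ_cubicA.pow 2).mul isQ_B₃_pow_three).const_mul z)
  have hz' : z = 1 / 3 := by
    have := hz.2
    norm_num at this
    linear_combination (-1 / 3) * this
  refine ⟨fun τ => by rw [hz'] at key; linear_combination -3 * key τ, fun τ => ?_⟩
  have hAC := (isQ_cubicA.pow 2).mul isQ_C₃_pow
  norm_num at hAC
  refine eq_mul_of_const_mul_eq hAC (isQ_lambert_chi3_right 4)
    (mul_ne_zero (show (-3 : ℂ) ≠ 0 by norm_num) kappa_ne_zero) (d := 3 * D) (fun τ => ?_) τ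
  have h1 := h τ
  rw [key, B₃_pow_fricke, cubicA_fricke, mul_pow, mul_pow, nine_div_kappa_sq, hz'] at h1
  apply mul_left_cancel₀ (pow_ne_zero 5 (coe_ne_zero τ))
  linear_combination 3 * h1

/-- The behaviour of the second Lambert series under `q ↦ -q`. -/
lemma lambert_chi4_neg (k : ℕ) {q : ℂ} (hq : ‖q‖ < 1) : lambert k (fun _ => 1) chi4 (-q) =
    2 ^ (k + 1) * lambert k (fun _ => 1) chi4 (q ^ 2) - lambert k (fun _ => 1) chi4 q := by
  have h : lambert k (fun _ => 1) chi4 (-q) =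
      lambert k (fun d : ZMod 4 => 2 * dvdIndicator 2 d + (-1) * 1) chi4 q := by
    refine tsum_congr fun p => ?_
    rcases Nat.even_or_odd (p.2 : ℕ) with hm | hm
    · have hχ : chi4 ((p.2 : ℕ) : ZMod 4) = 0 := by
        obtain ⟨m, hm⟩ := hm
        rw [hm, ← two_mul, Nat.cast_mul, map_mul, Nat.cast_ofNat, chi4_two, zero_mul]
      simp [hχ]
    · rcases Nat.even_or_odd (p.1 : ℕ) with hd | hd
      · have : dvdIndicator 2 ((p.1 : ℕ) : ZMod 4) = 1 := by
          simp only [dvdIndicator, ZMod.val_natCast, Nat.dvd_mod_iff (show 2 ∣ 4 by norm_num),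
            hd.two_dvd, if_true]
        beta_reduce
        rw [(hd.mul_right _).neg_pow, this]
        ring
      · have : dvdIndicator 2 ((p.1 : ℕ) : ZMod 4) = 0 := by
          simp only [dvdIndicator, ZMod.val_natCast, Nat.dvd_mod_iff (show 2 ∣ 4 by norm_num),
            hd.not_two_dvd_nat, if_false]
        beta_reduce
        rw [(hd.mul hm).neg_pow, this]
        ring
  rw [h, lambert_add_left _ _ _ _ hq, lambert_const_mul_left, lambert_const_mul_left,
    lambert_dvdIndicator_left _ _ (by norm_num)]
  push_cast
  ring

/-- The corrected Lambert series of weight three is proportional to `𝒜₂ ℬ₂²`; here the quotient has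
to be examined at the cusp `1/2` as well. -/
lemma thetaSq_mul_eq_lambert :
    (∀ τ, thetaSq τ * B₂ τ ^ 2 = 1 - 4 * lambert 2 chi4 (fun _ => 1) (nome τ)) ∧
      ∀ τ, thetaSq τ * C₂ τ ^ 2 = 16 * lambert 2 (fun _ => 1) chi4 (nome τ) := by
  obtain ⟨z, D, h⟩ := lambert_fricke_four (k := 2) le_rfl even_two
  have hf := (IsQ.const z).add (isQ_lambert_chi4_left 2)
  have hg := (isQ_lambert_chi4_right 2).const_mul D
  have hF := isQ_thetaSq_four.mul isQ_B₂_sq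
  have hAC := isQ_thetaSq_four.mul isQ_C₂_sq
  norm_num at hf hg hF hAC
  have hG := hAC.const_mul (8 * Complex.I)
  rw [mul_zero] at hG
  have hI := Complex.I_sq
  have hFG : ∀ τ, thetaSq (fricke 4 τ) * B₂ (fricke 4 τ) ^ 2 =
      (τ : ℂ) ^ 3 * (8 * Complex.I * (thetaSq τ * C₂ τ ^ 2)) := fun τ => by
    rw [thetaSq_fricke, B₂_fricke]
    linear_combination (-8) * Complex.I * τ ^ 3 * thetaSq τ * C₂ τ ^ 2 * hI
  have hginv : ∀ τ, D * lambert 2 (fun _ => 1) chi4 (nome (fricke 4 τ)) =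
      -64 * (τ : ℂ) ^ 3 * (z + lambert 2 chi4 (fun _ => 1) (nome τ)) := fun τ => by
    have := h (fricke 4 τ)
    have hτ := coe_ne_zero τ
    rw [fricke_fricke, coe_fricke] at this
    rw [this]
    push_cast
    field_simp
    ring
  have key := eq_mul_of_fricke (N := 4) (k := 3) (by norm_num) le_rfl hf hg hF hG (by simp)
    (fun τ => mul_ne_zero (thetaSq_ne_zero τ) (pow_ne_zero 2 (B₂_ne_zero τ)))
    (fun τ => mul_ne_zero (by simp) (mul_ne_zero (thetaSq_ne_zero τ)
      (pow_ne_zero 2 (C₂_ne_zero τ)))) h hFG (fun _ => ⟨_, ?_, fun τ => rfl⟩)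
  · have hz := (hf.congr fun τ => (key τ).symm).coeff_unique (hF.const_mul z)
    have hz' : z = -1 / 4 := by linear_combination (1 / 4) * hz.2
    refine ⟨fun τ => by rw [hz'] at key; linear_combination 4 * key τ, fun τ => ?_⟩
    refine eq_mul_of_const_mul_eq hAC (isQ_lambert_chi4_right 2)
      (show (8 * Complex.I) ≠ 0 by simp) (d := -4 * D) (fun τ => ?_) τ
    have h1 := h τ
    rw [key, hFG, hz'] at h1
    apply mul_left_cancel₀ (pow_ne_zero 3 (coe_ne_zero τ))
    linear_combination -4 * h1
  · -- the cusp `1/2`: after a change of scale the quotient is a function of the nome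
    obtain ⟨_, h2⟩ := hf.comp_scale_two
    have hnum := h2.sub hf
    rw [sub_self] at hnum
    obtain ⟨_, hB⟩ := isQ_B₂_sq.comp_scale_two
    have hden := isQ_C₂_scale.mul hB
    rw [zero_mul] at hden
    obtain ⟨_, hq⟩ := hnum.div_of_zero hden (by norm_num) fun τ =>
      mul_ne_zero (C₂_ne_zero _) (pow_ne_zero 2 (B₂_ne_zero _))
    refine isBoundedAtImInfty_of_scale 2 hq.isBoundedAtImInfty fun τ => ?_
    have hτ := coe_ne_zero τ
    have hs : scale 2 (fricke 4 (scale 2 τ)) = fricke 4 τ := by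
      ext1; simp only [coe_scale, coe_fricke]; push_cast; field_simp
    have e1 := hginv τ
    rw [← hs, nome_scale] at e1
    have e2 := hginv (scale 2 τ)
    rw [coe_scale] at e2
    have hnum : D * lambert 2 (fun _ => 1) chi4 (nome (halfShift (fricke 4 (scale 2 τ)))) =
        512 * (τ : ℂ) ^ 3 * (z + lambert 2 chi4 (fun _ => 1) (nome (scale 2 τ)) -
          (z + lambert 2 chi4 (fun _ => 1) (nome τ))) := by
      rw [nome_halfShift, lambert_chi4_neg 2 (norm_nome_lt_one _)]
      push_cast at e1 e2
      linear_combination 8 * e1 - e2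
    have hden : 8 * Complex.I * (thetaSq (halfShift (fricke 4 (scale 2 τ))) *
        C₂ (halfShift (fricke 4 (scale 2 τ))) ^ 2) =
        512 * (τ : ℂ) ^ 3 * (C₂ (scale 2 τ) * B₂ (scale 2 τ) ^ 2) := by
      rw [thetaSq_halfShift, C₂_sq_halfShift, B₂_fricke, C₂_fricke, coe_scale]
      push_cast
      linear_combination (512 * (Complex.I ^ 2 - 1) * (τ : ℂ) ^ 3 * C₂ (scale 2 τ) *
        B₂ (scale 2 τ) ^ 2) * hI
    rw [hnum, hden, mul_div_mul_left _ _ (by simpa using hτ)]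

/-! ### Values of Dirichlet `L`-functions -/

section hurwitz

open HurwitzZeta

/-- The bound for the terms of the series for the odd Hurwitz zeta function, uniform in
`1 ≤ s ≤ 2`. -/
lemma abs_one_div_rpow_sub_le {a x y s : ℝ} (ha : 0 < a) (hax : a ≤ x) (hxy : x ≤ y)
    (hy : y ≤ x + 1) (h1 : 1 ≤ s) (h2 : s ≤ 2) :
    |1 / x ^ s - 1 / y ^ s| ≤ 2 * (1 + 1 / a) * (1 / x ^ 2) := by
  have hx : 0 < x := ha.trans_le hax
  have hy0 : 0 < y := hx.trans_le hxy
  have hq : x / y ≤ 1 := (div_le_one hy0).2 hxy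
  have hq0 : 0 < x / y := div_pos hx hy0
  have e : 1 / x ^ s - 1 / y ^ s = 1 / x ^ s * (1 - (x / y) ^ s) := by
    rw [Real.div_rpow hx.le hy0.le]
    have := (Real.rpow_pos_of_pos hx s).ne'
    field_simp
  have hle : (x / y) ^ s ≤ 1 := Real.rpow_le_one hq0.le hq (by linarith)
  have hge : (x / y) ^ 2 ≤ (x / y) ^ s := by
    rw [← Real.rpow_natCast]
    exact Real.rpow_le_rpow_of_exponent_ge hq0 hq (by exact_mod_cast h2)
  have hf : 1 - (x / y) ^ s ≤ 2 * (1 / x) := by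
    have h3 : 1 - x / y ≤ 1 / x := by
      rw [one_sub_div hy0.ne']
      exact div_le_div₀ zero_le_one (by linarith) hx hxy
    nlinarith [sq_nonneg (1 - x / y)]
  have hg : 1 / x ^ s ≤ (1 + 1 / a) * (1 / x) := by
    have h4 : 1 / x ≤ 1 / a := one_div_le_one_div_of_le ha hax
    have hx' : 0 < 1 / x := by positivity
    rcases le_total 1 x with h | h
    · have : x ≤ x ^ s := by simpa using Real.rpow_le_rpow_of_exponent_le h h1
      have := one_div_le_one_div_of_le hx this
      have ha' : 0 < 1 / a := by positivity
      nlinarith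
    · have : x ^ 2 ≤ x ^ s := by
        rw [← Real.rpow_natCast]
        exact Real.rpow_le_rpow_of_exponent_ge hx h (by exact_mod_cast h2)
      have := one_div_le_one_div_of_le (by positivity) this
      have e2 : 1 / x ^ 2 = 1 / x * (1 / x) := by field_simp
      nlinarith
  have hpos : 0 < 1 / x ^ s := by positivity
  rw [e, abs_of_nonneg (mul_nonneg hpos.le (by linarith))]
  calc _ ≤ (1 + 1 / a) * (1 / x) * (2 * (1 / x)) := by
        gcongr
    _ = _ := by field_simp

/-- The partial fraction series of the cotangent, with `1 / (n + a)` in place of `1 / (n + 1 + a)`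
paired with `-1 / (n + 1 - a)`; the difference of the two pairings telescopes. -/
lemma hasSum_sub_cot {a : ℝ} (ha : 0 < a) (ha' : a < 1)
    (hs : Summable fun n : ℕ => (1 / (n + a : ℂ) - 1 / (n + 1 - a : ℂ))) :
    HasSum (fun n : ℕ => (1 / (n + a : ℂ) - 1 / (n + 1 - a : ℂ)))
      (Real.pi * Complex.cot (Real.pi * a)) := by
  have hmem : (a : ℂ) ∈ Complex.integerComplement := by
    rintro ⟨m, hm⟩
    have h : (m : ℝ) = a := by exact_mod_cast hm
    have h0 : (0 : ℝ) < m := h ▸ ha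
    have h1 : (m : ℝ) < 1 := h ▸ ha'
    norm_cast at h0 h1
    omega
  have hg : HasSum (fun n : ℕ => 1 / ((a : ℂ) - (n + 1)) + 1 / ((a : ℂ) + (n + 1))) _ :=
    (summable_cotTerm hmem).hasSum
  rw [← cot_series_rep' hmem] at hg
  have hu : ∀ n : ℕ, (1 / (n + a : ℂ) - 1 / (n + 1 - a : ℂ)) -
      (1 / ((a : ℂ) - (n + 1)) + 1 / ((a : ℂ) + (n + 1))) =
      1 / (n + a : ℂ) - 1 / ((n + 1 : ℕ) + a : ℂ) := fun n => by
    rw [← neg_sub (n + 1 : ℂ) a, one_div_neg_eq_neg_one_div, add_comm (a : ℂ)]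
    push_cast
    ring
  have htel : HasSum (fun n : ℕ => 1 / (n + a : ℂ) - 1 / ((n + 1 : ℕ) + a : ℂ)) (1 / a) := by
    rw [((hs.sub hg.summable).congr hu).hasSum_iff_tendsto_nat]
    simp_rw [Finset.sum_range_sub' fun n : ℕ => 1 / (n + a : ℂ)]
    have h0 : Tendsto (fun n : ℕ => 1 / (n + a : ℂ)) atTop (𝓝 0) := by
      have h : Tendsto (fun n : ℕ => ((1 / ((n : ℝ) + a) : ℝ) : ℂ)) atTop (𝓝 ((0 : ℝ) : ℂ)) :=
        (Complex.continuous_ofReal.tendsto 0).comp (tendsto_const_nhds.div_atTop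
          (tendsto_atTop_add_const_right _ a tendsto_natCast_atTop_atTop))
      simpa using h
    simpa using h0.const_sub (1 / (a : ℂ))
  have := (htel.congr_fun hu).add hg
  simpa using this

/-- At `s = 1` the odd Hurwitz zeta function is a value of the cotangent: the series for `s > 1`,
the terms `(n + a)^(-s)` and `(n + 1 - a)^(-s)` being combined, is dominated uniformly up to
`s = 1`. -/
lemma hurwitzZetaOdd_one {a : ℝ} (ha : 0 < a) (ha' : a ≤ 1 / 2) :
    hurwitzZetaOdd a 1 = Real.pi / 2 * Complex.cot (Real.pi * a) := by
  have hbd : Summable fun n : ℕ => 2 * (1 + 1 / a) * (1 / ((n : ℝ) + a) ^ 2) := by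
    refine Summable.mul_left _ (((Real.summable_one_div_nat_add_rpow a 2).2 (by norm_num)).congr
      fun n => ?_)
    rw [abs_of_pos (by positivity)]
    norm_cast
  have hterm : ∀ s : ℝ, ∀ n : ℕ, 1 / (n + a : ℂ) ^ (s : ℂ) - 1 / (n + 1 - a : ℂ) ^ (s : ℂ) =
      ((1 / ((n : ℝ) + a) ^ s - 1 / ((n : ℝ) + 1 - a) ^ s : ℝ) : ℂ) := fun s n => by
    have h2 : (0 : ℝ) ≤ (n : ℝ) + 1 - a := by
      have : (0 : ℝ) ≤ n := n.cast_nonneg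
      linarith
    push_cast [Complex.ofReal_cpow (show (0 : ℝ) ≤ (n : ℝ) + a by positivity),
      Complex.ofReal_cpow h2]
    rfl
  have hle : ∀ s : ℝ, 1 ≤ s → s ≤ 2 → ∀ n : ℕ,
      ‖1 / (n + a : ℂ) ^ (s : ℂ) - 1 / (n + 1 - a : ℂ) ^ (s : ℂ)‖ ≤
        2 * (1 + 1 / a) * (1 / ((n : ℝ) + a) ^ 2) := fun s h1 h2 n => by
    rw [hterm, Complex.norm_real, Real.norm_eq_abs]
    have : (0 : ℝ) ≤ n := n.cast_nonneg
    exact abs_one_div_rpow_sub_le ha (by linarith) (by linarith) (by linarith) h1 h2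
  have hs1 : Summable fun n : ℕ => (1 / (n + a : ℂ) - 1 / (n + 1 - a : ℂ)) :=
    Summable.of_norm_bounded hbd fun n => by simpa using hle 1 le_rfl (by norm_num) n
  have hlim : Tendsto (fun s : ℝ => ∑' n : ℕ,
      (1 / (n + a : ℂ) ^ (s : ℂ) - 1 / (n + 1 - a : ℂ) ^ (s : ℂ))) (𝓝[>] 1)
      (𝓝 (∑' n : ℕ, (1 / (n + a : ℂ) - 1 / (n + 1 - a : ℂ)))) := by
    refine tendsto_tsum_of_dominated_convergence hbd (fun n => ?_) ?_
    · have h1 : (n + a : ℂ) ≠ 0 := by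
        have : (n : ℝ) + a ≠ 0 := by positivity
        exact_mod_cast this
      have h2 : (n + 1 - a : ℂ) ≠ 0 := by
        have : (n : ℝ) + 1 - a ≠ 0 := by
          have : (0 : ℝ) ≤ n := n.cast_nonneg
          linarith
        exact_mod_cast this
      have hc : ContinuousAt (fun s : ℝ => 1 / (n + a : ℂ) ^ (s : ℂ) -
          1 / (n + 1 - a : ℂ) ^ (s : ℂ)) 1 := by
        refine ContinuousAt.sub ?_ ?_ <;>
        · refine continuousAt_const.div (ContinuousAt.const_cpow (by fun_prop) (.inl ?_))
            (Complex.cpow_ne_zero_iff.2 (.inl ?_)) <;> assumption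
      have := hc.tendsto.mono_left (nhdsWithin_le_nhds (s := Set.Ioi 1))
      simpa using this
    · filter_upwards [self_mem_nhdsWithin, mem_nhdsWithin_of_mem_nhds (Iic_mem_nhds one_lt_two)]
        with s h1 h2 n using hle s (le_of_lt h1) h2 n
  have hlim2 : Tendsto (fun s : ℝ => hurwitzZetaOdd a s) (𝓝[>] 1) (𝓝 (hurwitzZetaOdd a 1)) := by
    have h : Continuous fun s : ℝ => hurwitzZetaOdd a s :=
      (differentiable_hurwitzZetaOdd _).continuous.comp Complex.continuous_ofReal
    simpa using (h.tendsto 1).mono_left (nhdsWithin_le_nhds (s := Set.Ioi 1))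
  have heq : ∀ᶠ s : ℝ in 𝓝[>] 1, ∑' n : ℕ,
      (1 / (n + a : ℂ) ^ (s : ℂ) - 1 / (n + 1 - a : ℂ) ^ (s : ℂ)) = 2 * hurwitzZetaOdd a s := by
    filter_upwards [self_mem_nhdsWithin] with s hs
    rw [← (hasSum_nat_hurwitzZetaOdd_of_mem_Icc ⟨ha.le, by linarith⟩ (by simpa using hs)).tsum_eq,
      tsum_div_const]
    ring
  have := tendsto_nhds_unique (hlim.congr' heq) (hlim2.const_mul 2)
  rw [(hasSum_sub_cot ha (by linarith) hs1).tsum_eq] at this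
  linear_combination -1 / 2 * this

/-- The value of the odd Hurwitz zeta function at `s = 0`. By the functional equation it is a
multiple of the sine zeta function at `1`, which is a multiple of `L(1, χ)` if `χ` is proportional
to the sine in `hsin`, and hence of the odd Hurwitz zeta function at `1`. -/
lemma hurwitzZetaOdd_zero {N : ℕ} [NeZero N] (hN : 2 ≤ N) {χ : ZMod N → ℂ} {c : ℂ}
    (hsin : ∀ n : ℕ, (Real.sin (2 * Real.pi * (1 / N : ℝ) * n) : ℂ) = c * χ n)
    (hL : ∀ s, ZMod.LFunction χ s =
      N ^ (-s) * (2 * hurwitzZetaOdd ((1 / N : ℝ) : UnitAddCircle) s)) :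
    hurwitzZetaOdd ((1 / N : ℝ) : UnitAddCircle) 0 =
      c / N * Complex.cot (Real.pi * (1 / N : ℝ)) := by
  have hs : ∀ s : ℂ, 1 < s.re → sinZeta ((1 / N : ℝ) : UnitAddCircle) s =
      c * ZMod.LFunction χ s := fun s hs => by
    rw [ZMod.LFunction_eq_LSeries _ hs, ← (LSeriesHasSum_sin _ hs).LSeries_eq, ← smul_eq_mul,
      ← LSeries_smul]
    refine LSeries_congr (fun {n} _ => ?_) s
    exact hsin n
  have h1 : sinZeta ((1 / N : ℝ) : UnitAddCircle) 1 = c * ZMod.LFunction χ 1 := by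
    have hl : Tendsto (fun s : ℝ => sinZeta ((1 / N : ℝ) : UnitAddCircle) s) (𝓝[>] 1)
        (𝓝 (sinZeta ((1 / N : ℝ) : UnitAddCircle) 1)) := by
      have h : Continuous fun s : ℝ => sinZeta ((1 / N : ℝ) : UnitAddCircle) s :=
        (differentiableAt_sinZeta _).continuous.comp Complex.continuous_ofReal
      simpa using (h.tendsto 1).mono_left (nhdsWithin_le_nhds (s := Set.Ioi 1))
    have hr : Tendsto (fun s : ℝ => c * ZMod.LFunction χ s) (𝓝[>] 1)
        (𝓝 (c * ZMod.LFunction χ 1)) := by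
      have h : Continuous fun s : ℝ => c * ZMod.LFunction χ s := by
        simp_rw [hL]
        refine continuous_const.mul (((Continuous.const_cpow (by fun_prop) (.inl ?_))).mul
          (continuous_const.mul
            ((differentiable_hurwitzZetaOdd _).continuous.comp Complex.continuous_ofReal)))
        exact_mod_cast NeZero.ne N
      simpa using (h.tendsto 1).mono_left (nhdsWithin_le_nhds (s := Set.Ioi 1))
    refine tendsto_nhds_unique hl (hr.congr' ?_)
    filter_upwards [self_mem_nhdsWithin] with s h
    exact (hs s (by simpa using h)).symm
  have h2 := hurwitzZetaOdd_one_sub ((1 / N : ℝ) : UnitAddCircle) (s := 1) (fun n h => by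
    have := congrArg Complex.re h
    simp at this
    have : (0 : ℝ) ≤ n := n.cast_nonneg
    linarith)
  have hπ : (Real.pi : ℂ) ≠ 0 := by exact_mod_cast Real.pi_ne_zero
  have hN0 : (N : ℂ) ≠ 0 := by exact_mod_cast NeZero.ne N
  rw [sub_self] at h2
  rw [h2, h1, hL, hurwitzZetaOdd_one (by positivity) (by gcongr; exact_mod_cast hN),
    Complex.cpow_neg_one, Complex.cpow_neg_one, Complex.Gamma_one, mul_one, mul_one,
    Complex.sin_pi_div_two]
  field_simp

lemma LFunction_chi3 (s : ℂ) : ZMod.LFunction chi3 s =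
    (3 : ℕ) ^ (-s) * (2 * hurwitzZetaOdd ((1 / (3 : ℕ) : ℝ) : UnitAddCircle) s) := by
  have h1 : ZMod.toAddCircle (1 : ZMod 3) = ((1 / (3 : ℕ) : ℝ) : UnitAddCircle) := by
    simpa using ZMod.toAddCircle_natCast (N := 3) 1
  rw [ZMod.LFunction_def_odd chi3_neg, ← h1]
  congr 1
  have hsum : ∀ f : ZMod 3 → ℂ, ∑ j, f j = f 0 + f 1 + f 2 := fun f => Fin.sum_univ_three f
  rw [hsum, chi3_zero, chi3_one, chi3_two, show (2 : ZMod 3) = -1 by decide, map_neg,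
    hurwitzZetaOdd_neg]
  ring

lemma LFunction_chi4 (s : ℂ) : ZMod.LFunction chi4 s =
    (4 : ℕ) ^ (-s) * (2 * hurwitzZetaOdd ((1 / (4 : ℕ) : ℝ) : UnitAddCircle) s) := by
  have h1 : ZMod.toAddCircle (1 : ZMod 4) = ((1 / (4 : ℕ) : ℝ) : UnitAddCircle) := by
    simpa using ZMod.toAddCircle_natCast (N := 4) 1
  rw [ZMod.LFunction_def_odd chi4_neg, ← h1]
  congr 1
  have hsum : ∀ f : ZMod 4 → ℂ, ∑ j, f j = f 0 + f 1 + f 2 + f 3 := fun f => Fin.sum_univ_four f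
  rw [hsum, chi4_zero, chi4_one, chi4_two, chi4_three, show (3 : ZMod 4) = -1 by decide, map_neg,
    hurwitzZetaOdd_neg]
  ring

lemma sin_eq_chi3 (n : ℕ) : (Real.sin (2 * Real.pi * (1 / (3 : ℕ) : ℝ) * n) : ℂ) =
    Complex.sin (Real.pi / 3) * chi3 n := by
  have h : (n : ZMod 3) = (n % 3 : ℕ) := by simp
  have hn : (n : ℝ) = (n % 3 : ℕ) + 3 * (n / 3 : ℕ) := by exact_mod_cast (Nat.mod_add_div n 3).symm
  have e : Real.sin (2 * Real.pi * (1 / (3 : ℕ) : ℝ) * n) =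
      Real.sin (2 * Real.pi / 3 * (n % 3 : ℕ)) := by
    rw [hn, ← Real.sin_add_nat_mul_two_pi (2 * Real.pi / 3 * (n % 3 : ℕ)) (n / 3)]
    congr 1
    push_cast
    ring
  have hlt := Nat.mod_lt n (show 3 > 0 by norm_num)
  rw [e, h]
  interval_cases n % 3
  · simp [chi3_zero]
  · rw [show 2 * Real.pi / 3 * (1 : ℕ) = Real.pi - Real.pi / 3 by push_cast; ring, Real.sin_pi_sub,
      Nat.cast_one, chi3_one, mul_one]
    push_cast
    rfl
  · rw [show 2 * Real.pi / 3 * (2 : ℕ) = Real.pi / 3 + Real.pi by push_cast; ring, Real.sin_add_pi,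
      Nat.cast_ofNat, chi3_two, mul_neg_one]
    push_cast
    rfl

lemma sin_eq_chi4 (n : ℕ) : (Real.sin (2 * Real.pi * (1 / (4 : ℕ) : ℝ) * n) : ℂ) =
    1 * chi4 n := by
  have h : (n : ZMod 4) = (n % 4 : ℕ) := by simp
  have hn : (n : ℝ) = (n % 4 : ℕ) + 4 * (n / 4 : ℕ) := by exact_mod_cast (Nat.mod_add_div n 4).symm
  have e : Real.sin (2 * Real.pi * (1 / (4 : ℕ) : ℝ) * n) =
      Real.sin (Real.pi / 2 * (n % 4 : ℕ)) := by
    rw [hn, ← Real.sin_add_nat_mul_two_pi (Real.pi / 2 * (n % 4 : ℕ)) (n / 4)]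
    congr 1
    push_cast
    ring
  have hlt := Nat.mod_lt n (show 4 > 0 by norm_num)
  rw [e, h]
  interval_cases n % 4
  · simp [chi4_zero]
  · simp [chi4_one]
  · rw [show Real.pi / 2 * (2 : ℕ) = Real.pi by push_cast; ring]
    simp [chi4_two]
  · rw [show Real.pi / 2 * (3 : ℕ) = Real.pi / 2 + Real.pi by push_cast; ring, Real.sin_add_pi]
    simp [chi4_three]

lemma LFunction_chi3_zero : chi3.LFunction 0 = 1 / 3 := by
  have hc : Complex.cos (Real.pi / 3) = 1 / 2 := by
    have := congrArg Complex.ofReal Real.cos_pi_div_three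
    push_cast at this
    exact this
  have hs : Complex.sin (Real.pi / 3) ≠ 0 := by
    have : Real.sin (Real.pi / 3) ≠ 0 := by rw [Real.sin_pi_div_three]; positivity
    exact_mod_cast this
  have e : (Real.pi * (1 / (3 : ℕ) : ℝ) : ℂ) = Real.pi / 3 := by push_cast; ring
  rw [DirichletCharacter.LFunction, LFunction_chi3,
    hurwitzZetaOdd_zero (by norm_num) sin_eq_chi3 LFunction_chi3, e, Complex.cot, hc]
  rw [neg_zero, Complex.cpow_zero]
  push_cast
  field_simp

lemma LFunction_chi4_zero : chi4.LFunction 0 = 1 / 2 := by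
  have hc : Complex.cos (Real.pi / 4) = Complex.sin (Real.pi / 4) := by
    have := Real.cos_pi_div_four.trans Real.sin_pi_div_four.symm
    exact_mod_cast this
  have hs : Complex.sin (Real.pi / 4) ≠ 0 := by
    have : Real.sin (Real.pi / 4) ≠ 0 := by rw [Real.sin_pi_div_four]; positivity
    exact_mod_cast this
  have e : (Real.pi * (1 / (4 : ℕ) : ℝ) : ℂ) = Real.pi / 4 := by push_cast; ring
  rw [DirichletCharacter.LFunction, LFunction_chi4,
    hurwitzZetaOdd_zero (by norm_num) sin_eq_chi4 LFunction_chi4, e, Complex.cot, hc, div_self hs]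
  rw [neg_zero, Complex.cpow_zero]
  push_cast
  norm_num

lemma hurwitzZetaOdd_neg_two {x : ℝ} (hx : x ∈ Set.Icc (0 : ℝ) 1) :
    hurwitzZetaOdd x (-2) = -1 / 3 * (x ^ 3 - 3 / 2 * x ^ 2 + 1 / 2 * x) := by
  have h := hurwitzZetaOdd_neg_two_mul_nat one_ne_zero hx
  rw [Nat.cast_one, mul_one] at h
  rw [h]
  simp [Polynomial.bernoulli_def, Finset.sum_range_succ, Polynomial.eval_add,
    bernoulli_eq_zero_of_odd (n := 3) (by decide)]
  norm_num [Nat.choose]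
  ring

lemma hurwitzZetaOdd_neg_four {x : ℝ} (hx : x ∈ Set.Icc (0 : ℝ) 1) :
    hurwitzZetaOdd x (-4) = -1 / 5 * (x ^ 5 - 5 / 2 * x ^ 4 + 5 / 3 * x ^ 3 - 1 / 6 * x) := by
  have h := hurwitzZetaOdd_neg_two_mul_nat two_ne_zero hx
  rw [show ((2 : ℕ) : ℂ) = 2 by norm_num, show (2 * 2 : ℂ) = 4 by norm_num] at h
  rw [h]
  simp [Polynomial.bernoulli_def, Finset.sum_range_succ, Polynomial.eval_add,
    bernoulli_eq_zero_of_odd (n := 3) (by decide), bernoulli_eq_zero_of_odd (n := 5) (by decide),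
    bernoulli_eq_bernoulli'_of_ne_one (n := 4)]
  norm_num [Nat.choose]
  ring

lemma LFunction_chi3_neg_two : chi3.LFunction (-2) = -2 / 9 := by
  rw [DirichletCharacter.LFunction, LFunction_chi3,
    hurwitzZetaOdd_neg_two ⟨by positivity, by norm_num⟩]
  norm_num

lemma LFunction_chi3_neg_four : chi3.LFunction (-4) = 2 / 3 := by
  rw [DirichletCharacter.LFunction, LFunction_chi3,
    hurwitzZetaOdd_neg_four ⟨by positivity, by norm_num⟩]
  norm_num

lemma LFunction_chi4_neg_two : chi4.LFunction (-2) = -1 / 2 := by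
  rw [DirichletCharacter.LFunction, LFunction_chi4,
    hurwitzZetaOdd_neg_two ⟨by positivity, by norm_num⟩]
  norm_num

end hurwitz

lemma eisensteinHat_one_left {N : ℕ} [NeZero N] (k : ℕ) (χ : DirichletCharacter ℂ N) {q : ℂ}
    (hq : ‖q‖ < 1) : eisensteinHat k triv χ q = lambert (k - 1) χ (fun _ => 1) q := by
  rw [← (hasSum_lambert (k - 1) χ (fun _ => 1) hq).tsum_eq]
  refine tsum_congr fun n => ?_
  simp only [weightedDivSum, triv, mul_one]
  congr 1
  refine Finset.sum_congr rfl fun d _ => ?_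
  rw [Subsingleton.elim (((n / d : ℕ) : ZMod 1)) 1, map_one, one_mul]

lemma eisensteinHat_one_right {N : ℕ} [NeZero N] (k : ℕ) (χ : DirichletCharacter ℂ N) {q : ℂ}
    (hq : ‖q‖ < 1) : eisensteinHat k χ triv q = lambert (k - 1) (fun _ => 1) χ q := by
  rw [← (hasSum_lambert (k - 1) (fun _ => 1) χ hq).tsum_eq]
  refine tsum_congr fun n => ?_
  simp only [weightedDivSum, triv, one_mul]
  congr 1
  refine Finset.sum_congr rfl fun d _ => ?_
  rw [Subsingleton.elim ((d : ℕ) : ZMod 1) 1, map_one, mul_one]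

lemma eisenstein_triv_left {N : ℕ} [NeZero N] {k : ℕ} {χ : DirichletCharacter ℂ N} {a : ℂ}
    (ha : χ.LFunction (1 - (k : ℂ)) = a) {q : ℂ} (hq : ‖q‖ < 1) :
    eisenstein k triv χ q = 1 + 2 / a * lambert (k - 1) χ (fun _ => 1) q := by
  rw [eisenstein, if_pos rfl, ha, eisensteinHat_one_left k χ hq]

lemma eisenstein_triv_right {N : ℕ} [NeZero N] {k : ℕ} {χ : DirichletCharacter ℂ N} (hN : N ≠ 1)
    {q : ℂ} (hq : ‖q‖ < 1) :
    eisenstein k χ triv q = 2 * lambert (k - 1) (fun _ => 1) χ q := by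
  rw [eisenstein, if_neg hN, eisensteinHat_one_right k χ hq]

/-! ### The continuations of the three germs -/

lemma continuation_eq {g f : ℍ → ℂ} (h : IsContinuation g f) : continuation g = f := by
  have hex : ∃ f, IsContinuation g f := ⟨f, h⟩
  rw [continuation, dif_pos hex]
  exact hex.choose_spec.unique h

/-- A function with limit `1` at `i∞` is there the principal root of its powers. -/
lemma eventually_eq_cpow {f : ℍ → ℂ} {a : ℂ} (hf : IsQ f 1 a) {n : ℕ} (hn : n ≠ 0) :
    ∀ᶠ τ in atImInfty, f τ = (f τ ^ n) ^ (1 / n : ℂ) := by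
  have hcont : Tendsto (fun τ => (f τ).arg) atImInfty (𝓝 0) := by
    have h := (Complex.continuousAt_arg (x := 1) (by simp)).tendsto
    rw [Complex.arg_one] at h
    exact h.comp hf.tendsto
  have hpos : 0 < Real.pi / n := div_pos Real.pi_pos (by positivity)
  filter_upwards [hcont (Ioo_mem_nhds (neg_lt_zero.2 hpos) hpos)] with τ hτ
  rw [one_div, Complex.pow_cpow_nat_inv hn hτ.1 hτ.2.le]

lemma isContinuation_A₄Sq : IsContinuation (fun τ => A₄Germ τ ^ 2) eisTwo := by
  refine ⟨isQ_eisTwo.mdifferentiable, ?_⟩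
  filter_upwards [eventually_eq_cpow isQ_eisTwo two_ne_zero] with τ hτ
  have h1 := etaMul_ne_zero (δ := 1) (by norm_num) τ
  have h2 := etaMul_ne_zero (δ := 2) (by norm_num) τ
  have e : (2 ^ 6 * etaMul 2 τ ^ 24 + etaMul 1 τ ^ 24) / (etaMul 1 τ ^ 2 * etaMul 2 τ ^ 2) ^ 4 =
      eisTwo τ ^ 2 := by
    rw [eisTwo_sq, C₄_pow_four, B₄]
    field_simp
    ring
  rw [A₄Germ, e, ← Complex.cpow_nat_mul]
  conv_lhs => rw [hτ]
  congr 1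
  norm_num

lemma isContinuation_A₃ : IsContinuation A₃Germ cubicA := by
  refine ⟨isQ_cubicA.mdifferentiable, ?_⟩
  filter_upwards [eventually_eq_cpow isQ_cubicA three_ne_zero] with τ hτ
  have h1 := etaMul_ne_zero (δ := 1) (by norm_num) τ
  have h3 := etaMul_ne_zero (δ := 3) (by norm_num) τ
  have e : (3 ^ 3 * etaMul 3 τ ^ 12 + etaMul 1 τ ^ 12) / (etaMul 1 τ * etaMul 3 τ) ^ 3 =
      cubicA τ ^ 3 := by
    rw [cubicA_pow_three, B₃, C₃]
    field_simp
    ring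
  rw [A₃Germ, e]
  exact_mod_cast hτ

lemma isContinuation_A₂ : IsContinuation A₂Germ thetaSq := by
  refine ⟨isQ_thetaSq_four.mdifferentiable, ?_⟩
  filter_upwards [eventually_eq_cpow isQ_thetaSq_four two_ne_zero] with τ hτ
  have h2 := etaMul_ne_zero (δ := 2) (by norm_num) τ
  have e : (2 ^ 4 * etaMul 4 τ ^ 8 + etaMul 1 τ ^ 8) / (etaMul 2 τ ^ 2) ^ 2 = thetaSq τ ^ 2 := by
    rw [thetaSq_sq, B₂, C₂]
    field_simp
    ring
  rw [A₂Germ, e]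
  exact_mod_cast hτ

lemma A₄Sq_eq : A₄Sq = eisTwo := continuation_eq isContinuation_A₄Sq

lemma A₃_eq : A₃ = cubicA := continuation_eq isContinuation_A₃

lemma A₂_eq : A₂ = thetaSq := continuation_eq isContinuation_A₂

/-! ### From identities to rows of the table -/

/-- A row of even weight: the function is a combination of `E_k(q)`, `E_k(q^L)`, `E_k(q^M)`. -/
lemma FrickePair.row_one {N : ℕ} [NeZero N] {k : ℕ} {f g : ℍ → ℂ} (h : FrickePair N k f g)
    (h2 : 2 ≤ N) (h4 : N ≤ 4) (hk : k = 2 ∨ k = 4 ∨ k = 6) {c : Fin N → ℂ} {κ a₀ : ℂ} {e : ℂ → ℂ}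
    (α β γ : ℂ) (L M : ℕ) (hL : L ∣ N) (hM : M ∣ N)
    (hc : ∀ i : Fin N, κ * c i = eisConst k *
      (α + β * multWeight (k - 1) L i + γ * multWeight (k - 1) M i))
    (he : ∀ q, e q = α * E k q + β * E k (q ^ L) + γ * E k (q ^ M))
    (hf : ∀ τ, f τ = e (nome τ)) (h0 : α + β + γ = a₀) :
    Row N 1 k f a₀ (fun n => κ * divSum (k - 1) c n) e where
  modular := h.isModularFormWithChar h2 h4 1 (by
    rw [MulChar.one_apply isUnit_one.neg]
    rcases hk with rfl | rfl | rfl <;> norm_num)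
  qExpansion τ := by
    have := hasSum_divSum hk L M hL hM hc τ
    rwa [← he, ← hf, h0] at this
  eisenstein := hf

/-- A row of odd weight: the function is a combination of the two Lambert series attached to the
character. -/
lemma FrickePair.row_odd {N : ℕ} [NeZero N] {k : ℕ} {f g : ℍ → ℂ} (h : FrickePair N k f g)
    (h2 : 2 ≤ N) (h4 : N ≤ 4) (hk : Odd k) {χ : DirichletCharacter ℂ N} (hχ : χ (-1) = -1)
    {a₀ α β : ℂ} {a : ℕ → ℂ} {e : ℂ → ℂ}
    (ha : ∀ n, a n = α * weightedDivSum (k - 1) (fun d _ => χ d * 1) n +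
      β * weightedDivSum (k - 1) (fun _ m => 1 * χ m) n)
    (hf : ∀ τ, f τ = a₀ + (α * lambert (k - 1) χ (fun _ => 1) (nome τ) +
      β * lambert (k - 1) (fun _ => 1) χ (nome τ)))
    (he : ∀ q, ‖q‖ < 1 → e q = a₀ + (α * lambert (k - 1) χ (fun _ => 1) q +
      β * lambert (k - 1) (fun _ => 1) χ q)) :
    Row N χ k f a₀ a e where
  modular := h.isModularFormWithChar h2 h4 χ (by rw [hχ, hk.neg_one_pow])
  qExpansion τ := by
    have hq := norm_nome_lt_one τ
    have := ((hasSum_lambert (k - 1) χ (fun _ => 1) hq).mul_left α).add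
      ((hasSum_lambert (k - 1) (fun _ => 1) χ hq).mul_left β)
    rw [hf, add_sub_cancel_left]
    refine this.congr_fun fun n => ?_
    rw [ha]
    ring
  eisenstein τ := by rw [hf, he _ (norm_nome_lt_one τ)]

lemma vec_eq_chi3 (d : ℕ) : (![0, 1, -1] : Fin 3 → ℂ) (Fin.ofNat 3 d) = chi3 d := by
  have h : ∀ i : Fin 3, (![0, 1, -1] : Fin 3 → ℂ) i = chi3 (i : ℕ) := by
    intro i
    fin_cases i <;> simp [chi3_zero, chi3_one, chi3_two]
  rw [h, Fin.val_ofNat, ZMod.natCast_mod]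

lemma vec_eq_chi4 (d : ℕ) : (![0, 1, 0, -1] : Fin 4 → ℂ) (Fin.ofNat 4 d) = chi4 d := by
  have h : ∀ i : Fin 4, (![0, 1, 0, -1] : Fin 4 → ℂ) i = chi4 (i : ℕ) := by
    intro i
    fin_cases i <;> simp [chi4_zero, chi4_one, chi4_two, chi4_three]
  rw [h, Fin.val_ofNat, ZMod.natCast_mod]

lemma divSum_chi3 (k n : ℕ) :
    divSum k ![0, 1, -1] n = weightedDivSum k (fun d _ => chi3 d * 1) n := by
  simp only [divSum_eq_weightedDivSum, vec_eq_chi3, mul_one]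

lemma conjDivSum_chi3 (k n : ℕ) :
    conjDivSum k ![0, 1, -1] n = weightedDivSum k (fun _ m => 1 * chi3 m) n := by
  simp only [conjDivSum_eq_weightedDivSum, vec_eq_chi3, one_mul]

lemma divSum_chi4 (k n : ℕ) :
    divSum k ![0, 1, 0, -1] n = weightedDivSum k (fun d _ => chi4 d * 1) n := by
  simp only [divSum_eq_weightedDivSum, vec_eq_chi4, mul_one]

lemma conjDivSum_chi4 (k n : ℕ) :
    conjDivSum k ![0, 1, 0, -1] n = weightedDivSum k (fun _ m => 1 * chi4 m) n := by
  simp only [conjDivSum_eq_weightedDivSum, vec_eq_chi4, one_mul]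

lemma eisenstein_one_chi3 {q : ℂ} (hq : ‖q‖ < 1) :
    eisenstein 1 triv chi3 q = 1 + 6 * lambert 0 chi3 (fun _ => 1) q := by
  rw [eisenstein_triv_left (by rw [Nat.cast_one, sub_self, LFunction_chi3_zero]) hq]
  norm_num

lemma eisenstein_three_chi3 {q : ℂ} (hq : ‖q‖ < 1) :
    eisenstein 3 triv chi3 q = 1 - 9 * lambert 2 chi3 (fun _ => 1) q := by
  rw [eisenstein_triv_left (by
    rw [show (1 - ((3 : ℕ) : ℂ)) = -2 by norm_num, LFunction_chi3_neg_two]) hq]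
  norm_num
  ring

lemma eisenstein_five_chi3 {q : ℂ} (hq : ‖q‖ < 1) :
    eisenstein 5 triv chi3 q = 1 + 3 * lambert 4 chi3 (fun _ => 1) q := by
  rw [eisenstein_triv_left (by
    rw [show (1 - ((5 : ℕ) : ℂ)) = -4 by norm_num, LFunction_chi3_neg_four]) hq]
  norm_num

lemma eisenstein_one_chi4 {q : ℂ} (hq : ‖q‖ < 1) :
    eisenstein 1 triv chi4 q = 1 + 4 * lambert 0 chi4 (fun _ => 1) q := by
  rw [eisenstein_triv_left (by rw [Nat.cast_one, sub_self, LFunction_chi4_zero]) hq]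
  norm_num

lemma eisenstein_three_chi4 {q : ℂ} (hq : ‖q‖ < 1) :
    eisenstein 3 triv chi4 q = 1 - 4 * lambert 2 chi4 (fun _ => 1) q := by
  rw [eisenstein_triv_left (by
    rw [show (1 - ((3 : ℕ) : ℂ)) = -2 by norm_num, LFunction_chi4_neg_two]) hq]
  norm_num
  ring

/-! ### The rows of level two -/

lemma row_A₄_pow_two : Row 2 1 2 eisTwo 1 (fun n => 24 * divSum 1 ![0, 1] n)
    (fun q => 2 * E 2 (q ^ 2) - E 2 q) :=
  frickePair_eisTwo.row_one le_rfl (by norm_num) (by simp) (-1) 2 0 2 1 (by norm_num) (by norm_num)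
    (fun i => by fin_cases i <;> norm_num [eisConst, multWeight]) (fun q => by ring)
    (fun τ => rfl) (by norm_num)

lemma row_A₄_pow_four : Row 2 1 4 (fun τ => eisTwo τ ^ 2) 1 (fun n => 24 * divSum 3 ![3, 2] n)
    (fun q => 1 / 5 * (4 * E 4 (q ^ 2) + E 4 q)) :=
  (frickePair_eisTwo.pow 2).row_one le_rfl (by norm_num) (by simp) (1 / 5) (4 / 5) 0 2 1
    (by norm_num) (by norm_num)
    (fun i => by fin_cases i <;> norm_num [eisConst, multWeight]) (fun q => by ring)
    (fun τ => by rw [eisTwo_sq, B₄_pow_eq, C₄_pow_eq]; ring) (by norm_num)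

lemma row_B₄_pow_four : Row 2 1 4 (fun τ => B₄ τ ^ 4) 1 (fun n => -16 * divSum 3 ![-1, 1] n)
    (fun q => 1 / 15 * (16 * E 4 (q ^ 2) - E 4 q)) :=
  frickePair_B₄_pow.row_one le_rfl (by norm_num) (by simp) (-1 / 15) (16 / 15) 0 2 1
    (by norm_num) (by norm_num)
    (fun i => by fin_cases i <;> norm_num [eisConst, multWeight]) (fun q => by ring)
    B₄_pow_eq (by norm_num)

lemma row_C₄_pow_four : Row 2 1 4 (fun τ => C₄ τ ^ 4) 0 (fun n => 8 * divSum 3 ![7, 8] n)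
    (fun q => -(4 / 15) * (E 4 (q ^ 2) - E 4 q)) :=
  frickePair_C₄_pow.row_one le_rfl (by norm_num) (by simp) (4 / 15) (-4 / 15) 0 2 1
    (by norm_num) (by norm_num)
    (fun i => by fin_cases i <;> norm_num [eisConst, multWeight]) (fun q => by ring)
    C₄_pow_eq (by norm_num)

lemma row_A₄_pow_six : Row 2 1 6 (fun τ => eisTwo τ ^ 3) 1 (fun n => 18 * divSum 5 ![3, 4] n)
    (fun q => 1 / 7 * (8 * E 6 (q ^ 2) - E 6 q)) :=
  (frickePair_eisTwo.pow 3).row_one le_rfl (by norm_num) (by simp) (-1 / 7) (8 / 7) 0 2 1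
    (by norm_num) (by norm_num)
    (fun i => by fin_cases i <;> norm_num [eisConst, multWeight]) (fun q => by ring)
    (fun τ => by
      linear_combination eisTwo τ * eisTwo_sq τ + eisTwo_mul_B₄_pow τ + eisTwo_mul_C₄_pow τ)
    (by norm_num)

lemma row_A₄_mul_B₄ : Row 2 1 6 (fun τ => eisTwo τ * B₄ τ ^ 4) 1
    (fun n => 8 * divSum 5 ![-1, 1] n) (fun q => 1 / 63 * (64 * E 6 (q ^ 2) - E 6 q)) :=
  (frickePair_eisTwo.mul frickePair_B₄_pow).row_one le_rfl (by norm_num) (by simp) (-1 / 63)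
    (64 / 63) 0 2 1 (by norm_num) (by norm_num)
    (fun i => by fin_cases i <;> norm_num [eisConst, multWeight]) (fun q => by ring)
    eisTwo_mul_B₄_pow (by norm_num)

lemma row_A₄_mul_C₄ : Row 2 1 6 (fun τ => eisTwo τ * C₄ τ ^ 4) 0
    (fun n => 2 * divSum 5 ![31, 32] n) (fun q => 8 / 63 * (E 6 (q ^ 2) - E 6 q)) :=
  (frickePair_eisTwo.mul frickePair_C₄_pow).row_one le_rfl (by norm_num) (by simp) (-8 / 63)
    (8 / 63) 0 2 1 (by norm_num) (by norm_num)
    (fun i => by fin_cases i <;> norm_num [eisConst, multWeight]) (fun q => by ring)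
    eisTwo_mul_C₄_pow (by norm_num)

/-! ### The rows of level three -/

lemma row_A₃ : Row 3 chi3 1 cubicA 1 (fun n => 6 * divSum 0 ![0, 1, -1] n)
    (fun q => eisenstein 1 triv chi3 q) :=
  frickePair_cubicA.row_odd (by norm_num) (by norm_num) (by decide) chi3_neg_one (α := 6) (β := 0)
    (fun n => by rw [divSum_chi3]; ring) (fun τ => by rw [cubicA_eq_lambert]; ring)
    (fun q hq => by rw [eisenstein_one_chi3 hq]; ring)

lemma row_A₃_pow_two : Row 3 1 2 (fun τ => cubicA τ ^ 2) 1 (fun n => 12 * divSum 1 ![0, 1, 1] n)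
    (fun q => 1 / 2 * (3 * E 2 (q ^ 3) - E 2 q)) :=
  (frickePair_cubicA.pow 2).row_one (by norm_num) (by norm_num) (by simp) (-1 / 2) (3 / 2) 0 3 1
    (by norm_num) (by norm_num)
    (fun i => by fin_cases i <;> norm_num [eisConst, multWeight]) (fun q => by ring)
    cubicA_sq (by norm_num)

lemma row_A₃_pow_three : Row 3 chi3 3 (fun τ => cubicA τ ^ 3) 1
    (fun n => -9 * divSum 2 ![0, 1, -1] n + 27 * conjDivSum 2 ![0, 1, -1] n)
    (fun q => eisenstein 3 triv chi3 q + 27 / 2 * eisenstein 3 chi3 triv q) :=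
  (frickePair_cubicA.pow 3).row_odd (by norm_num) (by norm_num) (by decide) chi3_neg_one
    (α := -9) (β := 27) (fun n => by rw [divSum_chi3, conjDivSum_chi3])
    (fun τ => by
      rw [cubicA_pow_three, B₃_pow_C₃_pow_eq_lambert.1, B₃_pow_C₃_pow_eq_lambert.2]; ring)
    (fun q hq => by
      rw [eisenstein_three_chi3 hq, eisenstein_triv_right (by norm_num) hq]; ring)

lemma row_B₃_pow_three : Row 3 chi3 3 (fun τ => B₃ τ ^ 3) 1 (fun n => -9 * divSum 2 ![0, 1, -1] n)
    (fun q => eisenstein 3 triv chi3 q) :=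
  frickePair_B₃_pow.row_odd (by norm_num) (by norm_num) (by decide) chi3_neg_one
    (α := -9) (β := 0) (fun n => by rw [divSum_chi3]; ring)
    (fun τ => by rw [B₃_pow_C₃_pow_eq_lambert.1]; ring)
    (fun q hq => by rw [eisenstein_three_chi3 hq]; ring)

lemma row_C₃_pow_three : Row 3 chi3 3 (fun τ => C₃ τ ^ 3) 0
    (fun n => 27 * conjDivSum 2 ![0, 1, -1] n) (fun q => 27 / 2 * eisenstein 3 chi3 triv q) :=
  frickePair_C₃_pow.row_odd (by norm_num) (by norm_num) (by decide) chi3_neg_one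
    (α := 0) (β := 27) (fun n => by rw [conjDivSum_chi3]; ring)
    (fun τ => by rw [B₃_pow_C₃_pow_eq_lambert.2]; ring)
    (fun q hq => by rw [eisenstein_triv_right (by norm_num) hq]; ring)

lemma row_A₃_pow_four : Row 3 1 4 (fun τ => cubicA τ ^ 4) 1 (fun n => 8 * divSum 3 ![4, 3, 3] n)
    (fun q => 1 / 10 * (9 * E 4 (q ^ 3) + E 4 q)) :=
  (frickePair_cubicA.pow 4).row_one (by norm_num) (by norm_num) (by simp) (1 / 10) (9 / 10) 0 3 1
    (by norm_num) (by norm_num)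
    (fun i => by fin_cases i <;> norm_num [eisConst, multWeight]) (fun q => by ring)
    (fun τ => by
      linear_combination cubicA τ * cubicA_pow_three τ + cubicA_mul_B₃_pow τ + cubicA_mul_C₃_pow τ)
    (by norm_num)

lemma row_A₃_mul_B₃ : Row 3 1 4 (fun τ => cubicA τ * B₃ τ ^ 3) 1
    (fun n => -3 * divSum 3 ![-2, 1, 1] n) (fun q => 1 / 80 * (81 * E 4 (q ^ 3) - E 4 q)) :=
  (frickePair_cubicA.mul frickePair_B₃_pow).row_one (by norm_num) (by norm_num) (by simp)
    (-1 / 80) (81 / 80) 0 3 1 (by norm_num) (by norm_num)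
    (fun i => by fin_cases i <;> norm_num [eisConst, multWeight]) (fun q => by ring)
    cubicA_mul_B₃_pow (by norm_num)

lemma row_A₃_mul_C₃ : Row 3 1 4 (fun τ => cubicA τ * C₃ τ ^ 3) 0
    (fun n => divSum 3 ![26, 27, 27] n) (fun q => -(9 / 80) * (E 4 (q ^ 3) - E 4 q)) := by
  have h := (frickePair_cubicA.mul frickePair_C₃_pow).row_one (c := ![26, 27, 27]) (κ := 1)
    (e := fun q => -(9 / 80) * (E 4 (q ^ 3) - E 4 q)) (a₀ := 0)
    (by norm_num) (by norm_num) (by simp) (9 / 80) (-9 / 80) 0 3 1 (by norm_num) (by norm_num)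
    (fun i => by fin_cases i <;> norm_num [eisConst, multWeight]) (fun q => by ring)
    cubicA_mul_C₃_pow (by norm_num)
  simpa only [one_mul] using h

lemma row_A₃_pow_five : Row 3 chi3 5 (fun τ => cubicA τ ^ 5) 1
    (fun n => 3 * divSum 4 ![0, 1, -1] n + 27 * conjDivSum 4 ![0, 1, -1] n)
    (fun q => eisenstein 5 triv chi3 q + 27 / 2 * eisenstein 5 chi3 triv q) :=
  (frickePair_cubicA.pow 5).row_odd (by norm_num) (by norm_num) (by decide) chi3_neg_one
    (α := 3) (β := 27) (fun n => by rw [divSum_chi3, conjDivSum_chi3])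
    (fun τ => by
      linear_combination cubicA τ ^ 2 * cubicA_pow_three τ + cubicA_sq_mul_eq_lambert.1 τ +
        cubicA_sq_mul_eq_lambert.2 τ)
    (fun q hq => by
      rw [eisenstein_five_chi3 hq, eisenstein_triv_right (by norm_num) hq]; ring)

lemma row_A₃_sq_mul_B₃ : Row 3 chi3 5 (fun τ => cubicA τ ^ 2 * B₃ τ ^ 3) 1
    (fun n => 3 * divSum 4 ![0, 1, -1] n) (fun q => eisenstein 5 triv chi3 q) :=
  ((frickePair_cubicA.pow 2).mul frickePair_B₃_pow).row_odd (by norm_num) (by norm_num)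
    (by decide) chi3_neg_one (α := 3) (β := 0) (fun n => by rw [divSum_chi3]; ring)
    (fun τ => by rw [cubicA_sq_mul_eq_lambert.1]; ring)
    (fun q hq => by rw [eisenstein_five_chi3 hq]; ring)

lemma row_A₃_sq_mul_C₃ : Row 3 chi3 5 (fun τ => cubicA τ ^ 2 * C₃ τ ^ 3) 0
    (fun n => 27 * conjDivSum 4 ![0, 1, -1] n) (fun q => 27 / 2 * eisenstein 5 chi3 triv q) :=
  ((frickePair_cubicA.pow 2).mul frickePair_C₃_pow).row_odd (by norm_num) (by norm_num)
    (by decide) chi3_neg_one (α := 0) (β := 27) (fun n => by rw [conjDivSum_chi3]; ring)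
    (fun τ => by rw [cubicA_sq_mul_eq_lambert.2]; ring)
    (fun q hq => by rw [eisenstein_triv_right (by norm_num) hq]; ring)

/-! ### The rows of level four -/

lemma thetaSq_sq_mul_B₂_sq_eq (τ : ℍ) : thetaSq τ ^ 2 * B₂ τ ^ 2 =
    1 / 15 * (16 * E 4 (nome τ ^ 4) - E 4 (nome τ ^ 2)) := by
  rw [thetaSq_mul_B₂_sq, B₄_pow_eq, nome_scale, ← pow_mul]

lemma thetaSq_sq_mul_C₂_sq_eq (τ : ℍ) : thetaSq τ ^ 2 * C₂ τ ^ 2 =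
    -(1 / 15) * (E 4 (nome τ ^ 2) - E 4 (nome τ)) := by
  rw [thetaSq_mul_C₂_sq, C₄_pow_eq]
  ring

lemma C₂_pow_four_eq (τ : ℍ) :
    (C₂ τ ^ 2) ^ 2 = -(16 / 15) * (E 4 (nome τ ^ 4) - E 4 (nome τ ^ 2)) := by
  rw [← pow_mul, C₂_pow_four, C₄_pow_eq, nome_scale, ← pow_mul]
  ring

lemma row_A₂ : Row 4 chi4 1 thetaSq 1 (fun n => 4 * divSum 0 ![0, 1, 0, -1] n)
    (fun q => eisenstein 1 triv chi4 q) :=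
  frickePair_thetaSq.row_odd (by norm_num) le_rfl (by decide) chi4_neg_one (α := 4) (β := 0)
    (fun n => by rw [divSum_chi4]; ring) (fun τ => by rw [thetaSq_eq_lambert]; ring)
    (fun q hq => by rw [eisenstein_one_chi4 hq]; ring)

lemma row_A₂_pow_two : Row 4 1 2 (fun τ => thetaSq τ ^ 2) 1
    (fun n => 8 * divSum 1 ![0, 1, 1, 1] n) (fun q => 1 / 3 * (4 * E 2 (q ^ 4) - E 2 q)) :=
  (frickePair_thetaSq.pow 2).row_one (by norm_num) le_rfl (by simp) (-1 / 3) (4 / 3) 0 4 1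
    (by norm_num) (by norm_num)
    (fun i => by fin_cases i <;> norm_num [eisConst, multWeight]) (fun q => by ring)
    thetaSq_sq_eq_eis (by norm_num)

lemma row_B₂_pow_two : Row 4 1 2 (fun τ => B₂ τ ^ 2) 1 (fun n => -8 * divSum 1 ![0, 1, -2, 1] n)
    (fun q => 1 / 3 * (8 * E 2 (q ^ 4) - 6 * E 2 (q ^ 2) + E 2 q)) :=
  frickePair_B₂_sq.row_one (by norm_num) le_rfl (by simp) (1 / 3) (-2) (8 / 3) 2 4
    (by norm_num) (by norm_num)
    (fun i => by fin_cases i <;> norm_num [eisConst, multWeight]) (fun q => by ring)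
    B₂_sq_eq_eis (by norm_num)

lemma row_C₂_pow_two : Row 4 1 2 (fun τ => C₂ τ ^ 2) 0 (fun n => 8 * divSum 1 ![0, 2, -1, 2] n)
    (fun q => -(2 / 3) * (2 * E 2 (q ^ 4) - 3 * E 2 (q ^ 2) + E 2 q)) :=
  frickePair_C₂_sq.row_one (by norm_num) le_rfl (by simp) (-2 / 3) 2 (-4 / 3) 2 4
    (by norm_num) (by norm_num)
    (fun i => by fin_cases i <;> norm_num [eisConst, multWeight]) (fun q => by ring)
    C₂_sq_eq_eis (by norm_num)

lemma row_A₂_pow_three : Row 4 chi4 3 (fun τ => thetaSq τ ^ 3) 1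
    (fun n => -4 * divSum 2 ![0, 1, 0, -1] n + 16 * conjDivSum 2 ![0, 1, 0, -1] n)
    (fun q => eisenstein 3 triv chi4 q + 8 * eisenstein 3 chi4 triv q) :=
  (frickePair_thetaSq.pow 3).row_odd (by norm_num) le_rfl (by decide) chi4_neg_one
    (α := -4) (β := 16) (fun n => by rw [divSum_chi4, conjDivSum_chi4])
    (fun τ => by
      linear_combination thetaSq τ * thetaSq_sq τ + thetaSq_mul_eq_lambert.1 τ +
        thetaSq_mul_eq_lambert.2 τ)
    (fun q hq => by
      rw [eisenstein_three_chi4 hq, eisenstein_triv_right (by norm_num) hq]; ring)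

lemma row_A₂_mul_B₂ : Row 4 chi4 3 (fun τ => thetaSq τ * B₂ τ ^ 2) 1
    (fun n => -4 * divSum 2 ![0, 1, 0, -1] n) (fun q => eisenstein 3 triv chi4 q) :=
  (frickePair_thetaSq.mul frickePair_B₂_sq).row_odd (by norm_num) le_rfl (by decide) chi4_neg_one
    (α := -4) (β := 0) (fun n => by rw [divSum_chi4]; ring)
    (fun τ => by rw [thetaSq_mul_eq_lambert.1]; ring)
    (fun q hq => by rw [eisenstein_three_chi4 hq]; ring)

lemma row_A₂_mul_C₂ : Row 4 chi4 3 (fun τ => thetaSq τ * C₂ τ ^ 2) 0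
    (fun n => 16 * conjDivSum 2 ![0, 1, 0, -1] n) (fun q => 8 * eisenstein 3 chi4 triv q) :=
  (frickePair_thetaSq.mul frickePair_C₂_sq).row_odd (by norm_num) le_rfl (by decide) chi4_neg_one
    (α := 0) (β := 16) (fun n => by rw [conjDivSum_chi4]; ring)
    (fun τ => by rw [thetaSq_mul_eq_lambert.2]; ring)
    (fun q hq => by rw [eisenstein_triv_right (by norm_num) hq]; ring)

lemma row_A₂_pow_four : Row 4 1 4 (fun τ => thetaSq τ ^ 4) 1
    (fun n => 4 * divSum 3 ![4, 4, 3, 4] n)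
    (fun q => 1 / 15 * (16 * E 4 (q ^ 4) - 2 * E 4 (q ^ 2) + E 4 q)) :=
  (frickePair_thetaSq.pow 4).row_one (by norm_num) le_rfl (by simp) (1 / 15) (-2 / 15) (16 / 15) 2 4
    (by norm_num) (by norm_num)
    (fun i => by fin_cases i <;> norm_num [eisConst, multWeight]) (fun q => by ring)
    (fun τ => by
      linear_combination thetaSq τ ^ 2 * thetaSq_sq τ + thetaSq_sq_mul_B₂_sq_eq τ +
        thetaSq_sq_mul_C₂_sq_eq τ)
    (by norm_num)

lemma row_B₂_pow_four : Row 4 1 4 (fun τ => B₂ τ ^ 4) 1 (fun n => -16 * divSum 3 ![-1, 1] n)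
    (fun q => 1 / 15 * (16 * E 4 (q ^ 2) - E 4 q)) where
  modular := by
    have h := (frickePair_B₂_sq.pow 2).isModularFormWithChar (by norm_num) le_rfl 1 (by
      rw [MulChar.one_apply isUnit_one.neg]; norm_num)
    simpa only [← pow_mul] using h
  qExpansion := row_B₄_pow_four.qExpansion
  eisenstein := row_B₄_pow_four.eisenstein

lemma row_C₂_pow_four : Row 4 1 4 (fun τ => C₂ τ ^ 4) 0 (fun n => 4 * divSum 3 ![7, 0, 8, 0] n)
    (fun q => -(16 / 15) * (E 4 (q ^ 4) - E 4 (q ^ 2))) := by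
  have h := (frickePair_C₂_sq.pow 2).row_one (c := ![7, 0, 8, 0]) (κ := 4) (a₀ := 0)
    (e := fun q => -(16 / 15) * (E 4 (q ^ 4) - E 4 (q ^ 2))) (by norm_num) le_rfl (by simp) 0
    (16 / 15) (-16 / 15) 2 4 (by norm_num) (by norm_num)
    (fun i => by fin_cases i <;> norm_num [eisConst, multWeight]) (fun q => by ring)
    C₂_pow_four_eq (by norm_num)
  simpa only [← pow_mul] using h

lemma row_A₂_sq_mul_B₂_sq : Row 4 1 4 (fun τ => thetaSq τ ^ 2 * B₂ τ ^ 2) 1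
    (fun n => -2 * divSum 3 ![-1, 0, 1, 0] n)
    (fun q => 1 / 15 * (16 * E 4 (q ^ 4) - E 4 (q ^ 2))) :=
  ((frickePair_thetaSq.pow 2).mul frickePair_B₂_sq).row_one (by norm_num) le_rfl (by simp)
    0 (-1 / 15) (16 / 15) 2 4 (by norm_num) (by norm_num)
    (fun i => by fin_cases i <;> norm_num [eisConst, multWeight]) (fun q => by ring)
    thetaSq_sq_mul_B₂_sq_eq (by norm_num)

lemma row_A₂_sq_mul_C₂_sq : Row 4 1 4 (fun τ => thetaSq τ ^ 2 * C₂ τ ^ 2) 0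
    (fun n => 2 * divSum 3 ![7, 8] n) (fun q => -(1 / 15) * (E 4 (q ^ 2) - E 4 q)) where
  modular := ((frickePair_thetaSq.pow 2).mul frickePair_C₂_sq).isModularFormWithChar (by norm_num)
    le_rfl 1 (by rw [MulChar.one_apply isUnit_one.neg]; norm_num)
  qExpansion τ := by
    have h := (row_C₄_pow_four.qExpansion τ).div_const 4
    rw [sub_zero, ← thetaSq_mul_C₂_sq] at h
    rw [sub_zero]
    exact h.congr_fun fun n => by ring
  eisenstein := thetaSq_sq_mul_C₂_sq_eq

lemma row_B₂_sq_mul_C₂_sq : Row 4 1 4 (fun τ => B₂ τ ^ 2 * C₂ τ ^ 2) 0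
    (fun n => 2 * divSum 3 ![-7, 8, -9, 8] n)
    (fun q => 1 / 15 * (16 * E 4 (q ^ 4) - 17 * E 4 (q ^ 2) + E 4 q)) :=
  (frickePair_B₂_sq.mul frickePair_C₂_sq).row_one (by norm_num) le_rfl (by simp)
    (1 / 15) (-17 / 15) (16 / 15) 2 4 (by norm_num) (by norm_num)
    (fun i => by fin_cases i <;> norm_num [eisConst, multWeight]) (fun q => by ring)
    (fun τ => by
      linear_combination -C₂ τ ^ 2 * thetaSq_sq τ + thetaSq_sq_mul_C₂_sq_eq τ - C₂_pow_four_eq τ)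
    (by norm_num)

end RamanujanTriples

theorem mainTheorem8 :
    -- the single-valued functions `𝒜₄²`, `𝒜₃`, `𝒜₂` exist, and `𝒜_r^r = ℬ_r^r + 𝒞_r^r`
    (IsContinuation (fun τ => A₄Germ τ ^ 2) A₄Sq ∧ IsContinuation A₃Germ A₃ ∧
      IsContinuation A₂Germ A₂) ∧
    (∀ τ, A₄Sq τ ^ 2 = B₄ τ ^ 4 + C₄ τ ^ 4) ∧
    (∀ τ, A₃ τ ^ 3 = B₃ τ ^ 3 + C₃ τ ^ 3) ∧
    (∀ τ, A₂ τ ^ 2 = B₂ τ ^ 2 + C₂ τ ^ 2) ∧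
    -- `M₂(Γ₀(2))`
    Row 2 1 2 A₄Sq 1 (fun n => 24 * divSum 1 ![0, 1] n)
      (fun q => 2 * E 2 (q ^ 2) - E 2 q) ∧
    -- `M₄(Γ₀(2))`
    Row 2 1 4 (fun τ => A₄Sq τ ^ 2) 1 (fun n => 24 * divSum 3 ![3, 2] n)
      (fun q => 1 / 5 * (4 * E 4 (q ^ 2) + E 4 q)) ∧
    Row 2 1 4 (fun τ => B₄ τ ^ 4) 1 (fun n => -16 * divSum 3 ![-1, 1] n)
      (fun q => 1 / 15 * (16 * E 4 (q ^ 2) - E 4 q)) ∧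
    Row 2 1 4 (fun τ => C₄ τ ^ 4) 0 (fun n => 8 * divSum 3 ![7, 8] n)
      (fun q => -(4 / 15) * (E 4 (q ^ 2) - E 4 q)) ∧
    -- `M₆(Γ₀(2))`
    Row 2 1 6 (fun τ => A₄Sq τ ^ 3) 1 (fun n => 18 * divSum 5 ![3, 4] n)
      (fun q => 1 / 7 * (8 * E 6 (q ^ 2) - E 6 q)) ∧
    Row 2 1 6 (fun τ => A₄Sq τ * B₄ τ ^ 4) 1 (fun n => 8 * divSum 5 ![-1, 1] n)
      (fun q => 1 / 63 * (64 * E 6 (q ^ 2) - E 6 q)) ∧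
    Row 2 1 6 (fun τ => A₄Sq τ * C₄ τ ^ 4) 0 (fun n => 2 * divSum 5 ![31, 32] n)
      (fun q => 8 / 63 * (E 6 (q ^ 2) - E 6 q)) ∧
    -- `M₁(Γ₀(3), χ₋₃)`
    Row 3 chi3 1 A₃ 1 (fun n => 6 * divSum 0 ![0, 1, -1] n)
      (fun q => eisenstein 1 triv chi3 q) ∧
    -- `M₂(Γ₀(3))`
    Row 3 1 2 (fun τ => A₃ τ ^ 2) 1 (fun n => 12 * divSum 1 ![0, 1, 1] n)
      (fun q => 1 / 2 * (3 * E 2 (q ^ 3) - E 2 q)) ∧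
    -- `M₃(Γ₀(3), χ₋₃)`
    Row 3 chi3 3 (fun τ => A₃ τ ^ 3) 1
      (fun n => -9 * divSum 2 ![0, 1, -1] n + 27 * conjDivSum 2 ![0, 1, -1] n)
      (fun q => eisenstein 3 triv chi3 q + 27 / 2 * eisenstein 3 chi3 triv q) ∧
    Row 3 chi3 3 (fun τ => B₃ τ ^ 3) 1 (fun n => -9 * divSum 2 ![0, 1, -1] n)
      (fun q => eisenstein 3 triv chi3 q) ∧
    Row 3 chi3 3 (fun τ => C₃ τ ^ 3) 0 (fun n => 27 * conjDivSum 2 ![0, 1, -1] n)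
      (fun q => 27 / 2 * eisenstein 3 chi3 triv q) ∧
    -- `M₄(Γ₀(3))`
    Row 3 1 4 (fun τ => A₃ τ ^ 4) 1 (fun n => 8 * divSum 3 ![4, 3, 3] n)
      (fun q => 1 / 10 * (9 * E 4 (q ^ 3) + E 4 q)) ∧
    Row 3 1 4 (fun τ => A₃ τ * B₃ τ ^ 3) 1 (fun n => -3 * divSum 3 ![-2, 1, 1] n)
      (fun q => 1 / 80 * (81 * E 4 (q ^ 3) - E 4 q)) ∧
    Row 3 1 4 (fun τ => A₃ τ * C₃ τ ^ 3) 0 (fun n => divSum 3 ![26, 27, 27] n)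
      (fun q => -(9 / 80) * (E 4 (q ^ 3) - E 4 q)) ∧
    -- `M₅(Γ₀(3), χ₋₃)`
    Row 3 chi3 5 (fun τ => A₃ τ ^ 5) 1
      (fun n => 3 * divSum 4 ![0, 1, -1] n + 27 * conjDivSum 4 ![0, 1, -1] n)
      (fun q => eisenstein 5 triv chi3 q + 27 / 2 * eisenstein 5 chi3 triv q) ∧
    Row 3 chi3 5 (fun τ => A₃ τ ^ 2 * B₃ τ ^ 3) 1 (fun n => 3 * divSum 4 ![0, 1, -1] n)
      (fun q => eisenstein 5 triv chi3 q) ∧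
    Row 3 chi3 5 (fun τ => A₃ τ ^ 2 * C₃ τ ^ 3) 0 (fun n => 27 * conjDivSum 4 ![0, 1, -1] n)
      (fun q => 27 / 2 * eisenstein 5 chi3 triv q) ∧
    -- `M₁(Γ₀(4), χ₋₄)`
    Row 4 chi4 1 A₂ 1 (fun n => 4 * divSum 0 ![0, 1, 0, -1] n)
      (fun q => eisenstein 1 triv chi4 q) ∧
    -- `M₂(Γ₀(4))`
    Row 4 1 2 (fun τ => A₂ τ ^ 2) 1 (fun n => 8 * divSum 1 ![0, 1, 1, 1] n)
      (fun q => 1 / 3 * (4 * E 2 (q ^ 4) - E 2 q)) ∧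
    Row 4 1 2 (fun τ => B₂ τ ^ 2) 1 (fun n => -8 * divSum 1 ![0, 1, -2, 1] n)
      (fun q => 1 / 3 * (8 * E 2 (q ^ 4) - 6 * E 2 (q ^ 2) + E 2 q)) ∧
    Row 4 1 2 (fun τ => C₂ τ ^ 2) 0 (fun n => 8 * divSum 1 ![0, 2, -1, 2] n)
      (fun q => -(2 / 3) * (2 * E 2 (q ^ 4) - 3 * E 2 (q ^ 2) + E 2 q)) ∧
    -- `M₃(Γ₀(4), χ₋₄)`
    Row 4 chi4 3 (fun τ => A₂ τ ^ 3) 1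
      (fun n => -4 * divSum 2 ![0, 1, 0, -1] n + 16 * conjDivSum 2 ![0, 1, 0, -1] n)
      (fun q => eisenstein 3 triv chi4 q + 8 * eisenstein 3 chi4 triv q) ∧
    Row 4 chi4 3 (fun τ => A₂ τ * B₂ τ ^ 2) 1 (fun n => -4 * divSum 2 ![0, 1, 0, -1] n)
      (fun q => eisenstein 3 triv chi4 q) ∧
    Row 4 chi4 3 (fun τ => A₂ τ * C₂ τ ^ 2) 0 (fun n => 16 * conjDivSum 2 ![0, 1, 0, -1] n)
      (fun q => 8 * eisenstein 3 chi4 triv q) ∧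
    -- `M₄(Γ₀(4))`
    Row 4 1 4 (fun τ => A₂ τ ^ 4) 1 (fun n => 4 * divSum 3 ![4, 4, 3, 4] n)
      (fun q => 1 / 15 * (16 * E 4 (q ^ 4) - 2 * E 4 (q ^ 2) + E 4 q)) ∧
    Row 4 1 4 (fun τ => B₂ τ ^ 4) 1 (fun n => -16 * divSum 3 ![-1, 1] n)
      (fun q => 1 / 15 * (16 * E 4 (q ^ 2) - E 4 q)) ∧
    Row 4 1 4 (fun τ => C₂ τ ^ 4) 0 (fun n => 4 * divSum 3 ![7, 0, 8, 0] n)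
      (fun q => -(16 / 15) * (E 4 (q ^ 4) - E 4 (q ^ 2))) ∧
    Row 4 1 4 (fun τ => A₂ τ ^ 2 * B₂ τ ^ 2) 1 (fun n => -2 * divSum 3 ![-1, 0, 1, 0] n)
      (fun q => 1 / 15 * (16 * E 4 (q ^ 4) - E 4 (q ^ 2))) ∧
    Row 4 1 4 (fun τ => A₂ τ ^ 2 * C₂ τ ^ 2) 0 (fun n => 2 * divSum 3 ![7, 8] n)
      (fun q => -(1 / 15) * (E 4 (q ^ 2) - E 4 q)) ∧
    Row 4 1 4 (fun τ => B₂ τ ^ 2 * C₂ τ ^ 2) 0 (fun n => 2 * divSum 3 ![-7, 8, -9, 8] n)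
      (fun q => 1 / 15 * (16 * E 4 (q ^ 4) - 17 * E 4 (q ^ 2) + E 4 q)) := by
  rw [A₄Sq_eq, A₃_eq, A₂_eq]
  exact ⟨⟨isContinuation_A₄Sq, isContinuation_A₃, isContinuation_A₂⟩, eisTwo_sq, cubicA_pow_three,
    thetaSq_sq, row_A₄_pow_two, row_A₄_pow_four, row_B₄_pow_four, row_C₄_pow_four, row_A₄_pow_six,
    row_A₄_mul_B₄, row_A₄_mul_C₄, row_A₃, row_A₃_pow_two, row_A₃_pow_three, row_B₃_pow_three,
    row_C₃_pow_three, row_A₃_pow_four, row_A₃_mul_B₃, row_A₃_mul_C₃, row_A₃_pow_five,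
    row_A₃_sq_mul_B₃, row_A₃_sq_mul_C₃, row_A₂, row_A₂_pow_two, row_B₂_pow_two, row_C₂_pow_two,
    row_A₂_pow_three, row_A₂_mul_B₂, row_A₂_mul_C₂, row_A₂_pow_four, row_B₂_pow_four,
    row_C₂_pow_four, row_A₂_sq_mul_B₂_sq, row_A₂_sq_mul_C₂_sq, row_B₂_sq_mul_C₂_sq⟩
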